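/- Work over $\mathbb C$ with classical varieties, and let $e_1,\dots,e_4$ be the standard basis of $\mathbb C^4$, $E_I=\langle e_i: i\in I\rangle$ for $I\subset\{1,2,3,4\}$, and $G=\mathrm{GL}_4(\mathbb C)$. *Tetrahedra.* Let $Y=\prod_{\varnothing\ne I\subsetneq\{1,2,3,4\}}\mathrm{Gr}_{|I|}(\mathbb C^4)$ with projections $\pi_I$, let $X^\circ\subset Y$ be the $G$-orbit of the point $(E_I)_I$, and let $X$ be the closure of $X^\circ$ in $Y$; put $\pi_\varnothing=0$, $\pi_{1234}=\mathbb C^4$. Let $\mathcal E$ be the set of edges $\alpha=\{I,J\}$ of the hypersimplices $\Delta_k=\mathrm{Conv}\{\varepsilon_I:|I|=k\}\subset\mathbb R^4$, $k=1,2,3$ (subsets of equal size with $|I\cap J|=|I|-1$; write $I<J$ for the lexicographic order), let $\mathcal E_k$ be the set of edges of $\Delta_k$, let $\mathcal H$ be the set of the $19$ faces $\beta$ of dimension $\ge 2$ of $\Delta_1,\Delta_2,\Delta_3$, and let $\mathcal E(\beta)$ be the set of edges of $\beta$. For $\alpha=\{I,J\}$ let $E_\alpha\to X$ be the fibre square of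 the $\mathbb P^1$-bundle with fibre $\mathbb P(\pi_{I\cup J}(p)/\pi_{I\cap J}(p))$ over $p$, let $D_\alpha\subset E_\alpha$ be its diagonal, and let $u_\alpha(p)=(\pi_I(p)/\pi_{I\cap J}(p),\ \pi_J(p)/\pi_{I\cap J}(p))$. For $\beta\in\mathcal H$ let $E_\beta,D_\beta,u_\beta$ be the products over $X$ of the $E_\alpha$, $D_\alpha$, $u_\alpha$ over $\alpha\in\mathcal E(\beta)$, let $b_\beta:(E_\beta)_\#\to E_\beta$ be the blowup along $D_\beta$, and let $E_\#$ be the product over $X$ of the $(E_\beta)_\#$, $\beta\in\mathcal H$. The maps $b_\beta^{-1}\circ u_\beta$ embed $X^\circ$ in $E_\#$; let $\tilde X^\circ$ be the image and $\tilde X$ its closure. *The chart.* Let $U\subset X$ be the set of $p$ such that every $\pi_I(p)$ is transverse to $E_4\subset E_{34}\subset E_{234}$, and let $\tilde U$ be the closure, in the part $E_\#|_U$ of $E_\#$ over $U$, of the part of $\tilde X^\circ$ over $U$. Let $f_{I,J}$ be the ratio of Plücker coordinates $f_J/f_{\{1,\dots,k\}}$ of $\pi_I$, where $k=|I|=|J|$.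 The six *flag coordinates* $f_{1,2},f_{1,3},f_{1,4},f_{12,13},f_{12,14},f_{123,124}$ give a map from $U$ to $\mathbb A_{op}=\mathbb C^6$, and the *edge coordinates* $x_\alpha=f_{J,K}-f_{I,K}$ for $\alpha=\{I,J\}\in\mathcal E_k$, $I<J$, with $K=2,13,124$ for $k=1,2,3$, give a map from $U$ to $\mathbb A_{\mathcal E}=\mathbb C^{\mathcal E}$. For $\beta\in\mathcal H$ let $\mathbb P_\beta=\mathbb P(\mathbb C^{\mathcal E(\beta)})$, with homogeneous coordinates $y_{\alpha,\beta}$. Let $$\Phi:\tilde U\to\mathbb A_{op}\times\mathbb A_{\mathcal E}\times\prod_{\beta\in\mathcal H}\mathbb P_\beta$$ be the morphism given by the flag coordinates, by the edge coordinates and by the natural homogeneous coordinates $y_{\alpha,\beta}$ of the blowups; so at the point of $\tilde X^\circ$ over $p$ one has $y_{\alpha,\beta}=x_\alpha(p)$ for all $\alpha\in\mathcal E(\beta)$, up to a common factor for each $\beta$. The *core* $Z\subset\prod_\beta\mathbb P_\beta$ is the image of $\tilde U$, and $\eta:\tilde U\to Z$ is the induced map. Let $L_k\to Z$ be the pullback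 of the tautological line bundle on $\mathbb P_{\Delta_k}$, and $$N=(\mathbb A_{op}\times Z)\times_Z(L_1\times_Z L_2\times_Z L_3)\ \subset\ \mathbb A_{op}\times\mathbb A_{\mathcal E}\times Z .$$ *Action.* Let $B\subset G$ be the group of lower triangular matrices. It acts on $\tilde U$ through the action of $G$ on $E_\#$, and on $\mathbb A_{op}\times\mathbb A_{\mathcal E}\times\prod_\beta\mathbb P_\beta$ as follows: on $\mathbb A_{op}$ as on the cell of flags in general position to $E_4\subset E_{34}\subset E_{234}$, of which $\mathbb A_{op}$ is the coordinate space; on $x_\alpha$, $\alpha\in\mathcal E_k$, by the character $t_k(b)=b_{k+1,k+1}/b_{kk}$; and trivially on the $\mathbb P_\beta$. **Lemma.** $\tilde U$ is the part of $\tilde X$ over $U$. The core $Z$ is a closed irreducible subvariety of $\prod_\beta\mathbb P_\beta$ of dimension $3$, and $N$ is a vector bundle of rank $9$ over $Z$. The map $\Phi$ is a $B$-equivariant isomorphism of varieties from $\tilde U$ onto $N$, whose composition with the projection $N\to Z$ is $\eta$. Hence $\tilde U$ is smooth if and only if $Z$ is smooth. -/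

import Mathlib

open scoped LinearAlgebra.Projectivization

namespace Tetra

/-! ### Classical complex varieties, as sets of points with homogeneous coordinates -/

/-- A type whose points are given by (multi-)homogeneous coordinate vectors: `rep x` is the set of
all coordinate vectors of the point `x`. The Zariski topology and the regular functions on `X` are
read off from these coordinates. -/
class HomogCoords (X : Type) where
  idx : Type
  rep : X → Set (idx → ℂ)

/-- The complex line, with its affine coordinate. -/
instance instHomogCoordsComplex : HomogCoords ℂ where
  idx := Unit
  rep x := {fun _ => x}

/-- Projective space, with its homogeneous coordinates. -/
instance instHomogCoordsProj (J : Type) : HomogCoords (ℙ ℂ (J → ℂ)) where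
  idx := J
  rep y := {c | c ≠ 0 ∧ c ∈ y.submodule}

/-- Products: the coordinates of all the factors. -/
instance instHomogCoordsPi {ι : Type} (X : ι → Type) [∀ i, HomogCoords (X i)] :
    HomogCoords (∀ i, X i) where
  idx := Σ i, HomogCoords.idx (X i)
  rep x := {c | ∀ i, (fun j => c ⟨i, j⟩) ∈ HomogCoords.rep (x i)}

/-- Binary products. -/
instance instHomogCoordsProd (X Y : Type) [HomogCoords X] [HomogCoords Y] :
    HomogCoords (X × Y) where
  idx := HomogCoords.idx X ⊕ HomogCoords.idx Y
  rep x := {c | (fun j => c (Sum.inl j)) ∈ HomogCoords.rep x.1 ∧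
    (fun j => c (Sum.inr j)) ∈ HomogCoords.rep x.2}

/-- Subvarieties: the induced coordinates. -/
instance instHomogCoordsSubtype {X : Type} [HomogCoords X] (p : X → Prop) :
    HomogCoords {x : X // p x} where
  idx := HomogCoords.idx X
  rep x := HomogCoords.rep x.1

/-- A set is Zariski closed if polynomials in the homogeneous coordinates cut it out. (A polynomial
vanishes at all coordinate vectors of a point iff all its multihomogeneous components do.) -/
def IsZariskiClosed {X : Type} [HomogCoords X] (Z : Set X) : Prop :=
  ∃ S : Set (MvPolynomial (HomogCoords.idx X) ℂ),
    ∀ x, ∀ c ∈ HomogCoords.rep x, (x ∈ Z ↔ ∀ f ∈ S, MvPolynomial.eval c f = 0)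

/-- The Zariski topology. -/
@[reducible] def zariski (X : Type) [HomogCoords X] : TopologicalSpace X :=
  TopologicalSpace.ofClosed {Z : Set X | IsZariskiClosed Z}
    ⟨{1}, fun x c _ => by simp⟩
    (by
      intro A hA
      have hA' : ∀ Z ∈ A, IsZariskiClosed Z := fun Z hZ => hA hZ
      choose! S hS using hA'
      refine ⟨⋃ Z ∈ A, S Z, fun x c hc => ?_⟩
      simp only [Set.mem_sInter, Set.mem_iUnion, forall_exists_index]
      constructor
      · intro h f Z hZ hf
        exact ((hS Z hZ) x c hc).1 (h Z hZ) f hf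
      · intro h Z hZ
        exact ((hS Z hZ) x c hc).2 fun f hf => h f Z hZ hf)
    (by
      rintro Z₁ ⟨S₁, h₁⟩ Z₂ ⟨S₂, h₂⟩
      refine ⟨{h | ∃ f ∈ S₁, ∃ g ∈ S₂, h = f * g}, fun x c hc => ?_⟩
      rw [Set.mem_union, h₁ x c hc, h₂ x c hc]
      constructor
      · rintro (h | h) _ ⟨f, hf, g, hg, rfl⟩
        · simp [h f hf]
        · simp [h g hg]
      · intro h
        by_contra hne
        push Not at hne
        obtain ⟨⟨f, hf, hf0⟩, ⟨g, hg, hg0⟩⟩ := hne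
        have := h _ ⟨f, hf, g, hg, rfl⟩
        rw [map_mul] at this
        exact (mul_ne_zero hf0 hg0) this)

/-- The Zariski closure of `S` inside the subset `A`. -/
def closureIn {X : Type} [HomogCoords X] (A S : Set X) : Set X :=
  A ∩ @closure X (zariski X) S

/-- `f` is regular at `x`: near `x` it is a quotient of polynomials in the coordinates, whose
denominator does not vanish at `x`. -/
def IsRegularAt {X : Type} [HomogCoords X] (f : X → ℂ) (x : X) : Prop :=
  ∃ P Q : MvPolynomial (HomogCoords.idx X) ℂ,
    (∀ c ∈ HomogCoords.rep x, MvPolynomial.eval c Q ≠ 0) ∧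
    ∀ y, ∀ c ∈ HomogCoords.rep y, MvPolynomial.eval c Q ≠ 0 →
      f y = MvPolynomial.eval c P / MvPolynomial.eval c Q

/-- A morphism of varieties: a continuous map that pulls regular functions back to regular
functions. -/
def IsMorphism {X Y : Type} [HomogCoords X] [HomogCoords Y] (φ : X → Y) : Prop :=
  @Continuous X Y (zariski X) (zariski Y) φ ∧
    ∀ (g : Y → ℂ) (x : X), IsRegularAt g (φ x) → IsRegularAt (g ∘ φ) x

/-- An isomorphism of varieties. -/
def IsVarietyIso {X Y : Type} [HomogCoords X] [HomogCoords Y] (φ : X ≃ Y) : Prop :=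
  IsMorphism φ ∧ IsMorphism φ.symm

/-- The local ring of `X` at `x`: germs at `x` of functions that are regular at `x`. -/
def localRing (X : Type) [HomogCoords X] (x : X) :
    Subring (Filter.Germ (@nhds X (zariski X) x) ℂ) where
  carrier := {g | ∃ f : X → ℂ, IsRegularAt f x ∧ g = (f : Filter.Germ _ ℂ)}
  zero_mem' := ⟨0, ⟨0, 1, by simp, by simp⟩, rfl⟩
  one_mem' := ⟨1, ⟨1, 1, by simp, by simp⟩, rfl⟩
  add_mem' := by
    rintro _ _ ⟨f, ⟨P, Q, hQ, h⟩, rfl⟩ ⟨f', ⟨P', Q', hQ', h'⟩, rfl⟩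
    refine ⟨f + f', ⟨P * Q' + P' * Q, Q * Q', ?_, ?_⟩, rfl⟩
    · intro c hc
      rw [map_mul]
      exact mul_ne_zero (hQ c hc) (hQ' c hc)
    · intro y c hc hne
      rw [map_mul] at hne
      have h1 := left_ne_zero_of_mul hne
      have h2 := right_ne_zero_of_mul hne
      simp only [Pi.add_apply, h y c hc h1, h' y c hc h2, map_add, map_mul]
      field_simp
  mul_mem' := by
    rintro _ _ ⟨f, ⟨P, Q, hQ, h⟩, rfl⟩ ⟨f', ⟨P', Q', hQ', h'⟩, rfl⟩
    refine ⟨f * f', ⟨P * P', Q * Q', ?_, ?_⟩, rfl⟩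
    · intro c hc
      rw [map_mul]
      exact mul_ne_zero (hQ c hc) (hQ' c hc)
    · intro y c hc hne
      rw [map_mul] at hne
      have h1 := left_ne_zero_of_mul hne
      have h2 := right_ne_zero_of_mul hne
      simp only [Pi.mul_apply, h y c hc h1, h' y c hc h2, map_mul]
      field_simp
  neg_mem' := by
    rintro _ ⟨f, ⟨P, Q, hQ, h⟩, rfl⟩
    refine ⟨-f, ⟨-P, Q, hQ, ?_⟩, rfl⟩
    intro y c hc hne
    simp only [Pi.neg_apply, h y c hc hne, map_neg, neg_div]

/-- A variety is smooth if all its local rings are regular. -/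
def IsSmoothVariety (X : Type) [HomogCoords X] : Prop :=
  ∀ x : X, IsRegularLocalRing (localRing X x)

/-- The total space over `O` of the family `F` of subspaces of `W`. -/
abbrev TotalSpace {W B : Type} [AddCommGroup W] [Module ℂ W] (F : B → Submodule ℂ W) (O : Set B) :
    Type :=
  {n : W × B // n.2 ∈ O ∧ n.1 ∈ F n.2}

/-- The family `F` of subspaces of `W` is a vector bundle of rank `r` over `Z`: it is locally
isomorphic to a product with `ℂ ^ r`, as a variety over `Z` and linearly on the fibres. -/
def IsVectorBundle {W B : Type} [AddCommGroup W] [Module ℂ W] [HomogCoords W] [HomogCoords B]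
    (Z : Set B) (F : B → Submodule ℂ W) (r : ℕ) : Prop :=
  ∀ z₀ ∈ Z, ∃ O ⊆ Z, z₀ ∈ O ∧ IsZariskiClosed {z : Z | z.1 ∉ O} ∧
    ∃ ψ : TotalSpace F O ≃ O × (Fin r → ℂ), IsVarietyIso ψ ∧
      (∀ n, ((ψ n).1 : B) = n.1.2) ∧
      ∀ z : O, ∃ L : F z.1 ≃ₗ[ℂ] (Fin r → ℂ), ∀ w : F z.1,
        (ψ ⟨(w.1, z.1), z.2, w.2⟩).2 = L w

/-! ### Grassmannians of `ℂ⁴` -/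

/-- The points of all the Grassmannians of `ℂ⁴`. The coordinate `i : Fin 4` is the element `i + 1`
of the label set `{1, 2, 3, 4}`. -/
abbrev Gras : Type := Submodule ℂ (Fin 4 → ℂ)

/-- The Plücker coordinates of a `k`-tuple of vectors: its `k × k` minors (and `0` at the subsets of
the wrong size). -/
noncomputable def plucker {k : ℕ} (v : Fin k → Fin 4 → ℂ) (A : Finset (Fin 4)) : ℂ :=
  if h : A.card = k then (Matrix.of fun i j : Fin k => v i (A.orderEmbOfFin h j)).det else 0

/-- A subspace has as homogeneous coordinates the Plücker coordinates of its bases. -/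
instance instHomogCoordsGras : HomogCoords Gras where
  idx := Finset (Fin 4)
  rep W := {c | ∃ (k : ℕ) (v : Fin k → Fin 4 → ℂ), LinearIndependent ℂ v ∧
    Submodule.span ℂ (Set.range v) = W ∧ c = plucker v}

/-- The ratio `f_A / f_B` of Plücker coordinates of the subspace `W`. -/
noncomputable def pluckerRatio (W : Gras) (A B : Finset (Fin 4)) : ℂ :=
  plucker (fun i => (Module.finBasis ℂ W i : Fin 4 → ℂ)) A /
    plucker (fun i => (Module.finBasis ℂ W i : Fin 4 → ℂ)) B

/-- `π` and `V` are transverse: their intersection is as small as their dimensions permit. -/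
def Transverse (π V : Gras) : Prop := π ⊓ V = ⊥ ∨ π ⊔ V = ⊤

/-- The group `GL₄(ℂ)`. -/
abbrev G : Type := Matrix.GeneralLinearGroup (Fin 4) ℂ

/-- The translate `b · W` of a subspace. -/
def translate (b : G) (W : Gras) : Gras := W.map (Matrix.toLin' (b : Matrix (Fin 4) (Fin 4) ℂ))

/-- The coordinate subspace `E_I`. -/
def coordSubspace (I : Finset (Fin 4)) : Gras :=
  Submodule.span ℂ ((fun i => (Pi.single i 1 : Fin 4 → ℂ)) '' (I : Set (Fin 4)))

/-! ### The space of tetrahedra -/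

/-- Families of subspaces labelled by the subsets of `{1, 2, 3, 4}`. -/
abbrev Config : Type := Finset (Fin 4) → Gras

/-- The product of Grassmannians `Gr_I`; the factors at `∅` and at the full set are the single points
`0` and `ℂ⁴`. -/
def prodGr : Set Config := {p | ∀ I, Module.finrank ℂ (p I) = I.card}

/-- The nondegenerate tetrahedra: the `G`-orbit of the coordinate tetrahedron. -/
def nondegTetrahedra : Set Config := {p | ∃ b : G, ∀ I, p I = translate b (coordSubspace I)}

/-- The space of tetrahedra `X`. -/
def tetrahedra : Set Config := closureIn prodGr nondegTetrahedra

/-! ### Hypersimplices -/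

/-- The edges `α = {I, J}` of the hypersimplices, written with `I < J`: the sets `I` and `J` have the
same size and differ by exchanging one element `i ∈ I` for an element `j ∈ J`; then `I < J` in the
lexicographic order iff `i < j`. -/
abbrev Edge : Type :=
  {α : Finset (Fin 4) × Finset (Fin 4) //
    α.1.card = α.2.card ∧ (α.1 ∩ α.2).card + 1 = α.1.card ∧
      ∃ i ∈ α.1 \ α.2, ∃ j ∈ α.2 \ α.1, i < j}

/-- The faces of dimension at least two of the hypersimplices. Each face of the hypersimplex of rank
`k` has as its vertices the sets `I` of size `k` with `A ⊆ I ⊆ B` for some `A ⊆ B`; when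
`|A| < k < |B|` its dimension is `|B \ A| - 1`. -/
structure Face where
  lower : Finset (Fin 4)
  upper : Finset (Fin 4)
  rank : ℕ
  lower_subset : lower ⊆ upper
  three_le : 3 ≤ (upper \ lower).card
  lower_lt : lower.card < rank
  lt_upper : rank < upper.card

/-- The hypersimplex of rank `k + 1`, as a face of itself. -/
def hypersimplex (k : Fin 3) : Face where
  lower := ∅
  upper := Finset.univ
  rank := k + 1
  lower_subset := by simp
  three_le := by simp
  lower_lt := by simp
  lt_upper := by have := k.2; simp; omega

/-- `I` is a vertex of the face `β`. -/
abbrev Face.IsVertex (β : Face) (I : Finset (Fin 4)) : Prop :=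
  β.lower ⊆ I ∧ I ⊆ β.upper ∧ I.card = β.rank

/-- The edges of the face `β`. -/
abbrev Face.Edges (β : Face) : Type := {α : Edge // β.IsVertex α.1.1 ∧ β.IsVertex α.1.2}

/-! ### The ambient bundles, the blowups and the complete tetrahedra -/

/-- The bundle `E_β → X`. A point of the fibre of `P_α = ℙ(F_{I ∪ J} / F_{I ∩ J})` over `p` is given
as a subspace `q` with `π_{I ∩ J}(p) ⊆ q ⊆ π_{I ∪ J}(p)` and `dim q = |I|`, and `E_α = P_α ×_X P_α`. -/
def bundleE (β : Face) : Set (Config × (β.Edges → Gras × Gras)) :=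
  {e | e.1 ∈ tetrahedra ∧ ∀ α : β.Edges, ∀ q, (q = (e.2 α).1 ∨ q = (e.2 α).2) →
    e.1 (α.1.1.1 ∩ α.1.1.2) ≤ q ∧ q ≤ e.1 (α.1.1.1 ∪ α.1.1.2) ∧
      Module.finrank ℂ q = α.1.1.1.card}

/-- The product of diagonals `D_β ⊆ E_β`. -/
def diagD (β : Face) : Set (Config × (β.Edges → Gras × Gras)) :=
  {e | e ∈ bundleE β ∧ ∀ α, (e.2 α).1 = (e.2 α).2}

/-- The canonical section `u_β`, on points. -/
def sectionU (β : Face) (p : Config) : β.Edges → Gras × Gras :=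
  fun α => (p α.1.1.1, p α.1.1.2)

/-- Index set of the generators of the ideal of `D_β` of multidegree `(1, …, 1)`. -/
abbrev GenIdx (β : Face) : Type :=
  β.Edges × (β.Edges → Finset (Fin 4)) × (β.Edges → Finset (Fin 4))

/-- The equations of `D_β` in the Plücker coordinates `m α`, `n α` of the two subspaces labelled by
`α`: the ideal of the diagonal of `E_α` is generated by the `2 × 2` minors of the pair
`(m α, n α)`, and these are brought to the same multidegree by the monomials of degree `1` in the
coordinates of all the other factors. -/
def diagGenerators (β : Face) (m n : β.Edges → Finset (Fin 4) → ℂ) : GenIdx β → ℂ :=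
  fun j => (m j.1 (j.2.1 j.1) * n j.1 (j.2.2 j.1) - m j.1 (j.2.2 j.1) * n j.1 (j.2.1 j.1)) *
    ∏ α ∈ Finset.univ.erase j.1, m α (j.2.1 α) * n α (j.2.2 α)

/-- The blowup `(E_β)_#` of `E_β` along `D_β`: the closure of the graph of the map from `E_β \ D_β`
to projective space given by the generators of the ideal of `D_β`. -/
def blowupE (β : Face) :
    Set ((Config × (β.Edges → Gras × Gras)) × ℙ ℂ (GenIdx β → ℂ)) :=
  closureIn {e | e.1 ∈ bundleE β}
    {e | e.1 ∈ bundleE β ∧ e.1 ∉ diagD β ∧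
      ∃ m n : β.Edges → Finset (Fin 4) → ℂ,
        (∀ α, m α ∈ HomogCoords.rep (e.1.2 α).1 ∧ n α ∈ HomogCoords.rep (e.1.2 α).2) ∧
        e.2.submodule = Submodule.span ℂ {diagGenerators β m n}}

/-- The space that contains `E_#`: a configuration, and for each `β` the subspaces that give a point
of `E_β` together with a point of the projective space of the blowup. -/
abbrev Ambient : Type :=
  Config × (∀ β : Face, (β.Edges → Gras × Gras) × ℙ ℂ (GenIdx β → ℂ))

/-- The complete ambient variety `E_#`: the product over `X` of the blowups. -/
def ambientE : Set Ambient :=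
  {e | e.1 ∈ tetrahedra ∧ ∀ β, ((e.1, (e.2 β).1), (e.2 β).2) ∈ blowupE β}

/-- The image of the nondegenerate tetrahedra in `E_#`: the points of the blowups above `u(p)`. -/
def nondegComplete : Set Ambient :=
  {e | e ∈ ambientE ∧ e.1 ∈ nondegTetrahedra ∧ ∀ β, (e.2 β).1 = sectionU β e.1}

/-- The space of complete tetrahedra. -/
def completeTetrahedra : Set Ambient := closureIn ambientE nondegComplete

/-! ### The chart at the flag at infinity -/

/-- The flag at infinity `0 ⊂ E_4 ⊂ E_34 ⊂ E_234 ⊂ ℂ⁴`. -/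
def flagInfinity (k : ℕ) : Gras := coordSubspace (Finset.univ.filter fun i => 4 ≤ i.val + k)

/-- The tetrahedra in general position to the flag at infinity. -/
def chartU : Set Config :=
  {p | p ∈ tetrahedra ∧ ∀ I, I ≠ ∅ → I ≠ Finset.univ → ∀ k, 1 ≤ k → k ≤ 3 →
    Transverse (p I) (flagInfinity k)}

/-- The local chart: the closure, in the part of `E_#` over `U`, of the image of the nondegenerate
tetrahedra in `U`. -/
def chartUtilde : Set Ambient :=
  closureIn {e | e ∈ ambientE ∧ e.1 ∈ chartU} {e | e ∈ nondegComplete ∧ e.1 ∈ chartU}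

/-- The initial set `I₀ = {1, …, k}`. -/
def initialSet (k : ℕ) : Finset (Fin 4) := Finset.univ.filter fun i => i.val < k

/-- The set `{1, …, k - 1, k + 1}`, that is `2`, `13`, `124` for `k = 1, 2, 3`. -/
def secondSet (k : ℕ) : Finset (Fin 4) := Finset.univ.filter fun i => i.val + 1 < k ∨ i.val = k

/-- The six pairs `i < j` that index the flag coordinates. -/
abbrev OpIdx : Type := {ij : Fin 4 × Fin 4 // ij.1 < ij.2}

/-- The flag coordinates: for `(1, j)` these are `f_{1,j}`, for `(2, j)` they are `f_{12,1j}`, and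
for `(3, 4)` it is `f_{123,124}`. -/
noncomputable def flagCoord (p : Config) : OpIdx → ℂ := fun ij =>
  pluckerRatio (p (Finset.Iic ij.1.1)) (insert ij.1.2 (Finset.Iio ij.1.1)) (Finset.Iic ij.1.1)

/-- The edge coordinates `x_α = f_{J,K} - f_{I,K}`, where `K` is `2`, `13` or `124`. -/
noncomputable def edgeCoord (p : Config) : Edge → ℂ := fun α =>
  pluckerRatio (p α.1.2) (secondSet α.1.1.card) (initialSet α.1.1.card) -
    pluckerRatio (p α.1.1) (secondSet α.1.1.card) (initialSet α.1.1.card)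

/-- The affine space `𝔸_op × 𝔸_ℰ`. -/
abbrev AffineOE : Type := (OpIdx → ℂ) × (Edge → ℂ)

/-- The product of the projective spaces `ℙ_β` with coordinates `y_{α,β}`, for `α` an edge of `β`. -/
abbrev ProjProd : Type := ∀ β : Face, ℙ ℂ (β.Edges → ℂ)

/-- The linear projection that takes from the equations of `D_β`, for each edge `α`, the one that
reads `x_α⁺ - x_α⁻` in the affine charts; it gives the coordinates `y_{α,β}` on the chart of the
blowup. -/
noncomputable def yProj (β : Face) : (GenIdx β → ℂ) →ₗ[ℂ] (β.Edges → ℂ) :=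
  LinearMap.funLeft ℂ ℂ fun α : β.Edges =>
    (α, (fun _ => initialSet β.rank), Function.update (fun _ => initialSet β.rank) α
      (secondSet β.rank))

/-- `z` is the image of the point `e` of the chart in the product of the projective spaces. -/
def IsProjImage (e : Ambient) (z : ProjProd) : Prop :=
  ∀ β, (z β).submodule = ((e.2 β).2).submodule.map (yProj β)

/-- The core `Z`: the image of the chart in the product of the projective spaces. -/
def core : Set ProjProd := {z | ∃ e ∈ chartUtilde, IsProjImage e z}

/-- The fibre over `z` of the bundle `N`, the product of `𝔸_op` and of the tautological lines
`L₁`, `L₂`, `L₃` of the projective spaces of the three hypersimplices, as a subspace of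
`𝔸_op × 𝔸_ℰ`. -/
noncomputable def fibreN (z : ProjProd) : Submodule ℂ AffineOE :=
  ⨅ k : Fin 3, ((z (hypersimplex k)).submodule).comap
    (LinearMap.funLeft ℂ ℂ (fun α : (hypersimplex k).Edges => α.1) ∘ₗ
      LinearMap.snd ℂ (OpIdx → ℂ) (Edge → ℂ))

/-- The bundle `N → Z`. -/
abbrev BundleN : Type := TotalSpace fibreN core

/-- `n` is the image of the point `e` of the chart in `𝔸_op × 𝔸_ℰ × ∏_β ℙ_β`. -/
def IsChartImage (e : Ambient) (n : AffineOE × ProjProd) : Prop :=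
  n.1 = (flagCoord e.1, edgeCoord e.1) ∧ IsProjImage e n.2

/-! ### The group actions -/

/-- The subgroup `B` of lower triangular matrices. -/
def IsLowerTriangular (b : G) : Prop := ∀ i j : Fin 4, i < j → b i j = 0

/-- The `A × A'` minors of `b`, which give its action on the Plücker coordinates. -/
noncomputable def compound (b : G) (A A' : Finset (Fin 4)) : ℂ :=
  if h : A'.card = A.card then
    (Matrix.of fun i j : Fin A.card => b (A.orderEmbOfFin rfl i) (A'.orderEmbOfFin h j)).det
  else 0

/-- The linear action of `b` on the space of the blowup, induced by the one on the Plücker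
coordinates of all the factors. -/
noncomputable def genAction (b : G) (β : Face) : (GenIdx β → ℂ) →ₗ[ℂ] (GenIdx β → ℂ) :=
  Matrix.mulVecLin (Matrix.of fun j j' : GenIdx β =>
    if j.1 = j'.1 then
      ∏ α, compound b (j.2.1 α) (j'.2.1 α) * compound b (j.2.2 α) (j'.2.2 α) else 0)

/-- `e' = b · e` in `E_#`. -/
def IsTranslate (b : G) (e e' : Ambient) : Prop :=
  (∀ I, e'.1 I = translate b (e.1 I)) ∧
  ∀ β, (∀ α, ((e'.2 β).1 α) = (translate b ((e.2 β).1 α).1, translate b ((e.2 β).1 α).2)) ∧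
    ((e'.2 β).2).submodule = ((e.2 β).2).submodule.map (genAction b β)

/-- The vectors `s_i = e_i + ∑_{j > i} a_{ij} e_j`. -/
noncomputable def opVec (a : OpIdx → ℂ) (i : Fin 4) : Fin 4 → ℂ := fun j =>
  if h : i < j then a ⟨(i, j), h⟩ else if i = j then 1 else 0

/-- The flag with coordinates `a`, in the cell opposite to the flag at infinity: the spans of the
first `s_i`, at the initial sets. (For `I` in general, the span of the `s_i`, `i ∈ I`.) -/
noncomputable def opFlag (a : OpIdx → ℂ) : Config := fun I => Submodule.span ℂ (opVec a '' (I : Set (Fin 4)))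

/-- The action of `B` on `𝔸_op × 𝔸_ℰ × ∏_β ℙ_β`: on `𝔸_op` the action on flags, on the coordinates
`x_α` of rank `k` the character `t_k(b) = b_{k+1,k+1} / b_{kk}`, and on the projective spaces the
trivial action. -/
noncomputable def actB (b : G) (n : AffineOE × ProjProd) : AffineOE × ProjProd :=
  ((flagCoord fun I => translate b (opFlag n.1.1 I),
    fun α => (∏ k : Fin 3, if α.1.1.card = k.val + 1
      then b k.succ k.succ / b k.castSucc k.castSucc else 1) * n.1.2 α), n.2)

end Tetra

/-! On `U` a tetrahedron is the same thing as a system of vectors. A subspace `π_I` of dimension `k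
≥ 1` in general position to the flag at infinity contains exactly one vector `v_I` whose first `k`
coordinates are `0, …, 0, 1`. At an edge `α = {I, J}` the difference `v_J - v_I` lies in `π_{I ∪ J}`
and its first `k` coordinates vanish, so it is a multiple of `v_{I ∪ J}`; the factor, read off in
position `k + 1`, is the edge coordinate `x_α` (`IsGenericConfig.isSystem`). The vectors of the flag
have the flag coordinates as entries, and from them the relation `v_J = v_I + x_α v_{I ∪ J}`
produces all the other `v_I` as polynomials in the flag and edge coordinates (`exists_sysVec`). The
points of `𝔸_op × 𝔸_ℰ` at which these polynomial vectors satisfy all the relations are the coherent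
ones. Coherence is a closed condition, and coherent points correspond to increasing configurations
in general position.

The same relation resolves the blowups. Plücker coordinates are linear in the last vector, so `p_J =
p_I + x_α p_{I ∪ J}`, and every equation of `D_β` becomes `x_α` times a polynomial
(`diagGenerators_eq`); for one equation per edge this polynomial is `1` (`genCoeff_yIdx`). A point
of the blowup is thus recovered polynomially from its coordinates `y_{α,β}`, which yields the
inverse `psi` of the chart. The required identities hold at nondegenerate tetrahedra, and identities
of rational functions whose denominators do not vanish on `U` pass to the closure. Hence `psi`
identifies the closure of the image of the nondegenerate tetrahedra with `Ũ`
(`mem_chartUtilde_iff`).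

That closure is `N` because of the action of `B`: it moves the flag coordinates to any prescribed
values and rescales the edge coordinates of the three ranks independently, while the points of the
`ℙ_β` stay fixed. So over a nondegenerate point of the core the image contains `𝔸_op` times the
nonzero vectors of the three lines, and its closure is the whole bundle (`mem_chartClosure_iff`).
The zero section then shows that the core is closed. Equivariance holds since a triangular `b` sends
`v_I` to a multiple of the vector of `b π_I`.

Modulo `B` the flag coordinates become `0` and one edge coordinate of each rank becomes `1`. Three
parameters remain, and they are ratios of edge coordinates. The core is therefore the closure of the
image of a nonempty open subset of `𝔸³`, hence irreducible; transcendence degree bounds its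
dimension from above by `3`, and fixing the parameters one after another gives a chain of length
`3`.

Smoothness descends because `N` is locally the product of the core and `𝔸⁹`. Lines are split off one
at a time: in the local ring of `X × ℂ` the equation `t - t₀` is a nonzerodivisor in the maximal
ideal, not in its square, and the quotient is the local ring of `X`. Dimension and embedding
dimension both drop by exactly one (`isRegularLocalRing_iff_of_ker_eq_span`). -/

namespace Tetra

/-! ### Polynomial and rational functions of coordinate vectors -/

/-- A function of coordinate vectors that is given by a polynomial. -/
def IsPolyFun {σ : Type} (h : (σ → ℂ) → ℂ) : Prop :=
  ∃ P : MvPolynomial σ ℂ, ∀ c, MvPolynomial.eval c P = h c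

namespace IsPolyFun

variable {σ : Type} {f g : (σ → ℂ) → ℂ}

theorem const (a : ℂ) : IsPolyFun fun _ : σ → ℂ => a := ⟨MvPolynomial.C a, fun c => by simp⟩

theorem coord (i : σ) : IsPolyFun fun c : σ → ℂ => c i := ⟨MvPolynomial.X i, fun c => by simp⟩

theorem add (hf : IsPolyFun f) (hg : IsPolyFun g) : IsPolyFun fun c => f c + g c := by
  obtain ⟨P, hP⟩ := hf
  obtain ⟨Q, hQ⟩ := hg
  exact ⟨P + Q, fun c => by simp [hP, hQ]⟩

theorem mul (hf : IsPolyFun f) (hg : IsPolyFun g) : IsPolyFun fun c => f c * g c := by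
  obtain ⟨P, hP⟩ := hf
  obtain ⟨Q, hQ⟩ := hg
  exact ⟨P * Q, fun c => by simp [hP, hQ]⟩

theorem neg (hf : IsPolyFun f) : IsPolyFun fun c => -f c := by
  obtain ⟨P, hP⟩ := hf
  exact ⟨-P, fun c => by simp [hP]⟩

theorem sub (hf : IsPolyFun f) (hg : IsPolyFun g) : IsPolyFun fun c => f c - g c := by
  simpa only [sub_eq_add_neg] using hf.add hg.neg

theorem sum {ι : Type*} (s : Finset ι) {F : ι → (σ → ℂ) → ℂ} (h : ∀ i ∈ s, IsPolyFun (F i)) :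
    IsPolyFun fun c => ∑ i ∈ s, F i c := by
  classical
  choose! P hP using h
  exact ⟨∑ i ∈ s, P i, fun c => by
    rw [map_sum]; exact Finset.sum_congr rfl fun i hi => hP i hi c⟩

theorem prod {ι : Type*} (s : Finset ι) {F : ι → (σ → ℂ) → ℂ} (h : ∀ i ∈ s, IsPolyFun (F i)) :
    IsPolyFun fun c => ∏ i ∈ s, F i c := by
  classical
  choose! P hP using h
  exact ⟨∏ i ∈ s, P i, fun c => by
    rw [map_prod]; exact Finset.prod_congr rfl fun i hi => hP i hi c⟩

theorem det {n : ℕ} {M : (σ → ℂ) → Matrix (Fin n) (Fin n) ℂ}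
    (h : ∀ i j, IsPolyFun fun c => M c i j) : IsPolyFun fun c => (M c).det := by
  simp only [Matrix.det_apply']
  exact sum _ fun s _ => (const _).mul (prod _ fun i _ => h _ _)

theorem comp {τ : Type} {F : (τ → ℂ) → ℂ} (hF : IsPolyFun F) {h : (σ → ℂ) → τ → ℂ}
    (hh : ∀ j, IsPolyFun fun c => h c j) : IsPolyFun fun c => F (h c) := by
  obtain ⟨P, hP⟩ := hF
  choose Q hQ using hh
  refine ⟨MvPolynomial.bind₁ Q P, fun c => ?_⟩
  have h1 : (fun j => MvPolynomial.eval c (Q j)) = h c := funext fun j => hQ j c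
  change _ = F (h c)
  rw [← hP, ← h1]
  simp only [MvPolynomial.eval, MvPolynomial.eval₂Hom_bind₁]

end IsPolyFun

/-- A function of coordinate vectors that is a fraction with a power of `D` as denominator, where
`D` does not vanish. -/
def IsRat {σ : Type} (D : MvPolynomial σ ℂ) (h : (σ → ℂ) → ℂ) : Prop :=
  ∃ (P : MvPolynomial σ ℂ) (n : ℕ), ∀ c, MvPolynomial.eval c D ≠ 0 →
    h c = MvPolynomial.eval c P / MvPolynomial.eval c D ^ n

theorem IsPolyFun.isRat {σ : Type} {h : (σ → ℂ) → ℂ} (hh : IsPolyFun h) (D : MvPolynomial σ ℂ) :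
    IsRat D h := by
  obtain ⟨P, hP⟩ := hh
  exact ⟨P, 0, fun c _ => by simp [hP]⟩

namespace IsRat

variable {σ : Type} {D : MvPolynomial σ ℂ} {f g : (σ → ℂ) → ℂ}

theorem const (a : ℂ) : IsRat D fun _ : σ → ℂ => a := (IsPolyFun.const a).isRat D

theorem add (hf : IsRat D f) (hg : IsRat D g) : IsRat D fun c => f c + g c := by
  obtain ⟨P, n, hP⟩ := hf
  obtain ⟨Q, m, hQ⟩ := hg
  refine ⟨P * D ^ m + Q * D ^ n, n + m, fun c hc => ?_⟩
  beta_reduce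
  rw [hP c hc, hQ c hc]
  simp only [map_add, map_mul, map_pow]
  field_simp
  ring

theorem mul (hf : IsRat D f) (hg : IsRat D g) : IsRat D fun c => f c * g c := by
  obtain ⟨P, n, hP⟩ := hf
  obtain ⟨Q, m, hQ⟩ := hg
  refine ⟨P * Q, n + m, fun c hc => ?_⟩
  beta_reduce
  rw [hP c hc, hQ c hc]
  simp only [map_mul]
  field_simp
  ring

theorem neg (hf : IsRat D f) : IsRat D fun c => -f c := by
  simpa using (const (D := D) (-1)).mul hf

theorem sub (hf : IsRat D f) (hg : IsRat D g) : IsRat D fun c => f c - g c := by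
  simpa only [sub_eq_add_neg] using hf.add hg.neg

theorem inv_of_dvd {E : MvPolynomial σ ℂ} (h : E ∣ D) :
    IsRat D fun c => (MvPolynomial.eval c E)⁻¹ := by
  obtain ⟨F, rfl⟩ := h
  refine ⟨F, 1, fun c hc => ?_⟩
  rw [map_mul] at hc ⊢
  have h1 := left_ne_zero_of_mul hc
  have h2 := right_ne_zero_of_mul hc
  field_simp

theorem comp {τ : Type} {h : (σ → ℂ) → τ → ℂ} (hh : ∀ j, IsRat D fun c => h c j)
    (P : MvPolynomial τ ℂ) : IsRat D fun c => MvPolynomial.eval (h c) P := by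
  induction P using MvPolynomial.induction_on with
  | C a => simpa using const a
  | add p q hp hq => simpa using hp.add hq
  | mul_X p j hp => simpa using hp.mul (hh j)

theorem comp_isPolyFun {τ : Type} {F : (τ → ℂ) → ℂ} (hF : IsPolyFun F) {h : (σ → ℂ) → τ → ℂ}
    (hh : ∀ j, IsRat D fun c => h c j) : IsRat D fun c => F (h c) := by
  obtain ⟨P, hP⟩ := hF
  simpa only [hP] using comp hh P

end IsRat

/-! ### Coordinates that are unique up to scaling -/

/-- The coordinate vectors of the points are nonempty torsors under a fixed set of scalings. -/
class HomogTorsor (X : Type) [HomogCoords X] : Prop where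
  nonempty : ∀ x : X, (HomogCoords.rep x).Nonempty
  exists_scaling : ∃ Λ : Set (HomogCoords.idx X → ℂ), ∀ x : X, ∀ c ∈ HomogCoords.rep x,
    ∀ c', c' ∈ HomogCoords.rep x ↔ ∃ l ∈ Λ, c' = fun i => l i * c i

instance : HomogTorsor ℂ where
  nonempty x := ⟨_, rfl⟩
  exists_scaling := ⟨{fun _ => 1}, by
    rintro x c rfl c'
    simp only [HomogCoords.rep, Set.mem_singleton_iff, exists_eq_left, one_mul]
    rfl⟩

theorem mem_rep_proj {J : Type} {y : ℙ ℂ (J → ℂ)} {c : J → ℂ} :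
    c ∈ HomogCoords.rep y ↔ c ≠ 0 ∧ y.submodule = Submodule.span ℂ {c} := by
  constructor
  · rintro ⟨h0, hc⟩
    refine ⟨h0, ?_⟩
    rw [Projectivization.submodule_eq, Submodule.mem_span_singleton] at hc
    obtain ⟨a, rfl⟩ := hc
    have ha : a ≠ 0 := by rintro rfl; simp at h0
    rw [Projectivization.submodule_eq, Submodule.span_singleton_smul_eq (IsUnit.mk0 a ha)]
  · rintro ⟨h0, hc⟩
    exact ⟨h0, hc ▸ Submodule.mem_span_singleton_self c⟩

instance (J : Type) : HomogTorsor (ℙ ℂ (J → ℂ)) where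
  nonempty y := ⟨y.rep, y.rep_nonzero, y.submodule_eq ▸ Submodule.mem_span_singleton_self _⟩
  exists_scaling := ⟨{l | ∃ a : ℂ, a ≠ 0 ∧ l = fun _ => a}, by
    intro y c hc c'
    obtain ⟨h0, hy⟩ := mem_rep_proj.1 hc
    constructor
    · rintro ⟨h0', hc'⟩
      rw [hy, Submodule.mem_span_singleton] at hc'
      obtain ⟨a, rfl⟩ := hc'
      exact ⟨_, ⟨a, by rintro rfl; simp at h0', rfl⟩, rfl⟩
    · rintro ⟨_, ⟨a, ha, rfl⟩, rfl⟩
      refine ⟨fun h => h0 ?_, ?_⟩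
      · ext i
        simpa [ha] using congrFun h i
      · rw [hy]
        exact Submodule.mem_span_singleton.2 ⟨a, rfl⟩⟩

instance {ι : Type} (X : ι → Type) [∀ i, HomogCoords (X i)] [∀ i, HomogTorsor (X i)] :
    HomogTorsor (∀ i, X i) where
  nonempty x := by
    choose c hc using fun i => HomogTorsor.nonempty (x i)
    exact ⟨fun ij => c ij.1 ij.2, hc⟩
  exists_scaling := by
    choose L hL using fun i => HomogTorsor.exists_scaling (X := X i)
    refine ⟨{l | ∀ i, (fun j => l ⟨i, j⟩) ∈ L i}, fun x c hc c' => ?_⟩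
    constructor
    · intro hc'
      choose l hl h using fun i => (hL i (x i) _ (hc i) _).1 (hc' i)
      exact ⟨fun ij => l ij.1 ij.2, hl, funext fun ij => congrFun (h ij.1) ij.2⟩
    · rintro ⟨l, hl, rfl⟩ i
      exact (hL i (x i) _ (hc i) _).2 ⟨_, hl i, rfl⟩

instance (X Y : Type) [HomogCoords X] [HomogCoords Y] [HomogTorsor X] [HomogTorsor Y] :
    HomogTorsor (X × Y) where
  nonempty x := by
    obtain ⟨c, hc⟩ := HomogTorsor.nonempty x.1
    obtain ⟨d, hd⟩ := HomogTorsor.nonempty x.2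
    exact ⟨Sum.elim c d, hc, hd⟩
  exists_scaling := by
    obtain ⟨L, hL⟩ := HomogTorsor.exists_scaling (X := X)
    obtain ⟨M, hM⟩ := HomogTorsor.exists_scaling (X := Y)
    refine ⟨{l | (fun j => l (Sum.inl j)) ∈ L ∧ (fun j => l (Sum.inr j)) ∈ M},
      fun x c hc c' => ?_⟩
    constructor
    · intro hc'
      obtain ⟨l, hl, h⟩ := (hL x.1 _ hc.1 _).1 hc'.1
      obtain ⟨m, hm, h'⟩ := (hM x.2 _ hc.2 _).1 hc'.2
      refine ⟨Sum.elim l m, ⟨hl, hm⟩, funext fun j => ?_⟩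
      rcases j with j | j
      · exact congrFun h j
      · exact congrFun h' j
    · rintro ⟨l, hl, rfl⟩
      exact ⟨(hL x.1 _ hc.1 _).2 ⟨_, hl.1, rfl⟩, (hM x.2 _ hc.2 _).2 ⟨_, hl.2, rfl⟩⟩

instance {X : Type} [HomogCoords X] [HomogTorsor X] (p : X → Prop) :
    HomogTorsor {x : X // p x} where
  nonempty x := HomogTorsor.nonempty x.1
  exists_scaling := by
    obtain ⟨L, hL⟩ := HomogTorsor.exists_scaling (X := X)
    exact ⟨L, fun x => hL x.1⟩

/-! ### Closures and morphisms in coordinates -/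

section Zariski

variable {X Y : Type} [HomogCoords X] [HomogCoords Y]

theorem isClosed_zariski {Z : Set X} : @IsClosed X (zariski X) Z ↔ IsZariskiClosed Z := by
  rw [← @isOpen_compl_iff X Z (zariski X)]
  change Zᶜᶜ ∈ _ ↔ _
  rw [compl_compl]
  rfl

/-- By the definition of a closed set, membership can be tested at any single coordinate vector of
the point. -/
theorem mem_closure_of_eval_eq_zero {S : Set X} {x : X} {c : HomogCoords.idx X → ℂ}
    (hc : c ∈ HomogCoords.rep x)
    (h : ∀ f : MvPolynomial (HomogCoords.idx X) ℂ,
      (∀ y ∈ S, ∀ d ∈ HomogCoords.rep y, MvPolynomial.eval d f = 0) → MvPolynomial.eval c f = 0) :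
    x ∈ @closure X (zariski X) S := by
  intro F hF
  obtain ⟨hF, hSF⟩ := hF
  obtain ⟨T, hT⟩ := isClosed_zariski.1 hF
  rw [hT x c hc]
  exact fun f hf => h f fun y hy d hd => (hT y d hd).1 (hSF hy) f hf

/-- The polynomials need not be homogeneous. Vanishing of `f` at all coordinate vectors of a point
is the vanishing, at one of them, of all the rescalings of `f`; these rescalings serve as equations.
-/
theorem isZariskiClosed_eval_eq_zero [HomogTorsor X]
    (T : Set (MvPolynomial (HomogCoords.idx X) ℂ)) :
    IsZariskiClosed {x : X | ∀ c ∈ HomogCoords.rep x, ∀ f ∈ T, MvPolynomial.eval c f = 0} := by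
  obtain ⟨L, hL⟩ := HomogTorsor.exists_scaling (X := X)
  refine ⟨{g | ∃ f ∈ T, ∃ l ∈ L, g = MvPolynomial.bind₁
    (fun i => MvPolynomial.C (l i) * MvPolynomial.X i) f}, fun x c hc => ?_⟩
  have key : ∀ (l : HomogCoords.idx X → ℂ) (f : MvPolynomial (HomogCoords.idx X) ℂ),
      MvPolynomial.eval c (MvPolynomial.bind₁
      (fun i => MvPolynomial.C (l i) * MvPolynomial.X i) f) =
      MvPolynomial.eval (fun i => l i * c i) f := by
    intro l f
    have h1 : (fun i => MvPolynomial.eval c (MvPolynomial.C (l i) * MvPolynomial.X i)) =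
        fun i => l i * c i := funext fun i => by simp
    rw [← h1]
    simp only [MvPolynomial.eval, MvPolynomial.eval₂Hom_bind₁]
  constructor
  · rintro h _ ⟨f, hf, l, hl, rfl⟩
    rw [key]
    exact h _ ((hL x c hc _).2 ⟨l, hl, rfl⟩) f hf
  · intro h c' hc' f hf
    obtain ⟨l, hl, rfl⟩ := (hL x c hc _).1 hc'
    rw [← key]
    exact h _ ⟨f, hf, l, hl, rfl⟩

theorem eval_eq_zero_of_mem_closure [HomogTorsor X] {S : Set X} {x : X}
    (hx : x ∈ @closure X (zariski X) S) {f : MvPolynomial (HomogCoords.idx X) ℂ}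
    (hf : ∀ y ∈ S, ∀ d ∈ HomogCoords.rep y, MvPolynomial.eval d f = 0) :
    ∀ c ∈ HomogCoords.rep x, MvPolynomial.eval c f = 0 := by
  have hcl := isClosed_zariski.2 (isZariskiClosed_eval_eq_zero (X := X) {f})
  have hS : S ⊆ {x : X | ∀ c ∈ HomogCoords.rep x, ∀ g ∈ ({f} : Set _), MvPolynomial.eval c g = 0} :=
    fun y hy d hd g hg => by
      rw [Set.mem_singleton_iff.1 hg]
      exact hf y hy d hd
  have := Set.mem_of_subset_of_mem (@closure_minimal X (zariski X) S _ hS hcl) hx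
  exact fun c hc => this c hc f rfl

/-- Multiplying the numerator by `D` gives a polynomial that vanishes on all of `S`, also where `D`
does; at a point with `D ≠ 0` the factor cancels. This is how identities between nondegenerate
tetrahedra extend to their limits. -/
theorem IsRat.eq_zero_of_mem_closure [HomogTorsor X] {S : Set X} {x : X}
    (hx : x ∈ @closure X (zariski X) S) {D : MvPolynomial (HomogCoords.idx X) ℂ}
    {h : (HomogCoords.idx X → ℂ) → ℂ} (hh : IsRat D h)
    (hS : ∀ y ∈ S, ∀ d ∈ HomogCoords.rep y, MvPolynomial.eval d D ≠ 0 → h d = 0)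
    {c : HomogCoords.idx X → ℂ} (hc : c ∈ HomogCoords.rep x) (hD : MvPolynomial.eval c D ≠ 0) :
    h c = 0 := by
  obtain ⟨P, n, hP⟩ := hh
  have := eval_eq_zero_of_mem_closure hx (f := D * P) (fun y hy d hd => by
    rw [map_mul]
    by_cases h0 : MvPolynomial.eval d D = 0
    · rw [h0, zero_mul]
    · have := hS y hy d hd h0
      rw [hP d h0, div_eq_zero_iff] at this
      rw [this.resolve_right (pow_ne_zero _ h0), mul_zero]) c hc
  rw [map_mul, mul_eq_zero] at this
  rw [hP c hD, this.resolve_left hD, zero_div]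

theorem IsMorphism.of_lift [HomogTorsor X] {φ : X → Y}
    (H : ∀ x, ∃ (D : MvPolynomial (HomogCoords.idx X) ℂ)
      (h : (HomogCoords.idx X → ℂ) → HomogCoords.idx Y → ℂ),
      (∀ c ∈ HomogCoords.rep x, MvPolynomial.eval c D ≠ 0) ∧
      (∀ j, IsRat D fun c => h c j) ∧
      ∀ y, ∀ c ∈ HomogCoords.rep y, MvPolynomial.eval c D ≠ 0 → h c ∈ HomogCoords.rep (φ y)) :
    IsMorphism φ := by
  constructor
  · rw [@continuous_iff_isClosed X Y (zariski X) (zariski Y)]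
    intro F hF
    rw [isClosed_zariski] at hF ⊢
    obtain ⟨T, hT⟩ := hF
    -- All polynomials that vanish on the preimage are taken as equations. They suffice, since near
    -- `x` the pullback of each equation of `F`, multiplied by powers of `D`, is among them.
    refine ⟨{f | ∀ y ∈ φ ⁻¹' F, ∀ d ∈ HomogCoords.rep y, MvPolynomial.eval d f = 0},
      fun x c hc => ⟨fun hx f hf => hf x hx c hc, fun hf => ?_⟩⟩
    obtain ⟨D, h, hD, hr, hl⟩ := H x
    refine (hT _ _ (hl x c hc (hD c hc))).2 fun f hfT => ?_
    obtain ⟨P, n, hP⟩ := IsRat.comp hr f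
    beta_reduce at hP
    have := hf (D * P) fun y hy d hd => by
      rw [map_mul]
      by_cases h0 : MvPolynomial.eval d D = 0
      · rw [h0, zero_mul]
      · have := (hT _ _ (hl y d hd h0)).1 hy f hfT
        rw [hP d h0, div_eq_zero_iff] at this
        rw [this.resolve_right (pow_ne_zero _ h0), mul_zero]
    rw [map_mul, mul_eq_zero] at this
    rw [hP c (hD c hc), this.resolve_left (hD c hc), zero_div]
  · rintro g x ⟨P, Q, hQ, hPQ⟩
    obtain ⟨D, h, hD, hr, hl⟩ := H x
    obtain ⟨P', n, hP'⟩ := IsRat.comp hr P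
    obtain ⟨Q', m, hQ'⟩ := IsRat.comp hr Q
    beta_reduce at hP' hQ'
    have aux : ∀ c, MvPolynomial.eval c D ≠ 0 →
        (MvPolynomial.eval c Q' ≠ 0 ↔ MvPolynomial.eval (h c) Q ≠ 0) := by
      intro c hc
      rw [hQ' c hc, Ne, Ne, div_eq_zero_iff, or_iff_left (pow_ne_zero _ hc)]
    -- The quotient of `P' / D ^ n` by `Q' / D ^ m`, expanded by one more factor `D` so that the new
    -- denominator is nonzero only where the lift is valid.
    refine ⟨D * P' * D ^ m, D ^ (n + 1) * Q', ?_, ?_⟩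
    · intro c hc
      rw [map_mul, map_pow]
      exact mul_ne_zero (pow_ne_zero _ (hD c hc))
        ((aux c (hD c hc)).2 (hQ _ (hl x c hc (hD c hc))))
    · intro y c hc hne
      rw [map_mul, map_pow] at hne
      have h1 : MvPolynomial.eval c D ≠ 0 := fun h0 => by simp [h0] at hne
      have h2 : MvPolynomial.eval c Q' ≠ 0 := right_ne_zero_of_mul hne
      rw [Function.comp_apply, hPQ _ _ (hl y c hc h1) ((aux c h1).1 h2), hP' c h1, hQ' c h1]
      simp only [map_mul, map_pow]
      field_simp
      ring

theorem zariski_subtype [HomogTorsor X] (p : X → Prop) :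
    zariski {x : X // p x} = (zariski X).induced Subtype.val := by
  refine TopologicalSpace.ext_isClosed fun A => ?_
  rw [isClosed_zariski, @isClosed_induced_iff]
  constructor
  · rintro ⟨T, hT⟩
    refine ⟨_, isClosed_zariski.2 (isZariskiClosed_eval_eq_zero (X := X) T), ?_⟩
    ext x
    obtain ⟨c, hc⟩ := HomogTorsor.nonempty x
    exact ⟨fun h => (hT x c hc).2 (h c hc), fun h d hd => (hT x d hd).1 h⟩
  · rintro ⟨F, hF, rfl⟩
    obtain ⟨T, hT⟩ := isClosed_zariski.1 hF
    exact ⟨T, fun x => hT x.1⟩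

end Zariski
end Tetra

namespace Tetra

/-! ### Plücker coordinates -/

section Plucker

variable {k : ℕ}

theorem plucker_of_card {v : Fin k → Fin 4 → ℂ} {A : Finset (Fin 4)} (h : A.card = k) :
    plucker v A = (Matrix.of fun i j : Fin k => v i (A.orderEmbOfFin h j)).det := dif_pos h

theorem plucker_of_card_ne {v : Fin k → Fin 4 → ℂ} {A : Finset (Fin 4)} (h : A.card ≠ k) :
    plucker v A = 0 := dif_neg h

theorem plucker_isPolyFun {σ : Type} {v : (σ → ℂ) → Fin k → Fin 4 → ℂ}
    (hv : ∀ i j, IsPolyFun fun c => v c i j) (A : Finset (Fin 4)) :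
    IsPolyFun fun c => plucker (v c) A := by
  by_cases h : A.card = k
  · simp only [plucker_of_card h]
    exact IsPolyFun.det fun i j => hv _ _
  · simp only [plucker_of_card_ne h]
    exact IsPolyFun.const _

theorem plucker_mul (M : Matrix (Fin k) (Fin k) ℂ) (v : Fin k → Fin 4 → ℂ) (A : Finset (Fin 4)) :
    plucker (fun i => ∑ s, M i s • v s) A = M.det * plucker v A := by
  by_cases h : A.card = k
  · rw [plucker_of_card h, plucker_of_card h, ← Matrix.det_mul]
    congr 1
    ext i j
    simp [Matrix.mul_apply]
  · simp [plucker_of_card_ne h]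

/-- A minor with arbitrary columns is a multiple of a Plücker coordinate. -/
theorem exists_det_eq_mul_plucker (g : Fin k → Fin 4) :
    ∃ (a : ℂ) (A : Finset (Fin 4)), ∀ v : Fin k → Fin 4 → ℂ,
      (Matrix.of fun i j => v i (g j)).det = a * plucker v A := by
  by_cases hg : Function.Injective g
  · have hc : (Finset.univ.image g).card = k := by
      rw [Finset.card_image_of_injective _ hg, Finset.card_univ, Fintype.card_fin]
    have hmem : ∀ j, ∃ i, (Finset.univ.image g).orderEmbOfFin hc i = g j := fun j => by
      have : g j ∈ Set.range ((Finset.univ.image g).orderEmbOfFin hc) := by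
        rw [Finset.range_orderEmbOfFin]; simp
      exact this
    choose s hs using hmem
    have hsi : Function.Injective s := fun i j hij => hg (by rw [← hs, ← hs, hij])
    let e : Equiv.Perm (Fin k) := Equiv.ofBijective s (Finite.injective_iff_bijective.1 hsi)
    refine ⟨((Equiv.Perm.sign e : ℤ) : ℂ), Finset.univ.image g, fun v => ?_⟩
    rw [plucker_of_card hc, ← Matrix.det_permute' e]
    congr 1
    ext i j
    simp [e, hs]
  · refine ⟨0, ∅, fun v => ?_⟩
    rw [Function.Injective] at hg
    push Not at hg
    obtain ⟨i, j, hij, hne⟩ := hg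
    rw [zero_mul]
    exact Matrix.det_zero_of_column_eq hne fun r => by simp [hij]

/-- The matrix of the vectors has rank `k`, so some `k` of its columns are independent and form an
invertible minor. -/
theorem exists_plucker_ne_zero {v : Fin k → Fin 4 → ℂ} (hv : LinearIndependent ℂ v) :
    ∃ A : Finset (Fin 4), A.card = k ∧ plucker v A ≠ 0 := by
  have hr : (Matrix.of v).rank = k := by
    simpa using LinearIndependent.rank_matrix (M := Matrix.of v) hv
  have hcol := Matrix.rank_eq_finrank_span_cols (Matrix.of v)
  rw [hr] at hcol
  obtain ⟨f, hf, -, hli⟩ := Submodule.exists_fun_fin_finrank_span_eq ℂ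
    (Set.range (Matrix.of v).col)
  choose g hg using hf
  let e := finCongr hcol
  have hdet : (Matrix.of fun i j => v i (g (e j))).det ≠ 0 := by
    rw [← isUnit_iff_ne_zero, ← Matrix.isUnit_iff_isUnit_det,
      ← Matrix.linearIndependent_cols_iff_isUnit]
    have hcols : (Matrix.of fun i j => v i (g (e j))).col = f ∘ e := by
      funext j
      rw [Function.comp_apply, ← hg]
      rfl
    rw [hcols]
    exact hli.comp e e.injective
  obtain ⟨a, A, hA⟩ := exists_det_eq_mul_plucker fun j => g (e j)
  rw [hA] at hdet
  have hne := right_ne_zero_of_mul hdet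
  refine ⟨A, ?_, hne⟩
  by_contra h
  exact hne (plucker_of_card_ne h)

/-- Two bases differ by an invertible matrix, whose determinant is the factor. The index `∅` is kept
apart: for the zero subspace its coordinate is the empty determinant `1` and cannot be rescaled, and
for every other subspace it is `0`. -/
theorem rep_scaling {W : Gras} {c c' : Finset (Fin 4) → ℂ} (hc : c ∈ HomogCoords.rep W)
    (hc' : c' ∈ HomogCoords.rep W) :
    c' ∅ = c ∅ ∧ ∃ a : ℂ, a ≠ 0 ∧ ∀ A, A ≠ ∅ → c' A = a * c A := by
  obtain ⟨k, v, hv, hW, rfl⟩ := hc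
  obtain ⟨k', v', hv', hW', rfl⟩ := hc'
  have h1 := finrank_span_eq_card hv
  have h2 := finrank_span_eq_card hv'
  rw [hW, Fintype.card_fin] at h1
  rw [hW', Fintype.card_fin] at h2
  obtain rfl : k = k' := h1.symm.trans h2
  have hmem : ∀ i, v' i ∈ Submodule.span ℂ (Set.range v) := fun i => by
    rw [hW, ← hW']; exact Submodule.subset_span ⟨i, rfl⟩
  choose M hM using fun i => (Submodule.mem_span_range_iff_exists_fun ℂ).1 (hmem i)
  have hpl : ∀ A, plucker v' A = (Matrix.of M).det * plucker v A := fun A => by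
    rw [← plucker_mul]
    congr 1
    ext1 i
    exact (hM i).symm
  constructor
  · rcases Nat.eq_zero_or_pos k with rfl | hk
    · simp [plucker]
    · rw [plucker_of_card_ne (by simp; omega), plucker_of_card_ne (by simp; omega)]
  · refine ⟨_, fun h0 => ?_, fun A _ => hpl A⟩
    obtain ⟨A, -, hA⟩ := exists_plucker_ne_zero hv'
    exact hA (by rw [hpl, h0, zero_mul])

theorem rep_nonempty (W : Gras) :
    plucker (fun i => (Module.finBasis ℂ W i : Fin 4 → ℂ)) ∈ HomogCoords.rep W := by
  refine ⟨_, _, ?_, ?_, rfl⟩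
  · exact (Module.finBasis ℂ W).linearIndependent.map' W.subtype (Submodule.ker_subtype W)
  · have := congrArg (Submodule.map W.subtype) (Module.finBasis ℂ W).span_eq
    rw [Submodule.map_span, ← Set.range_comp] at this
    rw [Submodule.map_top, Submodule.range_subtype] at this
    exact this

instance : HomogTorsor Gras where
  nonempty W := ⟨_, rep_nonempty W⟩
  exists_scaling := ⟨{l : Finset (Fin 4) → ℂ | l ∅ = 1 ∧ ∃ a : ℂ, a ≠ 0 ∧ ∀ A, A ≠ ∅ → l A = a}, by
    intro W c hc c'
    constructor
    · intro hc'
      obtain ⟨h0, a, ha, h⟩ := rep_scaling hc hc'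
      refine ⟨fun A : Finset (Fin 4) => if A = ∅ then 1 else a,
        ⟨if_pos rfl, a, ha, fun A hA => if_neg hA⟩, ?_⟩
      funext (A : Finset (Fin 4))
      by_cases hA : A = ∅
      · subst hA; simpa using h0
      · simpa [hA] using h A hA
    · rintro ⟨l, ⟨h0, a, ha, h⟩, rfl⟩
      obtain ⟨k, v, hv, hW, rfl⟩ := hc
      rcases Nat.eq_zero_or_pos k with rfl | hk
      · refine ⟨0, v, hv, hW, ?_⟩
        funext (A : Finset (Fin 4))
        by_cases hA : A = ∅
        · subst hA; simp [h0]
        · rw [plucker_of_card_ne (by simpa using hA), mul_zero]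
      -- Multiplying a single basis vector by `a` multiplies all the maximal minors by `a`.
      · let u : Fin k → ℂˣ := fun i => if i = ⟨0, hk⟩ then Units.mk0 a ha else 1
        refine ⟨k, fun i => u i • v i, hv.units_smul u, ?_, ?_⟩
        · rw [← hW]
          refine le_antisymm (Submodule.span_le.2 ?_) (Submodule.span_le.2 ?_)
          · rintro _ ⟨i, rfl⟩
            exact Submodule.smul_mem _ (u i : ℂ) (Submodule.subset_span ⟨i, rfl⟩)
          · rintro _ ⟨i, rfl⟩
            have := Submodule.smul_mem _ ((u i)⁻¹ : ℂˣ).val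
              (Submodule.subset_span (R := ℂ) (s := Set.range fun i => u i • v i) ⟨i, rfl⟩)
            simpa [Units.smul_def, smul_smul] using this
        · have : (fun i => u i • v i) =
              fun i => ∑ s, (Matrix.diagonal fun i => (u i : ℂ)) i s • v s := by
            ext1 i
            rw [Finset.sum_eq_single i]
            · simp [Units.smul_def]
            · intro s _ hs; simp [Matrix.diagonal_apply_ne' _ hs]
            · simp
          rw [this]
          funext (A : Finset (Fin 4))
          rw [plucker_mul, Matrix.det_diagonal]
          by_cases hA : A = ∅
          · subst hA
            rw [plucker_of_card_ne (by simp; omega), mul_zero, mul_zero]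
          · rw [h A hA]
            simp [u, apply_ite]⟩

theorem pluckerRatio_eq {W : Gras} {c : Finset (Fin 4) → ℂ} (hc : c ∈ HomogCoords.rep W)
    {A B : Finset (Fin 4)} (hA : A ≠ ∅) (hB : B ≠ ∅) : pluckerRatio W A B = c A / c B := by
  obtain ⟨-, a, ha, h⟩ := rep_scaling hc (rep_nonempty W)
  rw [pluckerRatio, h A hA, h B hB, mul_div_mul_left _ _ ha]

/-- A subspace is determined by its Plücker coordinates. -/
theorem eq_of_rep_proportional {W W' : Gras} {c c' : Finset (Fin 4) → ℂ}
    (hc : c ∈ HomogCoords.rep W) (hc' : c' ∈ HomogCoords.rep W')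
    (h : ∀ A B, c A * c' B = c B * c' A) : W = W' := by
  have aux : ∀ {k : ℕ} {v v' : Fin k → Fin 4 → ℂ} {l : ℂ} {A : Finset (Fin 4)},
      plucker v' A ≠ 0 → (∀ B, plucker v' B = l * plucker v B) →
      Submodule.span ℂ (Set.range v') ≤ Submodule.span ℂ (Set.range v) := by
    intro k v v' l A hA hl
    have hcard : A.card = k := by
      by_contra hne
      exact hA (plucker_of_card_ne hne)
    set e := A.orderEmbOfFin hcard
    let V := Matrix.of fun i j : Fin k => v i (e j)
    let V' := Matrix.of fun i j : Fin k => v' i (e j)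
    -- Cramer's rule: the rows of `adj(V) * w` have as entries the minors in which one column of the
    -- chosen minor is replaced. Up to sign these are Plücker coordinates or zero, so they are
    -- proportional for `v` and `v'`, and they lie in the respective spans.
    let R := fun (w : Fin k → Fin 4 → ℂ) (i : Fin k) (j : Fin 4) =>
      (Matrix.of fun r s => w r (Function.update e i j s)).det
    have hR : ∀ w : Fin k → Fin 4 → ℂ, (Matrix.of fun i j : Fin k => w i (e j)).adjugate *
        Matrix.of w = Matrix.of (R w) := by
      intro w
      ext i j
      have : ((Matrix.of fun i j : Fin k => w i (e j)).adjugate * Matrix.of w) i j =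
          ((Matrix.of fun i j : Fin k => w i (e j)).adjugate.mulVec fun r => w r j) i := rfl
      rw [this, ← Matrix.cramer_eq_adjugate_mulVec, Matrix.cramer_apply]
      congr 1
      ext r s
      by_cases hs : s = i
      · subst hs; simp
      · simp [hs]
    have hRl : R v' = l • R v := by
      ext i j
      obtain ⟨a, B, hB⟩ := exists_det_eq_mul_plucker (Function.update e i j)
      simp only [R, Pi.smul_apply, smul_eq_mul]
      rw [hB, hB, hl]
      ring
    have hV' : V'.det ≠ 0 := by rwa [plucker_of_card hcard] at hA
    have hRmem : ∀ i, R v i ∈ Submodule.span ℂ (Set.range v) := fun i => by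
      have : R v i = ∑ s, V.adjugate i s • v s := by
        ext j
        have := congrFun (congrFun (hR v) i) j
        rw [Matrix.mul_apply] at this
        simpa [V] using this.symm
      rw [this]
      exact Submodule.sum_mem _ fun s _ => Submodule.smul_mem _ _ (Submodule.subset_span ⟨s, rfl⟩)
    refine Submodule.span_le.2 ?_
    rintro _ ⟨i, rfl⟩
    have h1 : V' * (V'.adjugate * Matrix.of v') = V'.det • Matrix.of v' := by
      rw [← Matrix.mul_assoc, Matrix.mul_adjugate, Matrix.smul_mul, Matrix.one_mul]
    have h2 : V'.det • v' i = ∑ s, (V' i s * l) • R v s := by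
      ext j
      have := congrFun (congrFun h1 i) j
      rw [hR v', hRl, Matrix.mul_apply] at this
      simp only [Matrix.smul_apply, Matrix.of_apply, Pi.smul_apply, smul_eq_mul] at this
      simp only [Pi.smul_apply, smul_eq_mul, Finset.sum_apply]
      rw [← this]
      exact Finset.sum_congr rfl fun s _ => by ring
    have h3 : v' i = V'.det⁻¹ • ∑ s, (V' i s * l) • R v s := by
      rw [← h2, smul_smul, inv_mul_cancel₀ hV', one_smul]
    rw [h3]
    exact Submodule.smul_mem _ _ (Submodule.sum_mem _ fun s _ => Submodule.smul_mem _ _ (hRmem s))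
  obtain ⟨k, v, hv, hW, rfl⟩ := hc
  obtain ⟨k', v', hv', hW', rfl⟩ := hc'
  obtain ⟨A, hAk, hA⟩ := exists_plucker_ne_zero hv
  obtain ⟨B, hBk, hB⟩ := exists_plucker_ne_zero hv'
  have hAB := mul_ne_zero hA hB
  rw [h A B] at hAB
  have hk : k = k' := by
    by_contra hne
    exact left_ne_zero_of_mul hAB (plucker_of_card_ne (by omega))
  subst hk
  have hA' := right_ne_zero_of_mul hAB
  rw [← hW, ← hW']
  refine le_antisymm (aux (l := plucker v A / plucker v' A) hA fun C => ?_)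
    (aux (l := plucker v' A / plucker v A) hA' fun C => ?_)
  · have := h A C
    field_simp
    linear_combination -this
  · have := h A C
    field_simp
    linear_combination this

end Plucker
end Tetra

namespace Tetra

/-! ### Minors bordering an initial set of columns, Cauchy–Binet, and general position. -/

section Plucker

theorem card_initialSet {k : ℕ} (hk : k ≤ 4) : (initialSet k).card = k := by
  interval_cases k <;> rfl

theorem mem_initialSet {k : ℕ} {i : Fin 4} : i ∈ initialSet k ↔ i.val < k := by
  simp [initialSet]

theorem initialSet_succ (m : Fin 4) : initialSet (m + 1) = insert m (initialSet m) := by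
  ext i
  simp [mem_initialSet, Fin.ext_iff]
  omega

theorem secondSet_succ (m : Fin 3) : secondSet (m + 1) = insert m.succ (initialSet m) := by
  ext i
  simp [secondSet, initialSet, Fin.ext_iff]
  omega

theorem insert_initialSet_ne_empty (m : ℕ) (j : Fin 4) : insert j (initialSet m) ≠ ∅ :=
  Finset.insert_ne_empty _ _

/-- The minor with the first `m` columns and the column `j`. -/
noncomputable def borderMinor {m : ℕ} (hm : m ≤ 4) (v : Fin (m + 1) → Fin 4 → ℂ) (j : Fin 4) : ℂ :=
  (Matrix.of fun r c : Fin (m + 1) => v r (Fin.snoc (α := fun _ => Fin 4) (Fin.castLE hm) j c)).det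

theorem borderMinor_eq_zero {m : ℕ} (hm : m ≤ 4) (v : Fin (m + 1) → Fin 4 → ℂ) {j : Fin 4}
    (hj : j.val < m) : borderMinor hm v j = 0 := by
  refine Matrix.det_zero_of_column_eq (i := Fin.castSucc ⟨j, hj⟩) (j := Fin.last m)
    (Fin.castSucc_lt_last _).ne fun r => ?_
  simp only [Matrix.of_apply, Fin.snoc_castSucc, Fin.snoc_last]
  congr 1

/-- For `j < m` both sides vanish: the set is too small to index a Plücker coordinate, and the minor
has a repeated column. Otherwise `j` is the largest element, so the columns are already in
increasing order and no sign appears. -/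
theorem plucker_insert_initialSet {m : ℕ} (hm : m ≤ 4) (v : Fin (m + 1) → Fin 4 → ℂ) (j : Fin 4) :
    plucker v (insert j (initialSet m)) = borderMinor hm v j := by
  by_cases hj : j.val < m
  · rw [borderMinor_eq_zero hm v hj, Finset.insert_eq_of_mem (mem_initialSet.2 hj),
      plucker_of_card_ne (by rw [card_initialSet hm]; omega)]
  · have hc : (insert j (initialSet m)).card = m + 1 := by
      rw [Finset.card_insert_of_notMem (by rwa [mem_initialSet]), card_initialSet hm]
    rw [plucker_of_card hc, borderMinor]
    have : Fin.snoc (α := fun _ => Fin 4) (Fin.castLE hm) j =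
        (insert j (initialSet m)).orderEmbOfFin hc := by
      refine Finset.orderEmbOfFin_unique hc (fun x => ?_) ?_
      · refine Fin.lastCases ?_ (fun i => ?_) x
        · rw [Fin.snoc_last]
          exact Finset.mem_insert_self _ _
        · rw [Fin.snoc_castSucc]
          exact Finset.mem_insert_of_mem (mem_initialSet.2 i.2)
      · intro x y
        refine Fin.lastCases ?_ (fun i => ?_) x <;> refine Fin.lastCases ?_ (fun i' => ?_) y
        · intro h; exact absurd h (lt_irrefl _)
        · intro h; exact absurd h (Fin.castSucc_lt_last i').not_gt
        · intro _
          simp only [Fin.snoc_castSucc, Fin.snoc_last, Fin.lt_def, Fin.val_castLE]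
          omega
        · intro h
          rw [Fin.snoc_castSucc, Fin.snoc_castSucc]
          exact h
    rw [this]

/-- Laplace expansion along the last column: the cofactors do not involve `j`. -/
theorem borderMinor_mem_span {m : ℕ} (hm : m ≤ 4) (v : Fin (m + 1) → Fin 4 → ℂ) :
    borderMinor hm v ∈ Submodule.span ℂ (Set.range v) := by
  have : borderMinor hm v = ∑ i : Fin (m + 1), ((-1) ^ ((i : ℕ) + (Fin.last m : ℕ)) *
      (Matrix.of fun (r c : Fin m) => v (i.succAbove r) (Fin.castLE hm c)).det) • v i := by
    ext j
    rw [borderMinor, Matrix.det_succ_column _ (Fin.last m), Finset.sum_apply]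
    refine Finset.sum_congr rfl fun i _ => ?_
    simp only [Matrix.of_apply, Fin.snoc_last, Pi.smul_apply, smul_eq_mul]
    have : (Matrix.of fun r c : Fin (m + 1) =>
        v r (Fin.snoc (α := fun _ => Fin 4) (Fin.castLE hm) j c)).submatrix i.succAbove
          (Fin.last m).succAbove =
        Matrix.of fun (r c : Fin m) => v (i.succAbove r) (Fin.castLE hm c) := by
      ext r c
      simp [Fin.succAbove_last]
    rw [this]
    ring
  rw [this]
  exact Submodule.sum_mem _ fun i _ => Submodule.smul_mem _ _ (Submodule.subset_span ⟨i, rfl⟩)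

/-- The minor is upper triangular, with diagonal entries `1, …, 1` followed by the entry of the last
vector in column `j`. -/
theorem plucker_insert_of_triangular {m : ℕ} (hm : m ≤ 4) (v : Fin (m + 1) → Fin 4 → ℂ)
    (h0 : ∀ (r : Fin (m + 1)) (i : Fin 4), i.val < r.val → v r i = 0)
    (h1 : ∀ (r : Fin m), v r.castSucc (Fin.castLE hm r) = 1) (j : Fin 4) :
    plucker v (insert j (initialSet m)) = v (Fin.last m) j := by
  rw [plucker_insert_initialSet hm, borderMinor, Matrix.det_of_isUpperTriangular, Fin.prod_univ_castSucc]
  · simp [h1]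
  · intro r c hrc
    obtain ⟨c', rfl⟩ : ∃ c' : Fin m, c = c'.castSucc :=
      ⟨c.castLT (by have : c.val < r.val := hrc; omega), by simp⟩
    simp only [Matrix.of_apply, Fin.snoc_castSucc]
    exact h0 _ _ hrc

theorem plucker_snoc_add_smul {m : ℕ} (v : Fin m → Fin 4 → ℂ) (x y : Fin 4 → ℂ) (a : ℂ)
    (A : Finset (Fin 4)) :
    plucker (Fin.snoc (α := fun _ => Fin 4 → ℂ) v (x + a • y)) A =
      plucker (Fin.snoc (α := fun _ => Fin 4 → ℂ) v x) A +
        a * plucker (Fin.snoc (α := fun _ => Fin 4 → ℂ) v y) A := by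
  by_cases h : A.card = m + 1
  · rw [plucker_of_card h, plucker_of_card h, plucker_of_card h]
    have key : ∀ z : Fin 4 → ℂ, (Matrix.of fun i j : Fin (m + 1) =>
        (Fin.snoc (α := fun _ => Fin 4 → ℂ) v z : Fin (m + 1) → Fin 4 → ℂ) i
          (A.orderEmbOfFin h j)) =
        (Matrix.of fun i j : Fin (m + 1) =>
          (Fin.snoc (α := fun _ => Fin 4 → ℂ) v 0 : Fin (m + 1) → Fin 4 → ℂ) i
          (A.orderEmbOfFin h j)).updateRow (Fin.last m) fun j => z (A.orderEmbOfFin h j) := by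
      intro z
      ext i j
      refine Fin.lastCases ?_ (fun i => ?_) i
      · simp
      · rw [Matrix.updateRow_ne (Fin.castSucc_lt_last i).ne]
        simp
    rw [key, key x, key y, ← Matrix.det_updateRow_smul, ← Matrix.det_updateRow_add]
    rfl
  · simp [plucker_of_card_ne h]

/-! ### The Cauchy–Binet formula -/

/-- Multilinear expansion of the determinant of the product, before the maps `g` are grouped by
their images; the maps that are not injective contribute zero but are kept. -/
theorem det_mul_rectangular {k : ℕ} {n : Type} [Fintype n] [DecidableEq n]
    (M : Matrix (Fin k) n ℂ) (N : Matrix n (Fin k) ℂ) :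
    (M * N).det = ∑ g : Fin k → n, (∏ j, N (g j) j) * (Matrix.of fun i j => M i (g j)).det := by
  rw [← Matrix.det_transpose]
  have h1 : (M * N).transpose = fun j => ∑ l, N l j • M.transpose l := by
    ext j i
    simp [Matrix.mul_apply, mul_comm]
  have := MultilinearMap.map_sum (Matrix.detRowAlternating (R := ℂ) (n := Fin k)).toMultilinearMap
    (fun j l => N l j • M.transpose l)
  change Matrix.detRowAlternating _ = _
  rw [h1]
  refine this.trans (Finset.sum_congr rfl fun g _ => ?_)
  rw [MultilinearMap.map_smul_univ, smul_eq_mul]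
  congr 1
  rw [← Matrix.det_transpose]
  rfl

theorem plucker_mulVec (b : G) {k : ℕ} (v : Fin k → Fin 4 → ℂ) (A : Finset (Fin 4)) :
    plucker (fun i => (b : Matrix (Fin 4) (Fin 4) ℂ).mulVec (v i)) A =
      ∑ A', compound b A A' * plucker v A' := by
  by_cases h : A.card = k
  · subst h
    have h1 : (Matrix.of fun i j : Fin A.card => (b : Matrix (Fin 4) (Fin 4) ℂ).mulVec (v i)
        (A.orderEmbOfFin rfl j)) = Matrix.of v * (Matrix.of fun l j => b (A.orderEmbOfFin rfl j) l) := by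
      ext i j
      simp [Matrix.mul_apply, Matrix.mulVec, dotProduct, mul_comm]
    rw [plucker_of_card rfl, h1, det_mul_rectangular,
      ← Finset.sum_fiberwise (s := Finset.univ) (g := fun g : Fin A.card → Fin 4 => Finset.univ.image g)]
    refine Finset.sum_congr rfl fun A' _ => ?_
    have hinj : ∀ g : Fin A.card → Fin 4, ¬ Function.Injective g →
        (Matrix.of fun i j => v i (g j)).det = 0 := by
      intro g hg
      rw [Function.Injective] at hg
      push Not at hg
      obtain ⟨i, j, hij, hne⟩ := hg
      exact Matrix.det_zero_of_column_eq hne fun r => by simp [hij]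
    by_cases hA' : A'.card = A.card
    · set e := A'.orderEmbOfFin hA'
      rw [compound, dif_pos hA', plucker_of_card hA', mul_comm, ← Matrix.det_transpose
        (M := Matrix.of fun i j => b (A.orderEmbOfFin rfl i) (A'.orderEmbOfFin hA' j)),
        ← Matrix.det_mul, det_mul_rectangular]
      -- The maps whose image is properly contained in `A'` are not injective and contribute zero.
      -- With them included, the sum is the expansion of a product of two square matrices indexed by
      -- `A'`.
      have hsub : ∑ g : Fin A.card → Fin 4 with Finset.univ.image g = A',
          (∏ j, (Matrix.of fun l j => b (A.orderEmbOfFin rfl j) l) (g j) j) *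
            (Matrix.of fun i j => Matrix.of v i (g j)).det =
          ∑ g : Fin A.card → Fin 4 with Finset.univ.image g ⊆ A',
          (∏ j, (Matrix.of fun l j => b (A.orderEmbOfFin rfl j) l) (g j) j) *
            (Matrix.of fun i j => Matrix.of v i (g j)).det := by
        refine Finset.sum_subset (fun g hg => ?_) fun g hg hg' => ?_
        · simp only [Finset.mem_filter] at hg ⊢
          exact ⟨hg.1, hg.2.subset⟩
        · simp only [Finset.mem_filter, Finset.mem_univ, true_and] at hg hg'
          refine mul_eq_zero_of_right _ (hinj g fun hi => hg' ?_)
          refine Finset.eq_of_subset_of_card_le hg ?_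
          rw [Finset.card_image_of_injective _ hi]
          simp [hA']
      rw [hsub]
      symm
      refine Finset.sum_of_injOn (fun h => e ∘ h) ?_ ?_ ?_ ?_
      · exact fun h _ h' _ hh => funext fun i => e.injective (congrFun hh i)
      · intro h _
        simp only [Finset.coe_filter, Finset.mem_univ, true_and, Set.mem_ofPred_eq,
          Finset.image_subset_iff, Function.comp_apply, forall_const]
        exact fun i => Finset.orderEmbOfFin_mem _ _ _
      · intro g hg hg'
        exfalso
        apply hg'
        simp only [Finset.mem_filter, Finset.mem_univ, true_and, Finset.image_subset_iff,
          forall_const] at hg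
        have : ∀ i, ∃ l, e l = g i := fun i => by
          have : g i ∈ Set.range e := by rw [Finset.range_orderEmbOfFin]; exact hg i
          exact this
        choose l hl using this
        exact ⟨l, by simp, funext hl⟩
      · intro h _
        rfl
    · rw [plucker_of_card_ne hA', mul_zero]
      refine Finset.sum_eq_zero fun g hg => ?_
      have hg' : ¬ Function.Injective g := fun hi => hA' (by
        rw [← (Finset.mem_filter.1 hg).2, Finset.card_image_of_injective _ hi]; simp)
      simp [hinj g hg']
  · rw [plucker_of_card_ne h]
    refine (Finset.sum_eq_zero fun A' _ => ?_).symm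
    by_cases hA' : A'.card = A.card
    · rw [plucker_of_card_ne (by omega), mul_zero]
    · rw [compound, dif_neg hA', zero_mul]

/-! ### Subspaces in general position to the flag at infinity -/

/-- The subspace `W` meets the subspace of vectors without the first `k` coordinates in `0`. -/
def IsGeneric (W : Gras) (k : ℕ) : Prop :=
  ∀ v ∈ W, (∀ i : Fin 4, i.val < k → v i = 0) → v = 0

theorem finrank_le_four (W : Gras) : Module.finrank ℂ W ≤ 4 := by
  simpa using Submodule.finrank_le W

theorem orderEmbOfFin_initialSet {k : ℕ} (hk : k ≤ 4) (i : Fin k) :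
    (initialSet k).orderEmbOfFin (card_initialSet hk) i = Fin.castLE hk i := by
  have : (Fin.castLE hk : Fin k → Fin 4) = (initialSet k).orderEmbOfFin (card_initialSet hk) :=
    Finset.orderEmbOfFin_unique _ (fun x => mem_initialSet.2 x.2) (Fin.strictMono_castLE hk)
  exact (congrFun this i).symm

/-- A vector in the left kernel of the initial minor is a combination of the basis of `W` whose
first `k` coordinates vanish. -/
theorem rep_initialSet_ne_zero_iff {W : Gras} {k : ℕ} (hk : Module.finrank ℂ W = k)
    {c : Finset (Fin 4) → ℂ} (hc : c ∈ HomogCoords.rep W) :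
    c (initialSet k) ≠ 0 ↔ IsGeneric W k := by
  obtain ⟨k', v, hv, hW, rfl⟩ := hc
  have h1 := finrank_span_eq_card hv
  rw [hW, Fintype.card_fin, hk] at h1
  subst h1
  have hk4 : k ≤ 4 := hk ▸ finrank_le_four W
  rw [plucker_of_card (card_initialSet hk4), Ne, ← Matrix.exists_vecMul_eq_zero_iff, not_iff_comm]
  have hcomb : ∀ (u : Fin k → ℂ) (j : Fin k), Matrix.vecMul u (Matrix.of fun i j : Fin k =>
      v i ((initialSet k).orderEmbOfFin (card_initialSet hk4) j)) j =
        (∑ i, u i • v i) (Fin.castLE hk4 j) := by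
    intro u j
    simp only [Matrix.vecMul, dotProduct, Matrix.of_apply, Finset.sum_apply, Pi.smul_apply,
      smul_eq_mul]
    exact Finset.sum_congr rfl fun i _ => by rw [orderEmbOfFin_initialSet hk4]
  constructor
  · intro h
    rw [IsGeneric] at h
    push Not at h
    obtain ⟨w, hw, h0, hne⟩ := h
    rw [← hW] at hw
    obtain ⟨u, rfl⟩ := (Submodule.mem_span_range_iff_exists_fun ℂ).1 hw
    refine ⟨u, by rintro rfl; simp at hne, ?_⟩
    ext j
    rw [hcomb]
    exact h0 _ j.2
  · rintro ⟨u, hu, h0⟩ h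
    have := h (∑ i, u i • v i) (hW ▸ Submodule.sum_mem _ fun i _ => Submodule.smul_mem _ _
      (Submodule.subset_span ⟨i, rfl⟩)) fun i hi => by
        have := congrFun h0 ⟨i, hi⟩
        rw [hcomb] at this
        exact this
    exact hu (funext fun i => Fintype.linearIndependent_iff.1 hv u this i)

/-- The vector of the `m + 1`-dimensional subspace `W` whose first `m + 1` coordinates are
`0, …, 0, 1`. -/
noncomputable def stdVec (W : Gras) (m : ℕ) : Fin 4 → ℂ := fun j =>
  pluckerRatio W (insert j (initialSet m)) (initialSet (m + 1))

theorem initialSet_succ_ne_empty (m : ℕ) : initialSet (m + 1) ≠ ∅ :=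
  Finset.ne_empty_of_mem (mem_initialSet.2 (show (0 : Fin 4).val < m + 1 by simp))

section StdVec

variable {W : Gras} {m : ℕ}

theorem stdVec_eq {c : Finset (Fin 4) → ℂ} (hc : c ∈ HomogCoords.rep W) (j : Fin 4) :
    stdVec W m j = c (insert j (initialSet m)) / c (initialSet (m + 1)) :=
  pluckerRatio_eq hc (insert_initialSet_ne_empty m j) (initialSet_succ_ne_empty m)

variable (hW : Module.finrank ℂ W = m + 1)
include hW

/-- The vector is a multiple of the vector of bordered minors. If the initial minor vanishes,
division by zero makes it `0`, which still lies in `W`, so general position plays no role here. -/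
theorem stdVec_mem : stdVec W m ∈ W := by
  obtain ⟨c, hc⟩ := HomogTorsor.nonempty W
  have hc' := hc
  obtain ⟨k', v, hv, hW', rfl⟩ := hc'
  have h1 := finrank_span_eq_card hv
  rw [hW', Fintype.card_fin, hW] at h1
  subst h1
  have hm : m ≤ 4 := by have := finrank_le_four W; omega
  have : stdVec W m = (plucker v (initialSet (m + 1)))⁻¹ • borderMinor hm v := by
    ext j
    rw [stdVec_eq hc, plucker_insert_initialSet hm]
    simp [div_eq_inv_mul]
  rw [this, ← hW']
  exact Submodule.smul_mem _ _ (borderMinor_mem_span hm v)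

theorem stdVec_eq_zero {i : Fin 4} (hi : i.val < m) : stdVec W m i = 0 := by
  obtain ⟨c, hc⟩ := HomogTorsor.nonempty W
  rw [stdVec_eq hc]
  obtain ⟨k', v, hv, hW', rfl⟩ := hc
  have h1 := finrank_span_eq_card hv
  rw [hW', Fintype.card_fin, hW] at h1
  subst h1
  have hm : m ≤ 4 := by have := finrank_le_four W; omega
  rw [plucker_insert_initialSet hm, borderMinor_eq_zero hm v hi, zero_div]

theorem stdVec_eq_one (hg : IsGeneric W (m + 1)) {i : Fin 4} (hi : i.val = m) :
    stdVec W m i = 1 := by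
  obtain ⟨c, hc⟩ := HomogTorsor.nonempty W
  rw [stdVec_eq hc]
  subst hi
  rw [← initialSet_succ]
  exact div_self ((rep_initialSet_ne_zero_iff hW hc).2 hg)

/-- Two such vectors differ by an element of `W` whose first `m + 1` coordinates vanish, and general
position makes it zero. -/
theorem eq_stdVec (hg : IsGeneric W (m + 1)) {v : Fin 4 → ℂ} (hv : v ∈ W)
    (h0 : ∀ i : Fin 4, i.val < m → v i = 0) (h1 : ∀ i : Fin 4, i.val = m → v i = 1) :
    v = stdVec W m := by
  refine sub_eq_zero.1 (hg _ (W.sub_mem hv (stdVec_mem hW)) fun i hi => ?_)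
  rcases Nat.lt_or_ge i m with h | h
  · simp [h0 i h, stdVec_eq_zero hW h]
  · have : i.val = m := by omega
    simp [h1 i this, stdVec_eq_one hW hg this]

end StdVec

end Plucker
end Tetra

namespace Tetra

theorem linearIndependent_of_plucker_ne_zero {k : ℕ} {v : Fin k → Fin 4 → ℂ} {A : Finset (Fin 4)}
    (h : plucker v A ≠ 0) : LinearIndependent ℂ v := by
  have hc : A.card = k := by
    by_contra hne
    exact h (plucker_of_card_ne hne)
  rw [plucker_of_card hc, ← isUnit_iff_ne_zero, ← Matrix.isUnit_iff_isUnit_det,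
    ← Matrix.linearIndependent_rows_iff_isUnit] at h
  exact LinearIndependent.of_comp (LinearMap.funLeft ℂ ℂ (A.orderEmbOfFin hc)) h

/-! ### Systems of vectors -/

/-- The systems of vectors `v_I` with coordinates `w`: the vectors of the flag are the `s_i`, the
vectors at the ends of an edge `α = {I, J}` differ by `x_α` times the vector at `I ∪ J`, and the
first coordinates of `v_I` are `0, …, 0, 1`, the last one in position `|I|`. -/
structure IsSystem (w : AffineOE) (v : Finset (Fin 4) → Fin 4 → ℂ) : Prop where
  init : ∀ k : Fin 4, v (Finset.Iic k) = opVec w.1 k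
  edge : ∀ α : Edge, v α.1.2 = v α.1.1 + w.2 α • v (α.1.1 ∪ α.1.2)
  zero : ∀ (I : Finset (Fin 4)) (i : Fin 4), i.val + 1 < I.card → v I i = 0
  one : ∀ (I : Finset (Fin 4)) (i : Fin 4), i.val + 1 = I.card → v I i = 1

/-- The index set of the coordinates of `𝔸_op × 𝔸_ℰ`. -/
abbrev AffIdx : Type := OpIdx ⊕ Edge

/-- The coordinate vector of a point of `𝔸_op × 𝔸_ℰ`. -/
def affCoord (w : AffineOE) : AffIdx → ℂ := Sum.elim w.1 w.2

theorem opVec_isPolyFun (k i : Fin 4) :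
    IsPolyFun fun c : AffIdx → ℂ => opVec (fun ij => c (Sum.inl ij)) k i := by
  by_cases h : k < i
  · simp only [opVec, dif_pos h]
    exact IsPolyFun.coord _
  · simp only [opVec, dif_neg h]
    exact IsPolyFun.const _

/-- The initial sets carry the vectors of the flag, with entries `0`, `1` and flag coordinates. The
edge relation gives `v_J` once `v_I` and `v_{I ∪ J}` are known; going down through the sizes `3, 2,
1` it reaches all the nonempty sets. -/
theorem exists_sysVec (I : Finset (Fin 4)) (hI : I ≠ ∅) :
    ∃ F : (AffIdx → ℂ) → Fin 4 → ℂ, (∀ i, IsPolyFun fun c => F c i) ∧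
      ∀ w v, IsSystem w v → v I = F (affCoord w) := by
  let P : Finset (Fin 4) → Prop := fun I => ∃ F : (AffIdx → ℂ) → Fin 4 → ℂ,
    (∀ i, IsPolyFun fun c => F c i) ∧ ∀ w v, IsSystem w v → v I = F (affCoord w)
  have hinit : ∀ k : Fin 4, P (Finset.Iic k) := fun k =>
    ⟨fun c => opVec (fun ij => c (Sum.inl ij)) k, fun i => opVec_isPolyFun k i, fun w v h => h.init k⟩
  have hedge : ∀ α : Edge, P α.1.1 → P (α.1.1 ∪ α.1.2) → P α.1.2 := by
    rintro α ⟨F, hF, hF'⟩ ⟨F₂, hF₂, hF₂'⟩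
    refine ⟨fun c => F c + c (Sum.inr α) • F₂ c, fun i => ?_, fun w v h => ?_⟩
    · exact (hF i).add ((IsPolyFun.coord _).mul (hF₂ i))
    · rw [h.edge α, hF' w v h, hF₂' w v h]
      rfl
  have step : ∀ I J K : Finset (Fin 4), (I.card = J.card ∧ (I ∩ J).card + 1 = I.card ∧
      (∃ i ∈ I \ J, ∃ j ∈ J \ I, i < j)) ∧ I ∪ J = K → P I → P K → P J := by
    rintro I J _ ⟨h, rfl⟩ h1 h2
    exact hedge ⟨(I, J), h⟩ h1 h2
  have h0 : P {0} := hinit 0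
  have h01 : P {0, 1} := hinit 1
  have h012 : P {0, 1, 2} := hinit 2
  have h0123 : P {0, 1, 2, 3} := hinit 3
  have h013 : P {0, 1, 3} := step _ _ _ (by decide) h012 h0123
  have h023 : P {0, 2, 3} := step _ _ _ (by decide) h012 h0123
  have h123 : P {1, 2, 3} := step _ _ _ (by decide) h012 h0123
  have h02 : P {0, 2} := step _ _ _ (by decide) h01 h012
  have h12 : P {1, 2} := step _ _ _ (by decide) h01 h012
  have h03 : P {0, 3} := step _ _ _ (by decide) h01 h013
  have h13 : P {1, 3} := step _ _ _ (by decide) h01 h013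
  have h23 : P {2, 3} := step _ _ _ (by decide) h02 h023
  have h1 : P {1} := step _ _ _ (by decide) h0 h01
  have h2 : P {2} := step _ _ _ (by decide) h0 h02
  have h3 : P {3} := step _ _ _ (by decide) h0 h03
  have hall : ∀ I : Finset (Fin 4), I ≠ ∅ → I = {0} ∨ I = {0, 1} ∨ I = {0, 1, 2} ∨
      I = {0, 1, 2, 3} ∨ I = {0, 1, 3} ∨ I = {0, 2, 3} ∨ I = {1, 2, 3} ∨ I = {0, 2} ∨
      I = {1, 2} ∨ I = {0, 3} ∨ I = {1, 3} ∨ I = {2, 3} ∨ I = {1} ∨ I = {2} ∨ I = {3} := by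
    decide
  rcases hall I hI with rfl | rfl | rfl | rfl | rfl | rfl | rfl | rfl | rfl | rfl | rfl | rfl |
    rfl | rfl | rfl
  all_goals assumption

/-- The vectors of a system as polynomials in its coordinates. -/
noncomputable def sysVec (w : AffineOE) (I : Finset (Fin 4)) : Fin 4 → ℂ :=
  if h : I = ∅ then 0 else (exists_sysVec I h).choose (affCoord w)

theorem IsSystem.eq_sysVec {w : AffineOE} {v : Finset (Fin 4) → Fin 4 → ℂ} (h : IsSystem w v)
    {I : Finset (Fin 4)} (hI : I ≠ ∅) : v I = sysVec w I := by
  rw [sysVec, dif_neg hI]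
  exact (exists_sysVec I hI).choose_spec.2 w v h

theorem exists_isPolyFun_sysVec (I : Finset (Fin 4)) (i : Fin 4) :
    ∃ F : (AffIdx → ℂ) → ℂ, IsPolyFun F ∧ ∀ w, sysVec w I i = F (affCoord w) := by
  by_cases hI : I = ∅
  · exact ⟨fun _ => 0, IsPolyFun.const 0, fun w => by simp [sysVec, hI]⟩
  · exact ⟨_, (exists_sysVec I hI).choose_spec.1 i, fun w => by rw [sysVec, dif_neg hI]⟩

/-- The points of `𝔸_op × 𝔸_ℰ` that are the coordinates of a system. -/
def IsCoherent (w : AffineOE) : Prop := IsSystem w (sysVec w)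

theorem IsSystem.isCoherent {w : AffineOE} {v : Finset (Fin 4) → Fin 4 → ℂ} (h : IsSystem w v) :
    IsCoherent w := by
  have hne : ∀ k : Fin 4, Finset.Iic k ≠ ∅ := fun k => Finset.ne_empty_of_mem (Finset.mem_Iic.2 le_rfl)
  have hcard : ∀ α : Edge, α.1.1 ≠ ∅ ∧ α.1.2 ≠ ∅ := fun α => by
    obtain ⟨h1, h2, -⟩ := α.2
    exact ⟨fun h0 => by rw [h0] at h2; simp at h2, fun h0 => by rw [h1, h0] at h2; simp at h2⟩
  refine ⟨fun k => ?_, fun α => ?_, fun I i hi => ?_, fun I i hi => ?_⟩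
  · rw [← h.eq_sysVec (hne k), h.init]
  · rw [← h.eq_sysVec (hcard α).1, ← h.eq_sysVec (hcard α).2, ← h.eq_sysVec, h.edge]
    exact fun h0 => (hcard α).1 (Finset.union_eq_empty.1 h0).1
  · rw [← h.eq_sysVec (by rintro rfl; simp at hi), h.zero I i hi]
  · rw [← h.eq_sysVec (by rintro rfl; simp at hi), h.one I i hi]

/-- Each condition in `IsSystem` becomes a family of polynomial equations once the vectors are
replaced by their polynomial expressions. Coherence therefore passes to closures. -/
theorem exists_isCoherent_iff : ∃ T : Set ((AffIdx → ℂ) → ℂ), (∀ F ∈ T, IsPolyFun F) ∧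
    ∀ w, IsCoherent w ↔ ∀ F ∈ T, F (affCoord w) = 0 := by
  choose S hS hS' using exists_isPolyFun_sysVec
  refine ⟨Set.range (fun ki : Fin 4 × Fin 4 => fun c => S (Finset.Iic ki.1) ki.2 c -
      opVec (fun ij => c (Sum.inl ij)) ki.1 ki.2) ∪
    Set.range (fun αi : Edge × Fin 4 => fun c => S αi.1.1.2 αi.2 c -
      (S αi.1.1.1 αi.2 c + c (Sum.inr αi.1) * S (αi.1.1.1 ∪ αi.1.1.2) αi.2 c)) ∪
    {F | ∃ (I : Finset (Fin 4)) (i : Fin 4), i.val + 1 < I.card ∧ F = S I i} ∪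
    {F | ∃ (I : Finset (Fin 4)) (i : Fin 4), i.val + 1 = I.card ∧ F = fun c => S I i c - 1},
    ?_, fun w => ?_⟩
  · rintro F (((⟨ki, rfl⟩ | ⟨αi, rfl⟩) | ⟨I, i, hi, rfl⟩) | ⟨I, i, hi, rfl⟩)
    · exact (hS _ _).sub (opVec_isPolyFun _ _)
    · exact (hS _ _).sub ((hS _ _).add ((IsPolyFun.coord _).mul (hS _ _)))
    · exact hS _ _
    · exact (hS _ _).sub (IsPolyFun.const _)
  · constructor
    · rintro h F (((⟨ki, rfl⟩ | ⟨αi, rfl⟩) | ⟨I, i, hi, rfl⟩) | ⟨I, i, hi, rfl⟩)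
      · beta_reduce
        rw [← hS', sub_eq_zero]
        exact congrFun (h.init ki.1) ki.2
      · beta_reduce
        rw [← hS', ← hS', ← hS', sub_eq_zero]
        exact congrFun (h.edge αi.1) αi.2
      · rw [← hS', h.zero I i hi]
      · beta_reduce
        rw [← hS', h.one I i hi, sub_self]
    · intro h
      refine ⟨fun k => funext fun i => ?_, fun α => funext fun i => ?_, fun I i hi => ?_,
        fun I i hi => ?_⟩
      · rw [hS']
        exact sub_eq_zero.1 (h _ (Or.inl (Or.inl (Or.inl ⟨(k, i), rfl⟩))))
      · rw [Pi.add_apply, Pi.smul_apply, hS', hS', hS']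
        exact sub_eq_zero.1 (h _ (Or.inl (Or.inl (Or.inr ⟨(α, i), rfl⟩))))
      · rw [hS']
        exact h _ (Or.inl (Or.inr ⟨I, i, hi, rfl⟩))
      · rw [hS']
        exact sub_eq_zero.1 (h _ (Or.inr ⟨I, i, hi, rfl⟩))

/-! ### The configuration of a system -/

/-- The span of the vectors of a system at the subsets of `I`. -/
def sysSpace (v : Finset (Fin 4) → Fin 4 → ℂ) (I : Finset (Fin 4)) : Gras :=
  Submodule.span ℂ (v '' {K | K ≠ ∅ ∧ K ⊆ I})

theorem sysSpace_mono (v : Finset (Fin 4) → Fin 4 → ℂ) {I J : Finset (Fin 4)} (h : I ⊆ J) :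
    sysSpace v I ≤ sysSpace v J :=
  Submodule.span_mono (Set.image_mono fun _ hK => ⟨hK.1, hK.2.trans h⟩)

theorem mem_sysSpace {v : Finset (Fin 4) → Fin 4 → ℂ} {I K : Finset (Fin 4)} (hK : K ≠ ∅)
    (h : K ⊆ I) : v K ∈ sysSpace v I := Submodule.subset_span ⟨K, ⟨hK, h⟩, rfl⟩

namespace IsSystem

variable {w : AffineOE} {v : Finset (Fin 4) → Fin 4 → ℂ} (h : IsSystem w v)
include h

/-- The two sets are the ends of an edge with union `I`. Edges are oriented lexicographically, so
one of the two orders needs a change of sign. -/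
theorem erase_eq {I : Finset (Fin 4)} {i j : Fin 4} (hi : i ∈ I) (hj : j ∈ I) (hij : i ≠ j) :
    ∃ a : ℂ, v (I.erase j) = v (I.erase i) + a • v I := by
  have aux : ∀ {i j : Fin 4}, i ∈ I → j ∈ I → i < j →
      ∃ a : ℂ, v (I.erase i) = v (I.erase j) + a • v I := by
    intro i j hi hj hlt
    have hu : I.erase j ∪ I.erase i = I := by
      ext l
      simp only [Finset.mem_union, Finset.mem_erase]
      have := hlt.ne
      constructor
      · rintro (h | h) <;> exact h.2
      · intro hl
        by_cases hlj : l = j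
        · exact Or.inr ⟨by rw [hlj]; exact this.symm, hl⟩
        · exact Or.inl ⟨hlj, hl⟩
    have hn : I.erase j ∩ I.erase i = (I.erase j).erase i := by
      ext l
      simp only [Finset.mem_inter, Finset.mem_erase]
      tauto
    have hcard : (I.erase j).card - 1 + 1 = (I.erase j).card :=
      Nat.sub_add_cancel (Finset.card_pos.2 ⟨i, Finset.mem_erase.2 ⟨hlt.ne, hi⟩⟩)
    have := h.edge ⟨(I.erase j, I.erase i), by simp [Finset.card_erase_of_mem, hi, hj], by
      rw [hn, Finset.card_erase_of_mem (Finset.mem_erase.2 ⟨hlt.ne, hi⟩)]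
      exact hcard, i, by simp [hi, hlt.ne], j, by simp [hj, hlt.ne'], hlt⟩
    simp only [hu] at this
    exact ⟨_, this⟩
  rcases lt_or_gt_of_ne hij with hlt | hlt
  · obtain ⟨a, ha⟩ := aux hi hj hlt
    exact ⟨-a, by rw [ha]; module⟩
  · exact aux hj hi hlt

/-- Removing one element lowers the span by at most one dimension. For `K ⊆ I \ {j}` with `j ≠ i`,
induction places `v_K` in the span for `I \ {i, j}` plus the line of `v_{I \ {j}}`, and the latter
vector is `v_{I \ {i}}` plus a multiple of `v_I`. -/
theorem sysSpace_le_sup : ∀ (n : ℕ) (I : Finset (Fin 4)), I.card = n → ∀ i ∈ I,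
    sysSpace v I ≤ sysSpace v (I.erase i) ⊔ Submodule.span ℂ {v I} := by
  intro n
  induction n with
  | zero =>
    intro I hI i hi
    rw [Finset.card_eq_zero.1 hI] at hi
    simp at hi
  | succ n ih =>
    intro I hI i hi
    refine Submodule.span_le.2 ?_
    rintro _ ⟨K, ⟨hK0, hKI⟩, rfl⟩
    by_cases hK : K = I
    · rw [hK]
      exact Submodule.mem_sup_right (Submodule.mem_span_singleton_self _)
    obtain ⟨j, hj, hjK⟩ : ∃ j ∈ I, j ∉ K := by
      by_contra hne
      push Not at hne
      exact hK (hKI.antisymm hne)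
    have hK' : K ⊆ I.erase j := fun l hl => Finset.mem_erase.2 ⟨fun h => hjK (h ▸ hl), hKI hl⟩
    by_cases hij : i = j
    · subst hij
      exact Submodule.mem_sup_left (mem_sysSpace hK0 hK')
    have hie : i ∈ I.erase j := Finset.mem_erase.2 ⟨hij, hi⟩
    have hje : j ∈ I.erase i := Finset.mem_erase.2 ⟨Ne.symm hij, hj⟩
    have h1 := ih (I.erase j) (by rw [Finset.card_erase_of_mem hj]; omega) i hie
      (mem_sysSpace hK0 hK')
    have h2 : sysSpace v ((I.erase j).erase i) ⊔ Submodule.span ℂ {v (I.erase j)} ≤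
        sysSpace v (I.erase i) ⊔ Submodule.span ℂ {v I} := by
      refine sup_le ((sysSpace_mono v ?_).trans le_sup_left) ?_
      · exact Finset.erase_subset_erase _ (Finset.erase_subset _ _)
      · rw [Submodule.span_singleton_le_iff_mem]
        obtain ⟨a, ha⟩ := h.erase_eq hi hj hij
        rw [ha]
        refine Submodule.add_mem _ (Submodule.mem_sup_left (mem_sysSpace ?_ subset_rfl))
          (Submodule.smul_mem _ _ (Submodule.mem_sup_right (Submodule.mem_span_singleton_self _)))
        exact Finset.ne_empty_of_mem hje
    exact h2 h1

end IsSystem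

/-- The chain depends on `I` alone and serves all systems at once; so the Plücker coordinates
computed from it are polynomials in the coordinates of the system. -/
theorem exists_chain (n : ℕ) : ∀ I : Finset (Fin 4), I.card = n →
    ∃ K : Fin n → Finset (Fin 4), (∀ r, (K r).card = r.val + 1) ∧ (∀ r, K r ⊆ I) ∧
      ∀ w v, IsSystem w v → Submodule.span ℂ (Set.range fun r => v (K r)) = sysSpace v I := by
  induction n with
  | zero =>
    intro I hI
    refine ⟨Fin.elim0, fun r => r.elim0, fun r => r.elim0, fun w v _ => ?_⟩
    rw [Finset.card_eq_zero.1 hI, sysSpace]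
    have h1 : (Set.range fun r : Fin 0 => v (r.elim0)) = ∅ := Set.range_eq_empty _
    have h2 : {K : Finset (Fin 4) | K ≠ ∅ ∧ K ⊆ ∅} = ∅ := by
      ext K
      simp
    rw [h1, h2, Set.image_empty]
  | succ n ih =>
    intro I hI
    obtain ⟨i, hi⟩ : I.Nonempty := Finset.card_pos.1 (by omega)
    obtain ⟨K, hKc, hKI, hK⟩ := ih (I.erase i) (by rw [Finset.card_erase_of_mem hi]; omega)
    refine ⟨Fin.snoc (α := fun _ => Finset (Fin 4)) K I, fun r => ?_, fun r => ?_, fun w v h => ?_⟩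
    · refine Fin.lastCases ?_ (fun r => ?_) r
      · simpa using hI
      · simpa using hKc r
    · refine Fin.lastCases ?_ (fun r => ?_) r
      · simp
      · simpa using (hKI r).trans (Finset.erase_subset _ _)
    · have : (Set.range fun r => v (Fin.snoc (α := fun _ => Finset (Fin 4)) K I r)) =
          (Set.range fun r => v (K r)) ∪ {v I} := by
        ext x
        simp only [Set.mem_range, Set.mem_union, Set.mem_singleton_iff]
        constructor
        · rintro ⟨r, rfl⟩
          refine Fin.lastCases ?_ (fun r => ?_) r
          · simp
          · left; exact ⟨r, by simp⟩
        · rintro (⟨r, rfl⟩ | rfl)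
          · exact ⟨r.castSucc, by simp⟩
          · exact ⟨Fin.last n, by simp⟩
      rw [this, Submodule.span_union, hK w v h]
      refine le_antisymm (sup_le (sysSpace_mono v (Finset.erase_subset _ _)) ?_)
        (h.sysSpace_le_sup _ I hI i hi)
      rw [Submodule.span_singleton_le_iff_mem]
      exact mem_sysSpace (Finset.ne_empty_of_mem hi) subset_rfl

/-- A maximal chain of subsets of `I`. -/
noncomputable def chain (I : Finset (Fin 4)) : Fin I.card → Finset (Fin 4) :=
  (exists_chain _ I rfl).choose

theorem card_chain (I : Finset (Fin 4)) (r : Fin I.card) : (chain I r).card = r.val + 1 :=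
  (exists_chain _ I rfl).choose_spec.1 r

theorem chain_subset (I : Finset (Fin 4)) (r : Fin I.card) : chain I r ⊆ I :=
  (exists_chain _ I rfl).choose_spec.2.1 r

theorem card_le_four (I : Finset (Fin 4)) : I.card ≤ 4 := by simpa using Finset.card_le_univ I

namespace IsSystem

variable {w : AffineOE} {v : Finset (Fin 4) → Fin 4 → ℂ} (h : IsSystem w v)
include h

theorem span_chain (I : Finset (Fin 4)) :
    Submodule.span ℂ (Set.range fun r => v (chain I r)) = sysSpace v I :=
  (exists_chain _ I rfl).choose_spec.2.2 w v h

/-- The vectors attached to sets of sizes `1, …, n` form a triangular matrix with unit diagonal on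
the first `n` columns. It normalizes all the Plücker vectors and gives the independence of the
vectors of a chain. -/
theorem plucker_initialSet {n : ℕ} (hn : n ≤ 4) (K : Fin n → Finset (Fin 4))
    (hK : ∀ r, (K r).card = r.val + 1) : plucker (fun r => v (K r)) (initialSet n) = 1 := by
  rcases n with - | m
  · rw [plucker_of_card (by rfl)]
    exact Matrix.det_isEmpty
  · have := initialSet_succ ⟨m, hn⟩
    simp only at this
    rw [this, plucker_insert_of_triangular (by omega)]
    · exact h.one _ _ (by simp [hK])
    · exact fun r i hi => h.zero _ _ (by rw [hK]; omega)
    · exact fun r => h.one _ _ (by simp [hK])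

theorem linearIndependent_chain (I : Finset (Fin 4)) :
    LinearIndependent ℂ fun r => v (chain I r) :=
  linearIndependent_of_plucker_ne_zero (A := initialSet I.card) (by
    rw [h.plucker_initialSet (card_le_four I) _ (card_chain I)]
    exact one_ne_zero)

theorem plucker_mem_rep (I : Finset (Fin 4)) :
    plucker (fun r => v (chain I r)) ∈ HomogCoords.rep (sysSpace v I) :=
  ⟨_, _, h.linearIndependent_chain I, h.span_chain I, rfl⟩

theorem finrank_sysSpace (I : Finset (Fin 4)) : Module.finrank ℂ (sysSpace v I) = I.card := by
  rw [← h.span_chain, finrank_span_eq_card (h.linearIndependent_chain I), Fintype.card_fin]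

theorem isGeneric_sysSpace (I : Finset (Fin 4)) : IsGeneric (sysSpace v I) I.card := by
  rw [← rep_initialSet_ne_zero_iff (h.finrank_sysSpace I) (h.plucker_mem_rep I),
    h.plucker_initialSet (card_le_four I) _ (card_chain I)]
  exact one_ne_zero

theorem stdVec_sysSpace {I : Finset (Fin 4)} {m : ℕ} (hI : I.card = m + 1) :
    stdVec (sysSpace v I) m = v I := by
  symm
  refine eq_stdVec (by rw [h.finrank_sysSpace, hI]) (hI ▸ h.isGeneric_sysSpace I)
    (mem_sysSpace ?_ subset_rfl) (fun i hi => h.zero _ _ (by omega)) fun i hi => h.one _ _ (by omega)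
  rintro rfl
  simp at hI

end IsSystem

end Tetra

/-! ### From configurations in general position to systems of vectors. -/

namespace Tetra

/-! ### Transversality to the flag at infinity -/

theorem mem_coordSubspace {I : Finset (Fin 4)} {v : Fin 4 → ℂ} :
    v ∈ coordSubspace I ↔ ∀ i ∉ I, v i = 0 := by
  constructor
  · intro hv
    refine Submodule.span_induction ?_ ?_ ?_ ?_ hv
    · rintro _ ⟨j, hj, rfl⟩ i hi
      exact Pi.single_eq_of_ne (by rintro rfl; exact hi hj) _
    · exact fun i _ => rfl
    · intro x y _ _ hx hy i hi
      simp [hx i hi, hy i hi]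
    · intro a x _ hx i hi
      simp [hx i hi]
  · intro h
    rw [← Finset.univ_sum_single v]
    refine Submodule.sum_mem _ fun i _ => ?_
    by_cases hi : i ∈ I
    · have : Pi.single i (v i) = v i • (Pi.single i 1 : Fin 4 → ℂ) := by
        rw [← Pi.single_smul]
        simp
      rw [this]
      exact Submodule.smul_mem _ _ (Submodule.subset_span ⟨i, hi, rfl⟩)
    · rw [h i hi, Pi.single_zero]
      exact Submodule.zero_mem _

theorem finrank_coordSubspace (I : Finset (Fin 4)) :
    Module.finrank ℂ (coordSubspace I) = I.card := by
  have hli : LinearIndependent ℂ fun i : I => (Pi.single i.1 1 : Fin 4 → ℂ) := by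
    have := (Pi.basisFun ℂ (Fin 4)).linearIndependent.comp (fun i : I => i.1)
      Subtype.val_injective
    convert this using 1
    ext i
    simp
  have := finrank_span_eq_card hli
  rw [Fintype.card_coe] at this
  have hr : (Set.range fun i : I => (Pi.single i.1 1 : Fin 4 → ℂ)) =
      (fun i => (Pi.single i 1 : Fin 4 → ℂ)) '' (I : Set (Fin 4)) := by
    ext x
    simp
  rw [← this, hr, coordSubspace]

theorem mem_flagInfinity {k : ℕ} {v : Fin 4 → ℂ} :
    v ∈ flagInfinity k ↔ ∀ i : Fin 4, i.val + k < 4 → v i = 0 := by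
  simp [flagInfinity, mem_coordSubspace]

theorem finrank_flagInfinity {k : ℕ} (hk : k ≤ 4) : Module.finrank ℂ (flagInfinity k) = k := by
  rw [flagInfinity, finrank_coordSubspace]
  interval_cases k <;> rfl

theorem isGeneric_iff_inf {W : Gras} {k : ℕ} (hk : k ≤ 4) :
    IsGeneric W k ↔ W ⊓ flagInfinity (4 - k) = ⊥ := by
  have hmem : ∀ v : Fin 4 → ℂ, v ∈ flagInfinity (4 - k) ↔ ∀ i : Fin 4, i.val < k → v i = 0 := by
    intro v
    rw [mem_flagInfinity]
    exact forall_congr' fun i => ⟨fun h hi => h (by omega), fun h hi => h (by omega)⟩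
  rw [Submodule.eq_bot_iff]
  exact ⟨fun h v hv => h v hv.1 ((hmem v).1 hv.2), fun h v hv h0 => h v ⟨hv, (hmem v).2 h0⟩⟩

/-- In complementary dimensions the two alternatives of transversality coincide, by counting
dimensions. -/
theorem isGeneric_iff_transverse {W : Gras} {k : ℕ} (hW : Module.finrank ℂ W = k) :
    IsGeneric W k ↔ Transverse W (flagInfinity (4 - k)) := by
  have hk : k ≤ 4 := hW ▸ finrank_le_four W
  rw [isGeneric_iff_inf hk, Transverse, or_iff_left_of_imp]
  intro h
  have := Submodule.finrank_sup_add_finrank_inf_eq W (flagInfinity (4 - k))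
  rw [h, finrank_top, hW, finrank_flagInfinity (by omega)] at this
  rw [← Submodule.finrank_eq_zero (R := ℂ)]
  simp at this
  omega

/-- Transversality to the member of complementary dimension implies it for all the others: a smaller
member still meets `W` in zero, and a larger one still spans everything together with `W`. -/
theorem IsGeneric.transverse {W : Gras} {k : ℕ} (hW : Module.finrank ℂ W = k) (h : IsGeneric W k)
    (l : ℕ) : Transverse W (flagInfinity l) := by
  have hk : k ≤ 4 := hW ▸ finrank_le_four W
  have h0 := (isGeneric_iff_inf hk).1 h
  have hmono : ∀ a b : ℕ, a ≤ b → flagInfinity a ≤ flagInfinity b := fun a b hab v hv => by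
    rw [mem_flagInfinity] at hv ⊢
    exact fun i hi => hv i (by omega)
  rcases le_total l (4 - k) with hl | hl
  · left
    rw [eq_bot_iff, ← h0]
    exact inf_le_inf_left _ (hmono _ _ hl)
  · right
    rw [eq_top_iff]
    refine le_trans (le_of_eq ?_) (sup_le_sup_left (hmono _ _ hl) W)
    symm
    refine Submodule.eq_top_of_finrank_eq ?_
    have := Submodule.finrank_sup_add_finrank_inf_eq W (flagInfinity (4 - k))
    rw [h0, finrank_bot, hW, finrank_flagInfinity (by omega)] at this
    simp
    omega

theorem mem_chartU_iff {p : Config} :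
    p ∈ chartU ↔ p ∈ tetrahedra ∧ ∀ I, IsGeneric (p I) I.card := by
  refine and_congr_right fun hp => ⟨fun h I => ?_, fun h I _ _ k _ _ => (h I).transverse (hp.1 I) k⟩
  by_cases h0 : I = ∅
  · have := hp.1 I
    rw [h0, Finset.card_empty, Submodule.finrank_eq_zero] at this
    intro v hv _
    rw [h0, this] at hv
    exact hv
  by_cases h1 : I = Finset.univ
  · intro v _ hv
    ext i
    exact hv i (by rw [h1]; exact i.2)
  rw [isGeneric_iff_transverse (hp.1 I)]
  have hlt : I.card < 4 := by
    have := (Finset.card_lt_iff_ne_univ I).2 h1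
    simpa using this
  have hpos : 0 < I.card := Finset.card_pos.2 (Finset.nonempty_iff_ne_empty.2 h0)
  exact h I h0 h1 _ (by omega) (by omega)

/-- Increasing families of subspaces of the right dimensions in general position. -/
structure IsGenericConfig (p : Config) : Prop where
  finrank : ∀ I, Module.finrank ℂ (p I) = I.card
  mono : ∀ I J, I ⊆ J → p I ≤ p J
  generic : ∀ I, IsGeneric (p I) I.card

/-- The vectors with first coordinates `0, …, 0, 1` in the subspaces of a configuration. -/
noncomputable def configVec (p : Config) (I : Finset (Fin 4)) : Fin 4 → ℂ :=
  stdVec (p I) (I.card - 1)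

theorem flagCoord_eq_configVec (p : Config) (i j : Fin 4) (h : i < j) :
    flagCoord p ⟨(i, j), h⟩ = configVec p (Finset.Iic i) j := by
  have h1 : Finset.Iio i = initialSet i := by ext; simp [mem_initialSet]
  have h2 : Finset.Iic i = initialSet (i + 1) := by
    ext x
    simp only [Finset.mem_Iic, mem_initialSet, Fin.le_def]
    omega
  have h3 : (Finset.Iic i).card - 1 = i := by simp
  rw [configVec, h3, stdVec, flagCoord]
  simp only [h1, h2]

theorem Edge.card_pos (α : Edge) : 0 < α.1.1.card := by
  have := α.2.2.1
  omega

theorem Edge.card_lt (α : Edge) : α.1.1.card < 4 := by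
  obtain ⟨-, -, i, -, j, hj, -⟩ := α.2
  have : α.1.1 ≠ Finset.univ := fun h => by simp [h] at hj
  simpa using (Finset.card_lt_iff_ne_univ _).2 this

theorem Edge.card_union (α : Edge) : (α.1.1 ∪ α.1.2).card = α.1.1.card + 1 := by
  have h1 := α.2.1
  have h2 := α.2.2.1
  have := Finset.card_union_add_card_inter α.1.1 α.1.2
  omega

/-- The set `K` in the definition of `x_α` arises from the initial set of size `k` by replacing its
last element by the next one, so the Plücker ratio at `K` is the first free coordinate of the
distinguished vector. -/
theorem edgeCoord_eq_configVec (p : Config) (α : Edge) (i : Fin 4) (hi : i.val = α.1.1.card) :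
    edgeCoord p α = configVec p α.1.2 i - configVec p α.1.1 i := by
  obtain ⟨m, hm⟩ : ∃ m : Fin 3, α.1.1.card = m + 1 :=
    ⟨⟨α.1.1.card - 1, by have := α.card_lt; have := α.card_pos; omega⟩, by
      have := α.card_pos; simp; omega⟩
  have hi' : i = m.succ := Fin.ext (by rw [hi, hm]; simp)
  rw [edgeCoord, configVec, configVec, ← α.2.1, hm, secondSet_succ, hi']
  simp [stdVec]

namespace IsGenericConfig

variable {p : Config} (h : IsGenericConfig p)
include h

theorem configVec_mem {I : Finset (Fin 4)} (hI : I ≠ ∅) : configVec p I ∈ p I := by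
  have := Finset.card_pos.2 (Finset.nonempty_iff_ne_empty.2 hI)
  exact stdVec_mem (by rw [h.finrank]; omega)

/-- The difference of the vectors at the ends of an edge `{I, J}` lies in the subspace of `I ∪ J`,
and its first `|I|` coordinates cancel. By general position it is a multiple of the vector at `I ∪
J`, with the factor visible in the next coordinate. -/
theorem isSystem : IsSystem (flagCoord p, edgeCoord p) (configVec p) := by
  have hzero : ∀ (I : Finset (Fin 4)) (i : Fin 4), i.val + 1 < I.card → configVec p I i = 0 := by
    intro I i hi
    exact stdVec_eq_zero (by rw [h.finrank]; omega) (by omega)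
  have hone : ∀ (I : Finset (Fin 4)) (i : Fin 4), i.val + 1 = I.card → configVec p I i = 1 := by
    intro I i hi
    exact stdVec_eq_one (by rw [h.finrank]; omega) (by rw [← hi]; simpa [← hi] using h.generic I)
      (by omega)
  refine ⟨fun k => ?_, fun α => ?_, hzero, hone⟩
  · ext j
    rcases lt_trichotomy k j with hkj | rfl | hkj
    · simp only [opVec, dif_pos hkj, flagCoord_eq_configVec]
    · simp only [opVec, lt_irrefl, dite_false, if_true]
      exact hone _ _ (by simp)
    · simp only [opVec, dif_neg hkj.not_gt, if_neg hkj.ne']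
      exact hzero _ _ (by simpa using hkj)
  · have hc1 := α.2.1
    have hpos := α.card_pos
    have hlt := α.card_lt
    have hu := α.card_union
    have hne1 : α.1.1 ≠ ∅ := Finset.card_pos.1 hpos |>.ne_empty
    have hne2 : α.1.2 ≠ ∅ := (Finset.card_pos.1 (hc1 ▸ hpos)).ne_empty
    have hneu : α.1.1 ∪ α.1.2 ≠ ∅ := fun h0 => hne1 (Finset.union_eq_empty.1 h0).1
    rw [← sub_eq_zero]
    -- General position of the subspace at `I ∪ J`: only the first `|I| + 1` coordinates of the
    -- relation need to be checked.
    refine h.generic (α.1.1 ∪ α.1.2) _ ?_ fun i hi => ?_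
    · exact Submodule.sub_mem _ (h.mono _ _ Finset.subset_union_right (h.configVec_mem hne2))
        (Submodule.add_mem _ (h.mono _ _ Finset.subset_union_left (h.configVec_mem hne1))
          (Submodule.smul_mem _ _ (h.configVec_mem hneu)))
    · simp only [Pi.sub_apply, Pi.add_apply, Pi.smul_apply, smul_eq_mul]
      rcases lt_trichotomy (i.val + 1) α.1.1.card with hlt' | heq | hgt
      · rw [hzero _ _ (hc1 ▸ hlt'), hzero _ _ hlt', hzero _ _ (by omega)]
        ring
      · rw [hone _ _ (hc1 ▸ heq), hone _ _ heq, hzero _ _ (by omega)]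
        ring
      · rw [hone (α.1.1 ∪ α.1.2) _ (by omega), edgeCoord_eq_configVec p α i (by omega)]
        ring

theorem eq_sysSpace (I : Finset (Fin 4)) : p I = sysSpace (configVec p) I := by
  symm
  refine Submodule.eq_of_le_of_finrank_eq (Submodule.span_le.2 ?_) ?_
  · rintro _ ⟨K, ⟨hK, hKI⟩, rfl⟩
    exact h.mono _ _ hKI (h.configVec_mem hK)
  · rw [h.isSystem.finrank_sysSpace, h.finrank]

end IsGenericConfig

/-- The configuration with coordinates `w`. -/
noncomputable def sysConfig (w : AffineOE) : Config := sysSpace (sysVec w)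

theorem sysSpace_congr {v v' : Finset (Fin 4) → Fin 4 → ℂ} (h : ∀ I, I ≠ ∅ → v I = v' I) :
    sysSpace v = sysSpace v' := by
  funext I
  rw [sysSpace, sysSpace]
  congr 1
  exact Set.image_congr fun K hK => h K hK.1

theorem IsSystem.sysSpace_eq {w : AffineOE} {v : Finset (Fin 4) → Fin 4 → ℂ} (h : IsSystem w v) :
    sysSpace v = sysConfig w := sysSpace_congr fun _ hI => h.eq_sysVec hI

theorem IsGenericConfig.eq_sysConfig {p : Config} (h : IsGenericConfig p) :
    p = sysConfig (flagCoord p, edgeCoord p) := by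
  rw [← h.isSystem.sysSpace_eq]
  exact funext h.eq_sysSpace

theorem IsCoherent.isGenericConfig {w : AffineOE} (h : IsCoherent w) :
    IsGenericConfig (sysConfig w) :=
  ⟨fun I => IsSystem.finrank_sysSpace h I, fun _ _ hIJ => sysSpace_mono _ hIJ,
    fun I => IsSystem.isGeneric_sysSpace h I⟩

theorem IsCoherent.configVec_sysConfig {w : AffineOE} (h : IsCoherent w) {I : Finset (Fin 4)}
    (hI : I ≠ ∅) : configVec (sysConfig w) I = sysVec w I := by
  have := Finset.card_pos.2 (Finset.nonempty_iff_ne_empty.2 hI)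
  exact IsSystem.stdVec_sysSpace h (by omega)

/-- Together with `IsGenericConfig.eq_sysConfig` this makes coherent points and increasing
configurations in general position correspond bijectively. -/
theorem IsCoherent.coord_sysConfig {w : AffineOE} (h : IsCoherent w) :
    (flagCoord (sysConfig w), edgeCoord (sysConfig w)) = w := by
  refine Prod.ext (funext ?_) (funext fun α => ?_)
  · rintro ⟨⟨i, j⟩, hij⟩
    have hne : Finset.Iic i ≠ ∅ := Finset.ne_empty_of_mem (Finset.mem_Iic.2 le_rfl)
    dsimp only
    rw [flagCoord_eq_configVec, h.configVec_sysConfig hne, IsSystem.init h]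
    exact dif_pos hij
  · have hc1 := α.2.1
    have hpos := α.card_pos
    have hne1 : α.1.1 ≠ ∅ := (Finset.card_pos.1 hpos).ne_empty
    have hne2 : α.1.2 ≠ ∅ := (Finset.card_pos.1 (hc1 ▸ hpos)).ne_empty
    dsimp only
    rw [edgeCoord_eq_configVec _ α ⟨_, α.card_lt⟩ rfl, h.configVec_sysConfig hne1,
      h.configVec_sysConfig hne2, IsSystem.edge h α, Pi.add_apply, Pi.smul_apply,
      IsSystem.one h (α.1.1 ∪ α.1.2) _ (by rw [α.card_union])]
    simp

end Tetra

namespace Tetra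

/-! ### Translates -/

theorem mem_translate {b : G} {W : Gras} {v : Fin 4 → ℂ} :
    v ∈ translate b W ↔ ∃ u ∈ W, (b : Matrix (Fin 4) (Fin 4) ℂ).mulVec u = v := by
  simp [translate, Submodule.mem_map, Matrix.toLin'_apply]

theorem mulVec_injective (b : G) :
    Function.Injective (b : Matrix (Fin 4) (Fin 4) ℂ).mulVec :=
  Matrix.mulVec_injective_of_isUnit b.isUnit

theorem finrank_translate (b : G) (W : Gras) :
    Module.finrank ℂ (translate b W) = Module.finrank ℂ W :=
  (Submodule.equivMapOfInjective (Matrix.toLin' (b : Matrix (Fin 4) (Fin 4) ℂ))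
    (mulVec_injective b) W).finrank_eq.symm

theorem translate_mono (b : G) {W W' : Gras} (h : W ≤ W') : translate b W ≤ translate b W' :=
  Submodule.map_mono h

theorem translate_le_iff (b : G) {W W' : Gras} : translate b W ≤ translate b W' ↔ W ≤ W' := by
  refine ⟨fun h v hv => ?_, translate_mono b⟩
  obtain ⟨u, hu, huv⟩ := mem_translate.1 (h (mem_translate.2 ⟨v, hv, rfl⟩))
  rwa [← mulVec_injective b huv]

theorem translate_mul (b b' : G) (W : Gras) : translate (b * b') W = translate b (translate b' W) := by
  ext v
  simp only [mem_translate, Matrix.GeneralLinearGroup.coe_mul]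
  constructor
  · rintro ⟨u, hu, rfl⟩
    exact ⟨_, ⟨u, hu, rfl⟩, by rw [Matrix.mulVec_mulVec]⟩
  · rintro ⟨_, ⟨u, hu, rfl⟩, rfl⟩
    exact ⟨u, hu, by rw [Matrix.mulVec_mulVec]⟩

namespace IsLowerTriangular

variable {b : G} (hb : IsLowerTriangular b)
include hb

theorem diag_ne_zero (i : Fin 4) : b i i ≠ 0 := by
  have h1 : (b : Matrix (Fin 4) (Fin 4) ℂ).det = ∏ i, b i i :=
    Matrix.det_of_isLowerTriangular _ fun i j hij => hb i j hij
  have h2 : (b : Matrix (Fin 4) (Fin 4) ℂ).det ≠ 0 := by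
    have := b.isUnit
    rw [Matrix.isUnit_iff_isUnit_det] at this
    exact this.ne_zero
  rw [h1, Finset.prod_ne_zero_iff] at h2
  exact h2 i (Finset.mem_univ i)

theorem mulVec_apply {k : ℕ} {u : Fin 4 → ℂ} (hu : ∀ i : Fin 4, i.val < k → u i = 0) {i : Fin 4}
    (hi : i.val ≤ k) : (b : Matrix (Fin 4) (Fin 4) ℂ).mulVec u i = b i i * u i := by
  rw [Matrix.mulVec, dotProduct]
  refine Finset.sum_eq_single i (fun j _ hj => ?_) (by simp)
  rcases lt_or_gt_of_ne hj with h | h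
  · rw [hu j (by have : j.val < i.val := h; omega), mul_zero]
  · rw [hb i j h, zero_mul]

theorem mulVec_eq_zero {k : ℕ} {u : Fin 4 → ℂ} (hu : ∀ i : Fin 4, i.val < k → u i = 0) {i : Fin 4}
    (hi : i.val < k) : (b : Matrix (Fin 4) (Fin 4) ℂ).mulVec u i = 0 := by
  rw [hb.mulVec_apply hu hi.le, hu i hi, mul_zero]

theorem isGeneric_translate {W : Gras} {k : ℕ} (h : IsGeneric W k) :
    IsGeneric (translate b W) k := by
  intro v hv h0
  obtain ⟨u, hu, rfl⟩ := mem_translate.1 hv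
  -- The matrix is triangular with nonzero diagonal, so the coordinates of `u` vanish one after
  -- another.
  have : ∀ n : ℕ, n ≤ k → ∀ i : Fin 4, i.val < n → u i = 0 := by
    intro n
    induction n with
    | zero => exact fun _ i hi => absurd hi (by omega)
    | succ n ih =>
      intro hn i hi
      have h1 := hb.mulVec_apply (ih (by omega)) (i := i) (by omega)
      rw [h0 i (by omega)] at h1
      exact (mul_eq_zero.1 h1.symm).resolve_left (hb.diag_ne_zero i)
  rw [h u hu (this k le_rfl), Matrix.mulVec_zero]

/-- A lower triangular matrix preserves the leading zeros and multiplies the leading entry by a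
diagonal entry; dividing by the latter restores the normalization, and `eq_stdVec` gives uniqueness.
-/
theorem stdVec_translate {W : Gras} {m : ℕ} (hW : Module.finrank ℂ W = m + 1)
    (h : IsGeneric W (m + 1)) {l : Fin 4} (hl : l.val = m) :
    stdVec (translate b W) m =
      (b l l)⁻¹ • (b : Matrix (Fin 4) (Fin 4) ℂ).mulVec (stdVec W m) := by
  symm
  refine eq_stdVec (by rw [finrank_translate, hW]) (hb.isGeneric_translate h) ?_
    (fun i hi => ?_) fun i hi => ?_
  · exact Submodule.smul_mem _ _ (mem_translate.2 ⟨_, stdVec_mem hW, rfl⟩)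
  · rw [Pi.smul_apply, hb.mulVec_eq_zero (fun i hi => stdVec_eq_zero hW hi) hi, smul_zero]
  · obtain rfl : i = l := Fin.ext (by omega)
    rw [Pi.smul_apply, hb.mulVec_apply (fun i hi => stdVec_eq_zero hW hi) hi.le,
      stdVec_eq_one hW h hi, smul_eq_mul, mul_one, inv_mul_cancel₀ (hb.diag_ne_zero i)]

theorem isGenericConfig_translate {p : Config} (h : IsGenericConfig p) :
    IsGenericConfig fun I => translate b (p I) :=
  ⟨fun I => by rw [finrank_translate, h.finrank], fun I J hIJ => translate_mono b (h.mono I J hIJ),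
    fun I => hb.isGeneric_translate (h.generic I)⟩

theorem configVec_translate {p : Config} (h : IsGenericConfig p) {I : Finset (Fin 4)} {l : Fin 4}
    (hl : l.val + 1 = I.card) : configVec (fun I => translate b (p I)) I =
      (b l l)⁻¹ • (b : Matrix (Fin 4) (Fin 4) ℂ).mulVec (configVec p I) :=
  hb.stdVec_translate (by rw [h.finrank]; omega) (by
    have := h.generic I
    rwa [show I.card = I.card - 1 + 1 by omega] at this) (by omega)

end IsLowerTriangular

/-- The character by which the triangular matrix `b` acts on the edge coordinate `x_α`. -/
noncomputable def edgeChar (b : G) (α : Edge) : ℂ :=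
  ∏ k : Fin 3, if α.1.1.card = k.val + 1 then b k.succ k.succ / b k.castSucc k.castSucc else 1

theorem edgeChar_eq (b : G) {α : Edge} {k : Fin 3} (hk : α.1.1.card = k.val + 1) :
    edgeChar b α = b k.succ k.succ / b k.castSucc k.castSucc := by
  rw [edgeChar, Finset.prod_eq_single k]
  · rw [if_pos hk]
  · intro l _ hl
    rw [if_neg]
    intro h
    exact hl (Fin.ext (by omega))
  · simp

theorem Edge.exists_rank (α : Edge) : ∃ k : Fin 3, α.1.1.card = k.val + 1 :=
  ⟨⟨α.1.1.card - 1, by have := α.card_lt; have := α.card_pos; omega⟩, by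
    have := α.card_pos; simp; omega⟩

/-- In `v_J - v_I = x_α v_{I ∪ J}` the vectors on the left are rescaled by the inverse of the
diagonal entry in position `k`, while the leading entry of `b v_{I ∪ J}` is the diagonal entry in
position `k + 1`. The quotient is the character. -/
theorem IsLowerTriangular.edgeCoord_translate {b : G} (hb : IsLowerTriangular b) {p : Config}
    (h : IsGenericConfig p) (α : Edge) :
    edgeCoord (fun I => translate b (p I)) α = edgeChar b α * edgeCoord p α := by
  obtain ⟨k, hk⟩ := α.exists_rank
  have hpos := α.card_pos
  have hc := α.2.1
  have hsub : configVec p α.1.2 - configVec p α.1.1 =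
      edgeCoord p α • configVec p (α.1.1 ∪ α.1.2) := by
    rw [h.isSystem.edge α]
    simp
  rw [edgeCoord_eq_configVec _ α k.succ (by simp [hk]),
    hb.configVec_translate h (I := α.1.2) (l := k.castSucc) (by simp [← hc, hk]),
    hb.configVec_translate h (I := α.1.1) (l := k.castSucc) (by simp [hk]), ← Pi.sub_apply,
    ← smul_sub, ← Matrix.mulVec_sub, hsub, Matrix.mulVec_smul, edgeChar_eq b hk]
  simp only [Pi.smul_apply, smul_eq_mul]
  have hu := α.card_union
  rw [hb.mulVec_apply (k := k.val + 1) (fun i hi => h.isSystem.zero _ i (by omega))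
    (i := k.succ) (by simp), h.isSystem.one _ k.succ (by simp [hu, hk])]
  have := hb.diag_ne_zero k.castSucc
  field_simp

/-! ### The group acts transitively on the flags in general position -/

theorem opVec_eq_zero (a : OpIdx → ℂ) {k i : Fin 4} (h : i < k) : opVec a k i = 0 := by
  rw [opVec, dif_neg h.not_gt, if_neg h.ne']

theorem opVec_eq_one (a : OpIdx → ℂ) (k : Fin 4) : opVec a k k = 1 := by
  rw [opVec, dif_neg (lt_irrefl k), if_pos rfl]

theorem exists_isLowerTriangular (a a' : OpIdx → ℂ) (d : Fin 4 → ℂ) (hd : ∀ i, d i ≠ 0) :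
    ∃ b : G, IsLowerTriangular b ∧ (∀ i, b i i = d i) ∧
      ∀ k, (b : Matrix (Fin 4) (Fin 4) ℂ).mulVec (opVec a k) = d k • opVec a' k := by
  let u : (OpIdx → ℂ) → Matrix (Fin 4) (Fin 4) ℂ := fun a => Matrix.of fun i k => opVec a k i
  have hlow : ∀ a, (u a).BlockTriangular OrderDual.toDual := fun a i j hij => opVec_eq_zero a hij
  have hdet : ∀ a, (u a).det = 1 := fun a => by
    rw [Matrix.det_of_isLowerTriangular _ (hlow a)]
    exact Finset.prod_eq_one fun i _ => opVec_eq_one a i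
  -- Move the first flag to the standard one, scale by the torus, and move on to the second flag.
  let M := u a' * Matrix.diagonal d * (u a)⁻¹
  have hMdet : M.det ≠ 0 := by
    simp only [M, Matrix.det_mul, hdet, Matrix.det_nonsing_inv, Ring.inverse_one, one_mul, mul_one,
      Matrix.det_diagonal]
    exact Finset.prod_ne_zero_iff.2 fun i _ => hd i
  have hMlow : M.BlockTriangular OrderDual.toDual := by
    have : Invertible (u a) := Matrix.invertibleOfIsUnitDet _ (by rw [hdet]; exact isUnit_one)
    refine ((hlow a').mul (Matrix.blockTriangular_diagonal d)).mul ?_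
    exact Matrix.blockTriangular_inv_of_blockTriangular (hlow a)
  let b : G := Matrix.GeneralLinearGroup.mkOfDetNeZero M hMdet
  have hb : IsLowerTriangular b := fun i j hij => hMlow hij
  have hbv : ∀ k, (b : Matrix (Fin 4) (Fin 4) ℂ).mulVec (opVec a k) = d k • opVec a' k := by
    intro k
    have h1 : opVec a k = (u a).mulVec (Pi.single k 1) := by
      ext i; simp [u]
    have h2 : (Matrix.diagonal d).mulVec (Pi.single k 1) = d k • Pi.single k (1 : ℂ) := by
      ext i; by_cases h : i = k
      · subst h; simp [Matrix.mulVec_diagonal]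
      · simp [Matrix.mulVec_diagonal, h]
    change M.mulVec _ = _
    rw [h1, Matrix.mulVec_mulVec, Matrix.mul_assoc, Matrix.nonsing_inv_mul _ (by
      rw [hdet]; exact isUnit_one), Matrix.mul_one, ← Matrix.mulVec_mulVec, h2, Matrix.mulVec_smul]
    congr 1
    ext i; simp [u]
  refine ⟨b, hb, fun i => ?_, hbv⟩
  have := congrFun (hbv i) i
  rw [hb.mulVec_apply (k := i.val) (fun j hj => opVec_eq_zero a hj) le_rfl, Pi.smul_apply,
    opVec_eq_one, opVec_eq_one] at this
  simpa using this

theorem exists_translate {p : Config} (h : IsGenericConfig p) (a' : OpIdx → ℂ) (t : Fin 3 → ℂ)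
    (ht : ∀ k, t k ≠ 0) : ∃ b : G, IsLowerTriangular b ∧
      flagCoord (fun I => translate b (p I)) = a' ∧
      ∀ (k : Fin 3) (α : Edge), α.1.1.card = k.val + 1 →
        edgeCoord (fun I => translate b (p I)) α = t k * edgeCoord p α := by
  -- The diagonal entries are chosen so that their successive quotients are `t 0`, `t 1`, `t 2`: the
  -- three characters are independent.
  obtain ⟨b, hb, hd, hbv⟩ := exists_isLowerTriangular (flagCoord p) a'
    ![1, t 0, t 0 * t 1, t 0 * t 1 * t 2] (by
      intro i
      fin_cases i <;> simp [ht])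
  refine ⟨b, hb, ?_, fun k α hk => ?_⟩
  · funext ⟨⟨i, j⟩, hij⟩
    rw [flagCoord_eq_configVec, hb.configVec_translate h (l := i) (by simp), h.isSystem.init, hbv,
      smul_smul, hd, inv_mul_cancel₀ (by rw [← hd]; exact hb.diag_ne_zero i), one_smul]
    exact dif_pos hij
  · rw [hb.edgeCoord_translate h, edgeChar_eq b hk, hd, hd]
    congr 1
    have h0 := ht 0
    have h1 := ht 1
    have h2 := ht 2
    fin_cases k
    · simp
    · simp; field_simp
    · simp; field_simp

/-! ### Nondegenerate tetrahedra in the chart -/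

/-- The nondegenerate tetrahedra in general position to the flag at infinity. -/
def chartNondeg : Set Config := {p | p ∈ nondegTetrahedra ∧ p ∈ chartU}

theorem nondegTetrahedra_subset : nondegTetrahedra ⊆ tetrahedra := by
  rintro p hp
  refine ⟨?_, @subset_closure _ (zariski Config) _ _ hp⟩
  obtain ⟨b, hb⟩ := hp
  intro I
  rw [hb, finrank_translate, finrank_coordSubspace]

theorem coordSubspace_le_iff {I J : Finset (Fin 4)} : coordSubspace I ≤ coordSubspace J ↔ I ⊆ J := by
  constructor
  · intro h i hi
    by_contra hij
    have h1 : (Pi.single i 1 : Fin 4 → ℂ) ∈ coordSubspace I := Submodule.subset_span ⟨i, hi, rfl⟩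
    simpa using mem_coordSubspace.1 (h h1) i hij
  · intro h v hv
    rw [mem_coordSubspace] at hv ⊢
    exact fun i hi => hv i fun h' => hi (h h')

theorem le_iff_of_mem_nondegTetrahedra {p : Config} (hp : p ∈ nondegTetrahedra)
    {I J : Finset (Fin 4)} : p I ≤ p J ↔ I ⊆ J := by
  obtain ⟨b, hb⟩ := hp
  rw [hb, hb, translate_le_iff, coordSubspace_le_iff]

theorem isGenericConfig_of_mem_chartNondeg {p : Config} (hp : p ∈ chartNondeg) :
    IsGenericConfig p := by
  have := mem_chartU_iff.1 hp.2
  exact ⟨this.1.1, fun I J h => (le_iff_of_mem_nondegTetrahedra hp.1).2 h, this.2⟩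

theorem mem_chartNondeg {p : Config} (hp : p ∈ nondegTetrahedra)
    (h : ∀ I, IsGeneric (p I) I.card) : p ∈ chartNondeg :=
  ⟨hp, mem_chartU_iff.2 ⟨nondegTetrahedra_subset hp, h⟩⟩

theorem translate_mem_chartNondeg {b : G} (hb : IsLowerTriangular b) {p : Config}
    (hp : p ∈ chartNondeg) : (fun I => translate b (p I)) ∈ chartNondeg := by
  refine mem_chartNondeg ?_ fun I =>
    hb.isGeneric_translate ((isGenericConfig_of_mem_chartNondeg hp).generic I)
  obtain ⟨b', hb'⟩ := hp.1
  exact ⟨b * b', fun I => by rw [translate_mul, ← hb']⟩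

/-- If `x_α = 0`, the vectors at `I` and `J` agree. Then `p_I`, spanned by `p_{I ∩ J}` and that
vector, is contained in `p_J`, which is impossible for a nondegenerate tetrahedron. -/
theorem edgeCoord_ne_zero {p : Config} (hp : p ∈ chartNondeg) (α : Edge) : edgeCoord p α ≠ 0 := by
  intro h0
  have h := isGenericConfig_of_mem_chartNondeg hp
  obtain ⟨h1, h2, i, hi, j, hj, hij⟩ := α.2
  have hv := h.isSystem.edge α
  rw [show (flagCoord p, edgeCoord p).2 α = 0 from h0, zero_smul, add_zero] at hv
  rw [Finset.mem_sdiff] at hi hj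
  have hle : p α.1.1 ≤ p α.1.2 := by
    rw [h.eq_sysSpace, h.eq_sysSpace α.1.2]
    refine (h.isSystem.sysSpace_le_sup _ _ rfl i hi.1).trans (sup_le (sysSpace_mono _ ?_) ?_)
    · have : α.1.1 ∩ α.1.2 = α.1.1.erase i := by
        refine Finset.eq_of_subset_of_card_le (fun l hl => ?_) ?_
        · rw [Finset.mem_inter] at hl
          exact Finset.mem_erase.2 ⟨fun hli => hi.2 (hli ▸ hl.2), hl.1⟩
        · rw [Finset.card_erase_of_mem hi.1]
          omega
      rw [← this]
      exact Finset.inter_subset_right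
    · rw [Submodule.span_singleton_le_iff_mem, ← hv]
      exact mem_sysSpace (Finset.ne_empty_of_mem hj.1) subset_rfl
  exact hi.2 ((le_iff_of_mem_nondegTetrahedra hp.1).1 hle hi.1)

/-! ### Faces -/

/-- A vertex `I` of the face has an element `i` outside `lower`, and `upper` has an element `j`
outside `I`; exchanging them gives a neighbouring vertex. -/
instance Face.nonempty_edges (β : Face) : Nonempty β.Edges := by
  obtain ⟨I, hAI, hIB, hIc⟩ := Finset.exists_subsuperset_card_eq β.lower_subset β.lower_lt.le
    β.lt_upper.le
  obtain ⟨i, hi, hiA⟩ := Finset.exists_mem_notMem_of_card_lt_card (hIc ▸ β.lower_lt)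
  obtain ⟨j, hj, hjI⟩ := Finset.exists_mem_notMem_of_card_lt_card (hIc ▸ β.lt_upper)
  have hij : i ≠ j := fun h => hjI (h ▸ hi)
  let J := insert j (I.erase i)
  have hJc : J.card = β.rank := by
    rw [Finset.card_insert_of_notMem (by simp [hjI]), Finset.card_erase_of_mem hi, hIc]
    have := β.lower_lt
    omega
  have hIJ : I ∩ J = I.erase i := by
    ext l
    simp only [J, Finset.mem_inter, Finset.mem_insert, Finset.mem_erase]
    constructor
    · rintro ⟨h1, rfl | h2⟩
      · exact absurd h1 hjI
      · exact h2
    · exact fun h => ⟨h.2, Or.inr h⟩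
  have hJI : J ∩ I = I.erase i := by rw [Finset.inter_comm, hIJ]
  have hcard : (I.erase i).card + 1 = β.rank := by
    rw [Finset.card_erase_of_mem hi, hIc]
    have := β.lower_lt
    omega
  have hI : β.IsVertex I := ⟨hAI, hIB, hIc⟩
  have hJ : β.IsVertex J := by
    refine ⟨fun l hl => ?_, fun l hl => ?_, hJc⟩
    · exact Finset.mem_insert_of_mem (Finset.mem_erase.2 ⟨fun h => hiA (h ▸ hl), hAI hl⟩)
    · rcases Finset.mem_insert.1 hl with rfl | h
      · exact hj
      · exact hIB (Finset.mem_of_mem_erase h)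
  have hiIJ : i ∈ I \ J := by simp [J, hi, hij]
  have hjJI : j ∈ J \ I := by simp [J, hjI]
  rcases lt_or_gt_of_ne hij with h | h
  · exact ⟨⟨(I, J), by rw [hIc, hJc], by rw [hIJ, hIc, hcard], i, hiIJ, j, hjJI, h⟩, hI, hJ⟩
  · exact ⟨⟨(J, I), by rw [hIc, hJc], by rw [hJI, hJc, hcard], j, hjJI, i, hiIJ, h⟩, hJ, hI⟩

end Tetra

namespace Tetra

/-! ### The inverse of the chart -/

/-- The Plücker coordinates of the span of the vectors of a chain up to `S` and of the vector
at `K`. -/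
noncomputable def edgePlucker (w : AffineOE) (S K : Finset (Fin 4)) : Finset (Fin 4) → ℂ :=
  plucker (Fin.snoc (α := fun _ => Fin 4 → ℂ) (fun r => sysVec w (chain S r)) (sysVec w K))

theorem Edge.card_inter_succ (α : Edge) : (α.1.1 ∩ α.1.2).card + 1 = α.1.1.card := α.2.2.1

theorem exists_isPolyFun_edgePlucker (S K A : Finset (Fin 4)) :
    ∃ F : (AffIdx → ℂ) → ℂ, IsPolyFun F ∧ ∀ w, edgePlucker w S K A = F (affCoord w) := by
  choose F hF hF' using exists_isPolyFun_sysVec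
  refine ⟨fun c => plucker (Fin.snoc (α := fun _ => Fin 4 → ℂ) (fun r i => F (chain S r) i c)
    (fun i => F K i c)) A, plucker_isPolyFun (fun i j => ?_) A, fun w => ?_⟩
  · refine Fin.lastCases ?_ (fun r => ?_) i
    · simpa using hF _ _
    · simpa using hF _ _
  · rw [edgePlucker]
    simp only [← hF']

theorem exists_isPolyFun_plucker_chain (I A : Finset (Fin 4)) :
    ∃ F : (AffIdx → ℂ) → ℂ, IsPolyFun F ∧
      ∀ w, plucker (fun r => sysVec w (chain I r)) A = F (affCoord w) := by
  choose F hF hF' using exists_isPolyFun_sysVec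
  refine ⟨fun c => plucker (fun r i => F (chain I r) i c) A, plucker_isPolyFun (fun i j => hF _ _) A,
    fun w => ?_⟩
  simp only [← hF']

/-- The frames of `π_I` and `π_J` share a chain up to `I ∩ J` and differ only in the last vector, in
which Plücker coordinates are linear. This is why the equations of the diagonal are divisible by
`x_α`. -/
theorem edgePlucker_add (w : AffineOE) (hw : IsCoherent w) (α : Edge) (A : Finset (Fin 4)) :
    edgePlucker w (α.1.1 ∩ α.1.2) α.1.2 A = edgePlucker w (α.1.1 ∩ α.1.2) α.1.1 A +
      w.2 α * edgePlucker w (α.1.1 ∩ α.1.2) (α.1.1 ∪ α.1.2) A := by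
  rw [edgePlucker, IsSystem.edge hw, plucker_snoc_add_smul]
  rfl

theorem edgePlucker_insert {w : AffineOE} (hw : IsCoherent w) {S K : Finset (Fin 4)}
    (hSK : S.card < K.card) (j : Fin 4) :
    edgePlucker w S K (insert j (initialSet S.card)) = sysVec w K j := by
  rw [edgePlucker, plucker_insert_of_triangular (card_le_four S)]
  · simp
  · intro r i
    refine Fin.lastCases (fun hi => ?_) (fun r hi => ?_) r
    · rw [Fin.snoc_last]
      exact IsSystem.zero hw _ _ (by simp at hi; omega)
    · rw [Fin.snoc_castSucc]
      exact IsSystem.zero hw _ _ (by rw [card_chain]; simp at hi; omega)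
  · intro r
    rw [Fin.snoc_castSucc]
    exact IsSystem.one hw _ _ (by rw [card_chain]; simp)

theorem edgePlucker_initialSet {w : AffineOE} (hw : IsCoherent w) {S K : Finset (Fin 4)}
    (hSK : S.card + 1 = K.card) : edgePlucker w S K (initialSet K.card) = 1 := by
  have hS : S.card < 4 := by have := card_le_four K; omega
  have h1 := initialSet_succ ⟨S.card, hS⟩
  have h2 := edgePlucker_insert hw (S := S) (K := K) (by omega) ⟨S.card, hS⟩
  rw [← h1] at h2
  rw [← hSK]
  exact h2.trans (IsSystem.one hw _ _ hSK)

theorem edgePlucker_mem_rep {w : AffineOE} (hw : IsCoherent w) {S K : Finset (Fin 4)} (hS : S ⊆ K)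
    (hSK : S.card + 1 = K.card) : edgePlucker w S K ∈ HomogCoords.rep (sysConfig w K) := by
  have hli : LinearIndependent ℂ
      (Fin.snoc (α := fun _ => Fin 4 → ℂ) (fun r => sysVec w (chain S r)) (sysVec w K) :
        Fin (S.card + 1) → Fin 4 → ℂ) :=
    linearIndependent_of_plucker_ne_zero (A := initialSet K.card) (by
      have := edgePlucker_initialSet hw hSK
      rw [edgePlucker] at this
      rw [this]
      exact one_ne_zero)
  refine ⟨_, _, hli, Submodule.eq_of_le_of_finrank_eq (Submodule.span_le.2 ?_) ?_, rfl⟩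
  · rintro _ ⟨r, rfl⟩
    have hK : K ≠ ∅ := by rintro rfl; simp at hSK
    refine Fin.lastCases ?_ (fun r => ?_) r
    · rw [Fin.snoc_last]
      exact mem_sysSpace hK subset_rfl
    · rw [Fin.snoc_castSucc]
      refine mem_sysSpace (fun h => ?_) ((chain_subset S r).trans hS)
      have := card_chain S r
      simp [h] at this
  · rw [finrank_span_eq_card hli, Fintype.card_fin, hSK]
    exact (IsSystem.finrank_sysSpace hw K).symm

/-- The factor by which the equation `j` of the diagonal differs from the edge coordinate. -/
noncomputable def genCoeff (w : AffineOE) (β : Face) (j : GenIdx β) : ℂ :=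
  (edgePlucker w (j.1.1.1.1 ∩ j.1.1.1.2) j.1.1.1.1 (j.2.1 j.1) *
      edgePlucker w (j.1.1.1.1 ∩ j.1.1.1.2) (j.1.1.1.1 ∪ j.1.1.1.2) (j.2.2 j.1) -
    edgePlucker w (j.1.1.1.1 ∩ j.1.1.1.2) j.1.1.1.1 (j.2.2 j.1) *
      edgePlucker w (j.1.1.1.1 ∩ j.1.1.1.2) (j.1.1.1.1 ∪ j.1.1.1.2) (j.2.1 j.1)) *
  ∏ α ∈ Finset.univ.erase j.1,
    edgePlucker w (α.1.1.1 ∩ α.1.1.2) α.1.1.1 (j.2.1 α) *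
      edgePlucker w (α.1.1.1 ∩ α.1.1.2) α.1.1.2 (j.2.2 α)

theorem exists_isPolyFun_genCoeff (β : Face) (j : GenIdx β) :
    ∃ F : (AffIdx → ℂ) → ℂ, IsPolyFun F ∧ ∀ w, genCoeff w β j = F (affCoord w) := by
  choose F hF hF' using exists_isPolyFun_edgePlucker
  simp only [genCoeff, hF']
  exact ⟨fun c => _, (((hF _ _ _).mul (hF _ _ _)).sub ((hF _ _ _).mul (hF _ _ _))).mul
    (IsPolyFun.prod _ fun α _ => (hF _ _ _).mul (hF _ _ _)), fun w => rfl⟩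

/-- After the substitution `p_J = p_I + x_α p_{I ∪ J}` the products of two coordinates of `p_I`
cancel in the `2 × 2` minor, and `x_α` factors out. -/
theorem diagGenerators_eq {w : AffineOE} (hw : IsCoherent w) (β : Face) (j : GenIdx β) :
    diagGenerators β (fun α => edgePlucker w (α.1.1.1 ∩ α.1.1.2) α.1.1.1)
      (fun α => edgePlucker w (α.1.1.1 ∩ α.1.1.2) α.1.1.2) j = w.2 j.1.1 * genCoeff w β j := by
  rw [diagGenerators, genCoeff]
  simp only [edgePlucker_add w hw j.1.1]
  ring

/-- The linear map that recovers the coordinates of a point of the blowup from its coordinates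
`y_α`. -/
noncomputable def genMap (w : AffineOE) (β : Face) : (β.Edges → ℂ) →ₗ[ℂ] (GenIdx β → ℂ) :=
  LinearMap.pi fun j => genCoeff w β j • LinearMap.proj j.1

theorem genMap_apply (w : AffineOE) (β : Face) (y : β.Edges → ℂ) (j : GenIdx β) :
    genMap w β y j = genCoeff w β j * y j.1 := rfl

/-- The index of the equation that reads `x_α` in the affine chart. -/
abbrev yIdx (β : Face) (α : β.Edges) : GenIdx β :=
  (α, (fun _ => initialSet β.rank), Function.update (fun _ => initialSet β.rank) α
      (secondSet β.rank))

theorem yProj_apply (β : Face) (c : GenIdx β → ℂ) (α : β.Edges) : yProj β c α = c (yIdx β α) := rfl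

/-- At the initial set `p_I` and `p_J` equal `1` while `p_{I ∪ J}` equals `0`, and at the second set
`p_{I ∪ J}` equals `1`. So the minor is `1 · 1` minus a product with the factor `0`, and all the
remaining factors are `1`. The coordinates `y_α` can therefore be read off directly. -/
theorem genCoeff_yIdx {w : AffineOE} (hw : IsCoherent w) (β : Face) (α : β.Edges) :
    genCoeff w β (yIdx β α) = 1 := by
  have hr : ∀ α : β.Edges, α.1.1.1.card = β.rank := fun α => α.2.1.2.2
  have hr2 : ∀ α : β.Edges, α.1.1.2.card = β.rank := fun α => α.2.2.2.2
  have hs : ∀ α : β.Edges, (α.1.1.1 ∩ α.1.1.2).card + 1 = β.rank := fun α => by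
    rw [α.1.card_inter_succ, hr]
  have h1 : ∀ α : β.Edges, edgePlucker w (α.1.1.1 ∩ α.1.1.2) α.1.1.1 (initialSet β.rank) = 1 :=
    fun α => by rw [← hr α]; exact edgePlucker_initialSet hw (α.1.card_inter_succ)
  have h2 : ∀ α : β.Edges, edgePlucker w (α.1.1.1 ∩ α.1.1.2) α.1.1.2 (initialSet β.rank) = 1 :=
    fun α => by rw [← hr2 α]; exact edgePlucker_initialSet hw (by rw [hs, hr2])
  have hu := α.1.card_union
  have hlt := α.1.card_lt
  have hsα := hs α
  have h3 : edgePlucker w (α.1.1.1 ∩ α.1.1.2) (α.1.1.1 ∪ α.1.1.2) (initialSet β.rank) = 0 := by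
    have e1 := initialSet_succ ⟨(α.1.1.1 ∩ α.1.1.2).card, by rw [hr] at hlt; omega⟩
    have e2 := edgePlucker_insert hw (S := α.1.1.1 ∩ α.1.1.2) (K := α.1.1.1 ∪ α.1.1.2)
      (by rw [hu, hr]; omega) ⟨(α.1.1.1 ∩ α.1.1.2).card, by rw [hr] at hlt; omega⟩
    rw [← e1] at e2
    simp only [hsα] at e2
    rw [e2]
    exact IsSystem.zero hw _ _ (by rw [hu, hr]; simp; omega)
  have h4 : edgePlucker w (α.1.1.1 ∩ α.1.1.2) (α.1.1.1 ∪ α.1.1.2) (secondSet β.rank) = 1 := by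
    have e1 := secondSet_succ ⟨(α.1.1.1 ∩ α.1.1.2).card, by rw [hr] at hlt; omega⟩
    have e2 := edgePlucker_insert hw (S := α.1.1.1 ∩ α.1.1.2) (K := α.1.1.1 ∪ α.1.1.2)
      (by rw [hu, hr]; omega) (Fin.succ ⟨(α.1.1.1 ∩ α.1.1.2).card, by rw [hr] at hlt; omega⟩)
    rw [← e1] at e2
    simp only [hsα] at e2
    rw [e2]
    exact IsSystem.one hw _ _ (by rw [hu, hr]; simp; omega)
  rw [genCoeff]
  simp only [Function.update_self]
  rw [h1, h3, h4, Finset.prod_eq_one]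
  · ring
  · intro γ hγ
    rw [h1, Function.update_of_ne (Finset.ne_of_mem_erase hγ), h2, mul_one]

theorem yProj_genMap {w : AffineOE} (hw : IsCoherent w) (β : Face) (y : β.Edges → ℂ) :
    yProj β (genMap w β y) = y := by
  ext α
  rw [yProj_apply, genMap_apply, genCoeff_yIdx hw, one_mul]

theorem genMap_injective {w : AffineOE} (hw : IsCoherent w) (β : Face) :
    Function.Injective (genMap w β) :=
  Function.LeftInverse.injective (yProj_genMap hw β)

/-- The point of the chart with given images in `𝔸_op × 𝔸_ℰ` and in the projective spaces. -/
noncomputable def psi (n : AffineOE × ProjProd) (h : IsCoherent n.1) : Ambient :=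
  (sysConfig n.1, fun β => (sectionU β (sysConfig n.1),
    Projectivization.map (genMap n.1 β) (genMap_injective h β) (n.2 β)))

theorem submodule_map {V W : Type} [AddCommGroup V] [Module ℂ V] [AddCommGroup W] [Module ℂ W]
    (f : V →ₗ[ℂ] W) (hf : Function.Injective f) (y : ℙ ℂ V) :
    (Projectivization.map f hf y).submodule = y.submodule.map f := by
  induction y using Projectivization.ind with
  | h v hv => rw [Projectivization.map_mk, Projectivization.submodule_mk,
      Projectivization.submodule_mk, Submodule.map_span, Set.image_singleton]

theorem psi_submodule (n : AffineOE × ProjProd) (h : IsCoherent n.1) (β : Face) :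
    (((psi n h).2 β).2).submodule = (n.2 β).submodule.map (genMap n.1 β) :=
  submodule_map _ (genMap_injective h β) _

theorem isProjImage_psi (n : AffineOE × ProjProd) (h : IsCoherent n.1) :
    IsProjImage (psi n h) n.2 := by
  intro β
  rw [psi_submodule, ← Submodule.map_comp]
  have : yProj β ∘ₗ genMap n.1 β = LinearMap.id := LinearMap.ext fun y => yProj_genMap h β y
  rw [this, Submodule.map_id]

theorem isChartImage_psi (n : AffineOE × ProjProd) (h : IsCoherent n.1) :
    IsChartImage (psi n h) n := ⟨h.coord_sysConfig.symm, isProjImage_psi n h⟩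

theorem IsProjImage.unique {e : Ambient} {z z' : ProjProd} (h : IsProjImage e z)
    (h' : IsProjImage e z') : z = z' :=
  funext fun β => Projectivization.submodule_injective ((h β).trans (h' β).symm)

theorem IsChartImage.unique {e : Ambient} {n n' : AffineOE × ProjProd} (h : IsChartImage e n)
    (h' : IsChartImage e n') : n = n' :=
  Prod.ext (h.1.trans h'.1.symm) (h.2.unique h'.2)

end Tetra

namespace Tetra

/-! ### The chart and its inverse in coordinates -/

/-- The index set of the coordinates of `𝔸_op × 𝔸_ℰ × ∏_β ℙ_β`. -/
abbrev TargetIdx : Type :=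
  ((Σ _ : OpIdx, Unit) ⊕ (Σ _ : Edge, Unit)) ⊕ (Σ β : Face, β.Edges)

/-- The index set of the coordinates of the space that contains `E_#`. -/
abbrev AmbientIdx : Type :=
  (Σ _ : Finset (Fin 4), Finset (Fin 4)) ⊕
    (Σ β : Face, (Σ _ : β.Edges, Finset (Fin 4) ⊕ Finset (Fin 4)) ⊕ GenIdx β)

/-- The point of `𝔸_op × 𝔸_ℰ` with given coordinates. -/
def affOf (c : TargetIdx → ℂ) : AffineOE :=
  (fun ij => c (Sum.inl (Sum.inl ⟨ij, ()⟩)), fun α => c (Sum.inl (Sum.inr ⟨α, ()⟩)))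

theorem mem_rep_target {n : AffineOE × ProjProd} {c : TargetIdx → ℂ} :
    c ∈ HomogCoords.rep n ↔ affOf c = n.1 ∧
      ∀ β, (fun α => c (Sum.inr ⟨β, α⟩)) ∈ HomogCoords.rep (n.2 β) := by
  refine and_congr ?_ Iff.rfl
  constructor
  · rintro ⟨h1, h2⟩
    exact Prod.ext (funext fun ij => congrFun (h1 ij) ()) (funext fun α => congrFun (h2 α) ())
  · intro h
    rw [← h]
    exact ⟨fun ij => rfl, fun α => rfl⟩

theorem mem_rep_ambient {e : Ambient} {c : AmbientIdx → ℂ} :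
    c ∈ HomogCoords.rep e ↔ (∀ I, (fun A => c (Sum.inl ⟨I, A⟩)) ∈ HomogCoords.rep (e.1 I)) ∧
      ∀ β, (∀ α, (fun A => c (Sum.inr ⟨β, Sum.inl ⟨α, Sum.inl A⟩⟩)) ∈
          HomogCoords.rep ((e.2 β).1 α).1 ∧
        (fun A => c (Sum.inr ⟨β, Sum.inl ⟨α, Sum.inr A⟩⟩)) ∈
          HomogCoords.rep ((e.2 β).1 α).2) ∧
        (fun j => c (Sum.inr ⟨β, Sum.inr j⟩)) ∈ HomogCoords.rep (e.2 β).2 := Iff.rfl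

/-- The map `psi` on coordinate vectors. -/
noncomputable def psiLift (c : TargetIdx → ℂ) : AmbientIdx → ℂ
  | Sum.inl ⟨I, A⟩ => plucker (fun r => sysVec (affOf c) (chain I r)) A
  | Sum.inr ⟨_, Sum.inl ⟨α, Sum.inl A⟩⟩ =>
    plucker (fun r => sysVec (affOf c) (chain α.1.1.1 r)) A
  | Sum.inr ⟨_, Sum.inl ⟨α, Sum.inr A⟩⟩ =>
    plucker (fun r => sysVec (affOf c) (chain α.1.1.2 r)) A
  | Sum.inr ⟨β, Sum.inr j⟩ => genCoeff (affOf c) β j * c (Sum.inr ⟨β, j.1⟩)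

theorem isPolyFun_affCoord_affOf (i : AffIdx) :
    IsPolyFun fun c : TargetIdx → ℂ => affCoord (affOf c) i := by
  rcases i with i | i
  · exact IsPolyFun.coord _
  · exact IsPolyFun.coord _

theorem isPolyFun_psiLift (i : AmbientIdx) : IsPolyFun fun c => psiLift c i := by
  have key : ∀ {f : AffineOE → ℂ}, (∃ F : (AffIdx → ℂ) → ℂ, IsPolyFun F ∧
      ∀ w, f w = F (affCoord w)) → IsPolyFun fun c : TargetIdx → ℂ => f (affOf c) := by
    rintro f ⟨F, hF, hf⟩
    simp only [hf]
    exact hF.comp isPolyFun_affCoord_affOf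
  rcases i with ⟨I, A⟩ | ⟨β, ⟨α, A | A⟩ | j⟩
  · exact key (exists_isPolyFun_plucker_chain I A)
  · exact key (exists_isPolyFun_plucker_chain _ A)
  · exact key (exists_isPolyFun_plucker_chain _ A)
  · exact (key (exists_isPolyFun_genCoeff β j)).mul (IsPolyFun.coord _)

theorem psiLift_mem_rep {n : AffineOE × ProjProd} (h : IsCoherent n.1) {c : TargetIdx → ℂ}
    (hc : c ∈ HomogCoords.rep n) : psiLift c ∈ HomogCoords.rep (psi n h) := by
  obtain ⟨h1, h2⟩ := mem_rep_target.1 hc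
  have hpl : ∀ I, plucker (fun r => sysVec (affOf c) (chain I r)) ∈
      HomogCoords.rep (sysConfig n.1 I) := fun I => by
    rw [h1]
    exact IsSystem.plucker_mem_rep h I
  refine mem_rep_ambient.2 ⟨fun I => hpl I, fun β => ⟨fun α => ⟨hpl _, hpl _⟩, ?_⟩⟩
  obtain ⟨h0, hy⟩ := mem_rep_proj.1 (h2 β)
  have : (fun j => psiLift c (Sum.inr ⟨β, Sum.inr j⟩)) =
      genMap n.1 β fun α => c (Sum.inr ⟨β, α⟩) := by
    ext j
    rw [genMap_apply, ← h1]
    rfl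
  rw [this, mem_rep_proj, psi_submodule, hy, Submodule.map_span, Set.image_singleton]
  refine ⟨fun h' => h0 ?_, rfl⟩
  exact genMap_injective h β (by rw [h', map_zero])

/-- The chart on coordinate vectors. -/
noncomputable def phiLift (c : AmbientIdx → ℂ) : TargetIdx → ℂ
  | Sum.inl (Sum.inl ⟨ij, _⟩) =>
    c (Sum.inl ⟨Finset.Iic ij.1.1, insert ij.1.2 (Finset.Iio ij.1.1)⟩) *
      (c (Sum.inl ⟨Finset.Iic ij.1.1, Finset.Iic ij.1.1⟩))⁻¹
  | Sum.inl (Sum.inr ⟨α, _⟩) =>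
    c (Sum.inl ⟨α.1.2, secondSet α.1.1.card⟩) * (c (Sum.inl ⟨α.1.2, initialSet α.1.1.card⟩))⁻¹ -
      c (Sum.inl ⟨α.1.1, secondSet α.1.1.card⟩) * (c (Sum.inl ⟨α.1.1, initialSet α.1.1.card⟩))⁻¹
  | Sum.inr ⟨β, α⟩ => c (Sum.inr ⟨β, Sum.inr (yIdx β α)⟩)

/-- The product of the Plücker coordinates at the initial sets. -/
noncomputable def initialMinor : MvPolynomial AmbientIdx ℂ :=
  ∏ I : Finset (Fin 4), MvPolynomial.X (Sum.inl ⟨I, initialSet I.card⟩)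

/-- So the chart is the open part where `initialMinor` does not vanish, and this polynomial is the
only denominator needed. -/
theorem initialMinor_ne_zero {e : Ambient} {c : AmbientIdx → ℂ} (hc : c ∈ HomogCoords.rep e)
    (he : ∀ I, Module.finrank ℂ (e.1 I) = I.card) :
    MvPolynomial.eval c initialMinor ≠ 0 ↔ ∀ I, IsGeneric (e.1 I) I.card := by
  rw [initialMinor, map_prod, Finset.prod_ne_zero_iff]
  simp only [Finset.mem_univ, forall_const, MvPolynomial.eval_X]
  exact forall_congr' fun I => rep_initialSet_ne_zero_iff (he I) (hc.1 I)

theorem Iic_eq_initialSet (i : Fin 4) : Finset.Iic i = initialSet (Finset.Iic i).card := by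
  ext x
  simp only [Finset.mem_Iic, mem_initialSet, Fin.le_def, Fin.card_Iic]
  omega

theorem isRat_phiLift (i : TargetIdx) : IsRat initialMinor fun c => phiLift c i := by
  have hinv : ∀ I : Finset (Fin 4),
      IsRat initialMinor fun c => (c (Sum.inl ⟨I, initialSet I.card⟩))⁻¹ := fun I => by
    have : (MvPolynomial.X (Sum.inl ⟨I, initialSet I.card⟩) : MvPolynomial AmbientIdx ℂ) ∣
        initialMinor := Finset.dvd_prod_of_mem _ (Finset.mem_univ I)
    simpa using IsRat.inv_of_dvd this
  have hX : ∀ i : AmbientIdx, IsRat initialMinor fun c => c i :=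
    fun i => (IsPolyFun.coord i).isRat _
  rcases i with (⟨ij, _⟩ | ⟨α, _⟩) | ⟨β, α⟩
  · refine (hX _).mul ?_
    have := hinv (Finset.Iic ij.1.1)
    rwa [← Iic_eq_initialSet] at this
  · refine ((hX _).mul ?_).sub ((hX _).mul (hinv _))
    rw [α.2.1]
    exact hinv _
  · exact hX _

theorem affOf_phiLift {e : Ambient} {c : AmbientIdx → ℂ} (hc : c ∈ HomogCoords.rep e) :
    affOf (phiLift c) = (flagCoord e.1, edgeCoord e.1) := by
  refine Prod.ext (funext fun ij => ?_) (funext fun α => ?_)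
  · refine Eq.trans ?_ (pluckerRatio_eq (hc.1 _) (Finset.insert_ne_empty _ _)
      (Finset.ne_empty_of_mem (Finset.mem_Iic.2 le_rfl))).symm
    rw [div_eq_mul_inv]
    rfl
  · obtain ⟨k, hk⟩ := α.exists_rank
    have h1 : initialSet α.1.1.card ≠ ∅ := hk ▸ initialSet_succ_ne_empty _
    have h2 : secondSet α.1.1.card ≠ ∅ := by
      rw [hk, secondSet_succ]
      exact Finset.insert_ne_empty _ _
    change _ = pluckerRatio _ _ _ - pluckerRatio _ _ _
    rw [pluckerRatio_eq (hc.1 _) h2 h1, pluckerRatio_eq (hc.1 _) h2 h1, div_eq_mul_inv,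
      div_eq_mul_inv]
    rfl

theorem phiLift_mem_rep {e : Ambient} {z : ProjProd} {c : AmbientIdx → ℂ}
    (hc : c ∈ HomogCoords.rep e) (hz : IsProjImage e z) :
    phiLift c ∈ HomogCoords.rep ((flagCoord e.1, edgeCoord e.1), z) := by
  refine mem_rep_target.2 ⟨affOf_phiLift hc, fun β => ?_⟩
  obtain ⟨h0, hc'⟩ := mem_rep_proj.1 ((mem_rep_ambient.1 hc).2 β).2
  have h1 := hz β
  rw [hc', Submodule.map_span, Set.image_singleton] at h1
  rw [mem_rep_proj]
  -- The line of `z β` is by hypothesis the image of the line of the blowup, so the projection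
  -- cannot kill the coordinate vector.
  refine ⟨fun h2 => ?_, h1⟩
  have h3 : yProj β (fun j => c (Sum.inr ⟨β, Sum.inr j⟩)) = 0 := h2
  have h4 := (z β).finrank_submodule
  rw [h1, h3, Submodule.span_zero_singleton, finrank_bot] at h4
  exact zero_ne_one h4

/-! ### The nondegenerate points of the chart -/

/-- The image of the nondegenerate tetrahedra under the chart. -/
def chartImage : Set (AffineOE × ProjProd) :=
  {n | ∃ p ∈ chartNondeg, n.1 = (flagCoord p, edgeCoord p) ∧
    ∀ β, (n.2 β).submodule = Submodule.span ℂ {fun α : β.Edges => edgeCoord p α.1}}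

theorem isCoherent_of_mem_chartImage {n : AffineOE × ProjProd} (hn : n ∈ chartImage) :
    IsCoherent n.1 := by
  obtain ⟨p, hp, h1, -⟩ := hn
  rw [h1]
  exact (isGenericConfig_of_mem_chartNondeg hp).isSystem.isCoherent

theorem edgeCoord_face_ne_zero {p : Config} (hp : p ∈ chartNondeg) (β : Face) :
    (fun α : β.Edges => edgeCoord p α.1) ≠ 0 := fun h =>
  edgeCoord_ne_zero hp _ (congrFun h (Classical.arbitrary β.Edges))

theorem rep_proportional {W : Gras} {c c' : Finset (Fin 4) → ℂ} (hc : c ∈ HomogCoords.rep W)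
    (hc' : c' ∈ HomogCoords.rep W) : ∃ a : ℂ, ∀ A, c' A = a * c A := by
  obtain ⟨h0, a, ha, h⟩ := rep_scaling hc hc'
  obtain ⟨k, v, hv, hW, rfl⟩ := hc
  rcases Nat.eq_zero_or_pos k with rfl | hk
  · refine ⟨1, fun A => ?_⟩
    by_cases hA : A = ∅
    · rw [hA, h0, one_mul]
    · rw [h A hA, plucker_of_card_ne (by simpa using hA), mul_zero, mul_zero]
  · refine ⟨a, fun A => ?_⟩
    by_cases hA : A = ∅
    · rw [hA, h0, plucker_of_card_ne (by simp; omega), mul_zero]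
    · exact h A hA

theorem diagGenerators_smul (β : Face) (m n : β.Edges → Finset (Fin 4) → ℂ) (a b : β.Edges → ℂ)
    (j : GenIdx β) : diagGenerators β (fun α A => a α * m α A) (fun α A => b α * n α A) j =
      (∏ α, a α * b α) * diagGenerators β m n j := by
  have h1 : ∏ α ∈ Finset.univ.erase j.1, a α * m α (j.2.1 α) * (b α * n α (j.2.2 α)) =
      (∏ α ∈ Finset.univ.erase j.1, a α * b α) *
        ∏ α ∈ Finset.univ.erase j.1, m α (j.2.1 α) * n α (j.2.2 α) := by
    rw [← Finset.prod_mul_distrib]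
    exact Finset.prod_congr rfl fun α _ => by ring
  rw [diagGenerators, diagGenerators, h1, ← Finset.mul_prod_erase _ _ (Finset.mem_univ j.1)]
  ring

theorem span_singleton_eq_of_minors {J : Type} {c g : J → ℂ} (hc : c ≠ 0) (hg : g ≠ 0)
    (h : ∀ j j', c j * g j' = c j' * g j) : Submodule.span ℂ {c} = Submodule.span ℂ {g} := by
  obtain ⟨j, hj⟩ := Function.ne_iff.1 hg
  rw [Pi.zero_apply] at hj
  have hcg : c = (c j / g j) • g := by
    ext j'
    rw [Pi.smul_apply, smul_eq_mul, div_mul_eq_mul_div, eq_div_iff hj]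
    exact h j' j
  have ha : c j / g j ≠ 0 := by
    intro h0
    rw [h0, zero_smul] at hcg
    exact hc hcg
  rw [hcg, Submodule.span_singleton_smul_eq (IsUnit.mk0 _ ha)]

/-- Over the complement of the diagonal the projective coordinates are proportional to the
generators. This proportionality is bilinear, so it persists in the closure, and it determines the
point wherever the generators do not all vanish. -/
theorem blowup_eq {β : Face} {p : Config} {y : ℙ ℂ (GenIdx β → ℂ)} {m n : β.Edges → Finset (Fin 4) → ℂ}
    (h : ((p, sectionU β p), y) ∈ blowupE β)
    (hm : ∀ α, m α ∈ HomogCoords.rep (p α.1.1.1)) (hn : ∀ α, n α ∈ HomogCoords.rep (p α.1.1.2))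
    (hne : diagGenerators β m n ≠ 0) : y.submodule = Submodule.span ℂ {diagGenerators β m n} := by
  obtain ⟨c, hc⟩ := HomogTorsor.nonempty y
  obtain ⟨cp, hcp⟩ := HomogTorsor.nonempty p
  have hcl := h.2
  let gl : ((Σ _ : Finset (Fin 4), Finset (Fin 4)) ⊕ (Σ _ : β.Edges, Finset (Fin 4) ⊕ Finset (Fin 4)))
      ⊕ GenIdx β → ℂ := Sum.elim (Sum.elim cp fun αA => Sum.elim (m αA.1) (n αA.1) αA.2) c
  have hgl : gl ∈ HomogCoords.rep ((p, sectionU β p), y) :=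
    ⟨⟨hcp, fun α => ⟨hm α, hn α⟩⟩, hc⟩
  -- Two factors of proportionality have to be absorbed: the choice of Plücker vectors, which
  -- rescales all generators by a common product, and the scaling of the projective vector.
  have hprop : ∀ j j', c j * diagGenerators β m n j' = c j' * diagGenerators β m n j := by
    intro j j'
    let gen : GenIdx β → (((Σ _ : Finset (Fin 4), Finset (Fin 4)) ⊕
        (Σ _ : β.Edges, Finset (Fin 4) ⊕ Finset (Fin 4))) ⊕ GenIdx β → ℂ) → ℂ := fun j d =>
      diagGenerators β (fun α A => d (Sum.inl (Sum.inr ⟨α, Sum.inl A⟩)))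
        (fun α A => d (Sum.inl (Sum.inr ⟨α, Sum.inr A⟩))) j
    have hgen : ∀ j, IsPolyFun (gen j) := fun j =>
      (((IsPolyFun.coord _).mul (IsPolyFun.coord _)).sub
        ((IsPolyFun.coord _).mul (IsPolyFun.coord _))).mul
        (IsPolyFun.prod _ fun α _ => (IsPolyFun.coord _).mul (IsPolyFun.coord _))
    obtain ⟨P, hP⟩ : IsPolyFun fun d => d (Sum.inr j) * gen j' d - d (Sum.inr j') * gen j d :=
      ((IsPolyFun.coord (Sum.inr j)).mul (hgen j')).sub
        ((IsPolyFun.coord (Sum.inr j')).mul (hgen j))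
    have := eval_eq_zero_of_mem_closure hcl (f := P) (fun e he d hd => ?_) gl hgl
    · rw [hP] at this
      exact sub_eq_zero.1 this
    · obtain ⟨-, -, m', n', hmn, he2⟩ := he
      rw [hP]
      beta_reduce
      have hd2 := hd.2.2
      rw [he2, Submodule.mem_span_singleton] at hd2
      obtain ⟨a, ha⟩ := hd2
      choose l hl using fun α => rep_proportional (hmn α).1 (hd.1.2 α).1
      choose l' hl' using fun α => rep_proportional (hmn α).2 (hd.1.2 α).2
      have hg : ∀ j, gen j d = (∏ α, l α * l' α) * diagGenerators β m' n' j := by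
        intro j
        rw [← diagGenerators_smul]
        simp only [gen]
        congr 1
        · exact funext fun α => funext fun A => hl α A
        · exact funext fun α => funext fun A => hl' α A
      have h1 : ∀ j, d (Sum.inr j) = a * diagGenerators β m' n' j := fun j => (congrFun ha j).symm
      rw [hg, hg, h1, h1]
      ring
  obtain ⟨h0, hy⟩ := mem_rep_proj.1 hc
  rw [hy]
  exact span_singleton_eq_of_minors h0 hne hprop

theorem diagGenerators_eq_smul {p : Config} (hp : p ∈ chartNondeg) (β : Face) :
    diagGenerators β
      (fun α => edgePlucker (flagCoord p, edgeCoord p) (α.1.1.1 ∩ α.1.1.2) α.1.1.1)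
      (fun α => edgePlucker (flagCoord p, edgeCoord p) (α.1.1.1 ∩ α.1.1.2) α.1.1.2) =
    genMap (flagCoord p, edgeCoord p) β fun α => edgeCoord p α.1 := by
  ext j
  rw [diagGenerators_eq (isGenericConfig_of_mem_chartNondeg hp).isSystem.isCoherent, genMap_apply,
    mul_comm]

theorem edgePlucker_mem_rep_config {p : Config} (hp : p ∈ chartNondeg) (α : Edge) :
    edgePlucker (flagCoord p, edgeCoord p) (α.1.1 ∩ α.1.2) α.1.1 ∈ HomogCoords.rep (p α.1.1) ∧
    edgePlucker (flagCoord p, edgeCoord p) (α.1.1 ∩ α.1.2) α.1.2 ∈ HomogCoords.rep (p α.1.2) := by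
  have h := isGenericConfig_of_mem_chartNondeg hp
  have hw := h.isSystem.isCoherent
  have h1 := edgePlucker_mem_rep hw (S := α.1.1 ∩ α.1.2) (K := α.1.1) Finset.inter_subset_left
    α.card_inter_succ
  have h2 := edgePlucker_mem_rep hw (S := α.1.1 ∩ α.1.2) (K := α.1.2) Finset.inter_subset_right
    (α.card_inter_succ.trans α.2.1)
  rw [← h.eq_sysConfig] at h1 h2
  exact ⟨h1, h2⟩

/-- The nondegenerate complete tetrahedra in the chart. -/
def chartNondegComplete : Set Ambient := {e | e ∈ nondegComplete ∧ e.1 ∈ chartU}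

/-- Since `x_α ≠ 0`, the section stays off the diagonal, where the point of the blowup is forced;
its coordinates are `genMap` applied to the edge coordinates. -/
theorem exists_psi_of_mem_chartNondegComplete {e : Ambient} (he : e ∈ chartNondegComplete) :
    ∃ n ∈ chartImage, ∃ h, e = psi n h := by
  obtain ⟨⟨hA, hnd, hs⟩, hU⟩ := he
  have hp : e.1 ∈ chartNondeg := ⟨hnd, hU⟩
  have hg := isGenericConfig_of_mem_chartNondeg hp
  let n : AffineOE × ProjProd := ((flagCoord e.1, edgeCoord e.1),
    fun β => Projectivization.mk ℂ _ (edgeCoord_face_ne_zero hp β))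
  refine ⟨n, ⟨e.1, hp, rfl, fun β => Projectivization.submodule_mk _ _⟩, hg.isSystem.isCoherent,
    Prod.ext hg.eq_sysConfig (funext fun β => Prod.ext ?_ ?_)⟩
  · rw [hs β]
    exact congrArg (sectionU β) hg.eq_sysConfig
  · apply Projectivization.submodule_injective
    have hb := hA.2 β
    rw [hs β] at hb
    have hne : genMap n.1 β (fun α => edgeCoord e.1 α.1) ≠ 0 := fun h0 =>
      edgeCoord_face_ne_zero hp β (genMap_injective hg.isSystem.isCoherent β (by rw [h0, map_zero]))
    have := blowup_eq hb (fun α => (edgePlucker_mem_rep_config hp α.1).1)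
      (fun α => (edgePlucker_mem_rep_config hp α.1).2) (by
        rw [diagGenerators_eq_smul hp]; exact hne)
    rw [psi_submodule, this, diagGenerators_eq_smul hp, Projectivization.submodule_mk,
      Submodule.map_span, Set.image_singleton]

theorem mem_bundleE {p : Config} (hp : p ∈ tetrahedra) (h : IsGenericConfig p) (β : Face) :
    (p, sectionU β p) ∈ bundleE β := by
  refine ⟨hp, fun α q hq => ?_⟩
  rcases hq with rfl | rfl
  · exact ⟨h.mono _ _ Finset.inter_subset_left, h.mono _ _ Finset.subset_union_left, h.finrank _⟩
  · exact ⟨h.mono _ _ Finset.inter_subset_right, h.mono _ _ Finset.subset_union_right,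
      (h.finrank _).trans α.1.2.1.symm⟩

/-- The points of the blowup over the complement of the diagonal. -/
def blowupGraph (β : Face) : Set ((Config × (β.Edges → Gras × Gras)) × ℙ ℂ (GenIdx β → ℂ)) :=
  {e | e.1 ∈ bundleE β ∧ e.1 ∉ diagD β ∧
      ∃ m n : β.Edges → Finset (Fin 4) → ℂ,
        (∀ α, m α ∈ HomogCoords.rep (e.1.2 α).1 ∧ n α ∈ HomogCoords.rep (e.1.2 α).2) ∧
        e.2.submodule = Submodule.span ℂ {diagGenerators β m n}}

theorem psi_mem_blowupGraph {n : AffineOE × ProjProd} (hn : n ∈ chartImage) (h : IsCoherent n.1)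
    (β : Face) : (((psi n h).1, ((psi n h).2 β).1), ((psi n h).2 β).2) ∈ blowupGraph β := by
  obtain ⟨p, hp, h1, h2⟩ := hn
  have hg := isGenericConfig_of_mem_chartNondeg hp
  have hpe : (psi n h).1 = p := by
    change sysConfig n.1 = p
    rw [h1, ← hg.eq_sysConfig]
  have hse : ((psi n h).2 β).1 = sectionU β p := by rw [← hpe]; rfl
  rw [blowupGraph, Set.mem_ofPred_eq]
  simp only [hpe, hse]
  refine ⟨mem_bundleE hp.2.1 hg β, fun hD => ?_, _, _,
    fun α => edgePlucker_mem_rep_config hp α.1, ?_⟩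
  · let α := Classical.arbitrary β.Edges
    have h3 : p α.1.1.1 = p α.1.1.2 := hD.2 α
    obtain ⟨-, -, i, hi, -⟩ := α.1.2
    rw [Finset.mem_sdiff] at hi
    exact hi.2 ((le_iff_of_mem_nondegTetrahedra hp.1).1 h3.le hi.1)
  · rw [psi_submodule, h2, Submodule.map_span, Set.image_singleton, diagGenerators_eq_smul hp, h1]

theorem psi_mem_chartNondegComplete {n : AffineOE × ProjProd} (hn : n ∈ chartImage)
    (h : IsCoherent n.1) : psi n h ∈ chartNondegComplete := by
  have hb := psi_mem_blowupGraph hn h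
  obtain ⟨p, hp, h1, h2⟩ := hn
  have hpe : (psi n h).1 = p := by
    change sysConfig n.1 = p
    rw [h1, ← (isGenericConfig_of_mem_chartNondeg hp).eq_sysConfig]
  refine ⟨⟨⟨by rw [hpe]; exact hp.2.1, fun β => ⟨(hb β).1, ?_⟩⟩, by rw [hpe]; exact hp.1,
    fun β => rfl⟩, by rw [hpe]; exact hp.2⟩
  exact @subset_closure _ (zariski _) _ _ (hb β)

/-! ### The chart as the image of a closed set -/

/-- Closures are transported through a map of coordinate vectors. It has to produce points of `T`
only over `S`; at the limit it is enough that the image vector represents `y`. -/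
theorem mem_closure_of_lift {X Y : Type} [HomogCoords X] [HomogCoords Y] [HomogTorsor X]
    {S : Set X} {T : Set Y} {x : X} (hx : x ∈ @closure X (zariski X) S)
    {D : MvPolynomial (HomogCoords.idx X) ℂ} {g : (HomogCoords.idx X → ℂ) → HomogCoords.idx Y → ℂ}
    (hg : ∀ j, IsRat D fun c => g c j)
    (hS : ∀ s ∈ S, ∀ d ∈ HomogCoords.rep s, MvPolynomial.eval d D ≠ 0 →
      ∃ t ∈ T, g d ∈ HomogCoords.rep t)
    {c : HomogCoords.idx X → ℂ} (hc : c ∈ HomogCoords.rep x) (hD : MvPolynomial.eval c D ≠ 0)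
    {y : Y} (hy : g c ∈ HomogCoords.rep y) : y ∈ @closure Y (zariski Y) T :=
  mem_closure_of_eval_eq_zero hy fun f hf =>
    (IsRat.comp hg f).eq_zero_of_mem_closure hx (fun s hs d hd hd0 => by
      obtain ⟨t, ht, hgt⟩ := hS s hs d hd hd0
      exact hf t ht _ hgt) hc hD

/-- The closure of the image of the nondegenerate tetrahedra. -/
def chartClosure : Set (AffineOE × ProjProd) :=
  @closure (AffineOE × ProjProd) (zariski (AffineOE × ProjProd)) chartImage

theorem isCoherent_of_mem_chartClosure {n : AffineOE × ProjProd} (hn : n ∈ chartClosure) :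
    IsCoherent n.1 := by
  obtain ⟨c, hc⟩ := HomogTorsor.nonempty n
  obtain ⟨T, hT, hT'⟩ := exists_isCoherent_iff
  rw [hT']
  intro F hF
  obtain ⟨P, hP⟩ : IsPolyFun fun c : TargetIdx → ℂ => F (affCoord (affOf c)) :=
    (hT F hF).comp isPolyFun_affCoord_affOf
  have := eval_eq_zero_of_mem_closure hn (f := P) (fun m hm d hd => by
    rw [hP]
    beta_reduce
    rw [(mem_rep_target.1 hd).1]
    exact (hT' m.1).1 (isCoherent_of_mem_chartImage hm) F hF) c hc
  rw [hP] at this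
  beta_reduce at this
  rwa [(mem_rep_target.1 hc).1] at this

/-- Three closures enter the definition of the chart: those defining `X`, the blowups and `Ũ`
itself. Each membership follows from the fact that `psiLift` is polynomial and takes nondegenerate
points to nondegenerate ones. -/
theorem psi_mem_chartUtilde {n : AffineOE × ProjProd} (hn : n ∈ chartClosure) (h : IsCoherent n.1) :
    psi n h ∈ chartUtilde := by
  obtain ⟨c, hc⟩ := HomogTorsor.nonempty n
  have hrep := psiLift_mem_rep h hc
  have hrat : ∀ j : AmbientIdx, IsRat 1 fun d => psiLift d j := fun j => (isPolyFun_psiLift j).isRat _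
  have h1 : MvPolynomial.eval c (1 : MvPolynomial TargetIdx ℂ) ≠ 0 := by simp
  have hmem : ∀ m ∈ chartImage, ∃ h', psi m h' ∈ chartNondegComplete := fun m hm =>
    ⟨isCoherent_of_mem_chartImage hm, psi_mem_chartNondegComplete hm _⟩
  have hg := h.isGenericConfig
  have htet : (psi n h).1 ∈ tetrahedra := by
    refine ⟨hg.finrank, ?_⟩
    refine mem_closure_of_lift (Y := Config) hn (D := 1) (g := fun d IA => psiLift d (Sum.inl IA))
      (fun j => hrat _) (fun m hm d hd _ => ?_) hc h1 hrep.1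
    obtain ⟨h', hm'⟩ := hmem m hm
    exact ⟨_, hm'.1.2.1, (psiLift_mem_rep h' hd).1⟩
  refine ⟨⟨⟨htet, fun β => ⟨mem_bundleE htet hg β, ?_⟩⟩, mem_chartU_iff.2 ⟨htet, hg.generic⟩⟩, ?_⟩
  · refine mem_closure_of_lift (Y := (Config × (β.Edges → Gras × Gras)) × ℙ ℂ (GenIdx β → ℂ))
      hn (D := 1) (T := blowupGraph β)
      (g := fun d (i : ((Σ _ : Finset (Fin 4), Finset (Fin 4)) ⊕
        (Σ _ : β.Edges, Finset (Fin 4) ⊕ Finset (Fin 4))) ⊕ GenIdx β) =>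
        psiLift d (Sum.elim (Sum.elim Sum.inl fun a => Sum.inr ⟨β, Sum.inl a⟩)
          (fun a => Sum.inr ⟨β, Sum.inr a⟩) i))
      (fun j => hrat _) (fun m hm d hd _ => ?_) hc h1 ⟨⟨hrep.1, (hrep.2 β).1⟩, (hrep.2 β).2⟩
    have h' := isCoherent_of_mem_chartImage hm
    have hd' := psiLift_mem_rep h' hd
    exact ⟨_, psi_mem_blowupGraph hm h' β, ⟨⟨hd'.1, (hd'.2 β).1⟩, (hd'.2 β).2⟩⟩
  · refine mem_closure_of_lift (Y := Ambient) hn (D := 1) (g := psiLift)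
      (fun j => hrat _) (fun m hm d hd _ => ?_) hc h1 hrep
    obtain ⟨h', hm'⟩ := hmem m hm
    exact ⟨_, hm', psiLift_mem_rep h' hd⟩

/-- At nondegenerate points the composite `psiLift ∘ phiLift` returns a coordinate vector of the
same point. This is expressed by equations with powers of `initialMinor` as denominators, so it
holds at every limit that lies over `U`. -/
theorem exists_psi_of_mem_closure {e : Ambient} (hU : e.1 ∈ chartU)
    (he : e ∈ @closure Ambient (zariski Ambient) chartNondegComplete) :
    ∃ n ∈ chartClosure, ∃ h, e = psi n h := by
  obtain ⟨c, hc⟩ := HomogTorsor.nonempty e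
  obtain ⟨htet, hgen⟩ := mem_chartU_iff.1 hU
  have hD := (initialMinor_ne_zero hc htet.1).2 hgen
  have hS : ∀ s ∈ chartNondegComplete, ∀ d ∈ HomogCoords.rep s,
      ∃ n ∈ chartImage, ∃ h, s = psi n h ∧ phiLift d ∈ HomogCoords.rep n ∧
        psiLift (phiLift d) ∈ HomogCoords.rep s := by
    intro s hs d hd
    obtain ⟨n, hn, h, rfl⟩ := exists_psi_of_mem_chartNondegComplete hs
    have h1 := phiLift_mem_rep hd (isProjImage_psi n h)
    rw [← (isChartImage_psi n h).1] at h1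
    exact ⟨n, hn, h, rfl, h1, psiLift_mem_rep h h1⟩
  have hrat : ∀ i : AmbientIdx, IsRat initialMinor fun d => psiLift (phiLift d) i := fun i =>
    IsRat.comp_isPolyFun (isPolyFun_psiLift i) isRat_phiLift
  have hcoh : IsCoherent (affOf (phiLift c)) := by
    obtain ⟨T, hT, hT'⟩ := exists_isCoherent_iff
    rw [hT']
    intro F hF
    have hr : IsRat initialMinor fun d => F (affCoord (affOf (phiLift d))) :=
      IsRat.comp_isPolyFun ((hT F hF).comp isPolyFun_affCoord_affOf) isRat_phiLift
    refine hr.eq_zero_of_mem_closure he (fun s hs d hd _ => ?_) hc hD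
    obtain ⟨n, -, h, -, hd', -⟩ := hS s hs d hd
    rw [(mem_rep_target.1 hd').1]
    exact (hT' _).1 h F hF
  have hX : ∀ i : AmbientIdx, IsRat initialMinor fun d => d i :=
    fun i => (IsPolyFun.coord i).isRat _
  -- The Plücker vectors agree only up to a factor, so the identity that passes to the limit is the
  -- vanishing of the `2 × 2` minors.
  have hprop : ∀ (q : Ambient → Gras) (ι : Finset (Fin 4) → AmbientIdx),
      (∀ s, ∀ d ∈ HomogCoords.rep s, (fun A => d (ι A)) ∈ HomogCoords.rep (q s)) →
      ∀ A B, c (ι A) * psiLift (phiLift c) (ι B) = c (ι B) * psiLift (phiLift c) (ι A) := by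
    intro q ι hq A B
    have hr := ((hX (ι A)).mul (hrat (ι B))).sub ((hX (ι B)).mul (hrat (ι A)))
    refine sub_eq_zero.1 (hr.eq_zero_of_mem_closure he (fun s hs d hd _ => ?_) hc hD)
    obtain ⟨n, -, h, -, -, hd'⟩ := hS s hs d hd
    obtain ⟨a, ha⟩ := rep_proportional (hq s d hd) (hq s _ hd')
    rw [ha, ha]
    ring
  -- Here the vectors agree without rescaling: `phiLift` copies the coordinates `y_α`, and on the
  -- image of `genMap` the composite `genMap ∘ yProj` is the identity.
  have hblow : ∀ β j, c (Sum.inr ⟨β, Sum.inr j⟩) = psiLift (phiLift c) (Sum.inr ⟨β, Sum.inr j⟩) := by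
    intro β j
    have hr := (hX (Sum.inr ⟨β, Sum.inr j⟩)).sub (hrat (Sum.inr ⟨β, Sum.inr j⟩))
    refine sub_eq_zero.1 (hr.eq_zero_of_mem_closure he (fun s hs d hd _ => ?_) hc hD)
    obtain ⟨n, -, h, rfl, hd', -⟩ := hS s hs d hd
    have h2 := ((mem_rep_ambient.1 hd).2 β).2.2
    rw [psi_submodule] at h2
    obtain ⟨y, -, hy⟩ := h2
    have h3 : yProj β (fun j => d (Sum.inr ⟨β, Sum.inr j⟩)) = y := by
      rw [← hy, yProj_genMap h]
    have h4 : psiLift (phiLift d) (Sum.inr ⟨β, Sum.inr j⟩) =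
        genMap (affOf (phiLift d)) β (yProj β fun j => d (Sum.inr ⟨β, Sum.inr j⟩)) j := rfl
    rw [h4, h3, (mem_rep_target.1 hd').1, hy, sub_self]
  -- The projection to `ℙ_β` is defined at the limit: if all the `y_α` vanished, the preceding
  -- identity would make the whole vector zero.
  have hy0 : ∀ β, yProj β (fun j => c (Sum.inr ⟨β, Sum.inr j⟩)) ≠ 0 := by
    intro β h0
    refine ((mem_rep_ambient.1 hc).2 β).2.1 (funext fun j => ?_)
    rw [hblow]
    change genMap (affOf (phiLift c)) β (yProj β fun j => c (Sum.inr ⟨β, Sum.inr j⟩)) j = 0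
    rw [h0, map_zero]
    rfl
  have hsub : ∀ β, (e.2 β).2.submodule = Submodule.span ℂ {fun j => c (Sum.inr ⟨β, Sum.inr j⟩)} :=
    fun β => (mem_rep_proj.1 ((mem_rep_ambient.1 hc).2 β).2).2
  let z : ProjProd := fun β => Projectivization.mk ℂ _ (hy0 β)
  have hz : IsProjImage e z := fun β => by
    rw [hsub, Submodule.map_span, Set.image_singleton]
    exact Projectivization.submodule_mk _ _
  have hn := phiLift_mem_rep hc hz
  rw [affOf_phiLift hc] at hcoh
  refine ⟨((flagCoord e.1, edgeCoord e.1), z), ?_, hcoh, ?_⟩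
  · refine mem_closure_of_lift he isRat_phiLift (fun s hs d hd _ => ?_) hc hD hn
    obtain ⟨n, hn, h, -, hd', -⟩ := hS s hs d hd
    exact ⟨n, hn, hd'⟩
  · have hp := psiLift_mem_rep (n := ((flagCoord e.1, edgeCoord e.1), z)) hcoh hn
    refine Prod.ext (funext fun I => ?_) (funext fun β => Prod.ext (funext fun α => Prod.ext ?_ ?_) ?_)
    · exact eq_of_rep_proportional (hc.1 I) (hp.1 I)
        (hprop (fun s => s.1 I) (fun A => Sum.inl ⟨I, A⟩) fun s d hd => hd.1 I)
    · exact eq_of_rep_proportional ((hc.2 β).1 α).1 ((hp.2 β).1 α).1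
        (hprop (fun s => ((s.2 β).1 α).1) (fun A => Sum.inr ⟨β, Sum.inl ⟨α, Sum.inl A⟩⟩)
          fun s d hd => ((hd.2 β).1 α).1)
    · exact eq_of_rep_proportional ((hc.2 β).1 α).2 ((hp.2 β).1 α).2
        (hprop (fun s => ((s.2 β).1 α).2) (fun A => Sum.inr ⟨β, Sum.inl ⟨α, Sum.inr A⟩⟩)
          fun s d hd => ((hd.2 β).1 α).2)
    · apply Projectivization.submodule_injective
      rw [hsub, psi_submodule, Projectivization.submodule_mk, Submodule.map_span, Set.image_singleton]
      congr 2
      ext j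
      rw [hblow, ← affOf_phiLift hc]
      rfl

theorem mem_chartUtilde_iff {e : Ambient} :
    e ∈ chartUtilde ↔ ∃ n ∈ chartClosure, ∃ h, e = psi n h :=
  ⟨fun he => exists_psi_of_mem_closure he.1.2 he.2, by
    rintro ⟨n, hn, h, rfl⟩
    exact psi_mem_chartUtilde hn h⟩

end Tetra

namespace Tetra

/-! ### The chart as a part of the space of complete tetrahedra -/

/-- `U` is the open set `initialMinor ≠ 0`. A polynomial that vanishes on the nondegenerate points
over `U` vanishes on all nondegenerate points after multiplication by `initialMinor`, so taking the
closure before or after the restriction to `U` gives the same set. -/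
theorem chartUtilde_eq : chartUtilde = {e | e ∈ completeTetrahedra ∧ e.1 ∈ chartU} := by
  ext e
  constructor
  · rintro ⟨⟨hA, hU⟩, hcl⟩
    exact ⟨⟨hA, @closure_mono Ambient (zariski Ambient) _ _ (fun _ h => h.1) _ hcl⟩, hU⟩
  · rintro ⟨⟨hA, hcl⟩, hU⟩
    refine ⟨⟨hA, hU⟩, ?_⟩
    obtain ⟨c, hc⟩ := HomogTorsor.nonempty e
    obtain ⟨htet, hgen⟩ := mem_chartU_iff.1 hU
    have hD := (initialMinor_ne_zero hc htet.1).2 hgen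
    refine mem_closure_of_eval_eq_zero hc fun f hf => ?_
    have := eval_eq_zero_of_mem_closure hcl (f := initialMinor * f) (fun s hs d hd => by
      rw [map_mul]
      by_cases h0 : MvPolynomial.eval d initialMinor = 0
      · rw [h0, zero_mul]
      · have hs' : s.1 ∈ chartU := mem_chartU_iff.2 ⟨hs.1.1, (initialMinor_ne_zero hd hs.1.1.1).1 h0⟩
        rw [hf s ⟨hs, hs'⟩ d hd, mul_zero]) c hc
    rw [map_mul, mul_eq_zero] at this
    exact this.resolve_left hD

/-! ### The bundle over the core -/

/-- The image of the nondegenerate tetrahedra in the core. -/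
def coreNondeg : Set ProjProd := Prod.snd '' chartImage

/-- An edge of a hypersimplex has rank one less than the size of its vertices. -/
def Edge.rank (α : Edge) : Fin 3 :=
  ⟨α.1.1.card - 1, by have := α.card_lt; have := α.card_pos; omega⟩

theorem Edge.card_eq (α : Edge) : α.1.1.card = α.rank.val + 1 := by
  have := α.card_pos
  simp only [Edge.rank]
  omega

/-- An edge as an edge of its hypersimplex. -/
def Edge.top (α : Edge) : (hypersimplex α.rank).Edges :=
  ⟨α, ⟨Finset.empty_subset _, Finset.subset_univ _, α.card_eq⟩,
    ⟨Finset.empty_subset _, Finset.subset_univ _, α.2.1.symm.trans α.card_eq⟩⟩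

theorem Edge.top_eq (k : Fin 3) (α : (hypersimplex k).Edges) :
    (⟨_, α.1.top⟩ : Σ β : Face, β.Edges) = ⟨hypersimplex k, α⟩ := by
  have aux : ∀ (α : Edge) (k : Fin 3) (_ : α.rank = k)
      (hα : (hypersimplex k).IsVertex α.1.1 ∧ (hypersimplex k).IsVertex α.1.2),
      (⟨_, α.top⟩ : Σ β : Face, β.Edges) = ⟨hypersimplex k, ⟨α, hα⟩⟩ := by
    intro α k h hα
    subst h
    rfl
  refine aux α.1 k (Fin.ext ?_) α.2
  have h1 := α.1.card_eq
  have h2 : α.1.1.1.card = k.val + 1 := α.2.1.2.2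
  omega

theorem Edge.rank_eq (k : Fin 3) (α : (hypersimplex k).Edges) : α.1.rank = k := by
  have h1 := α.1.card_eq
  have h2 : α.1.1.1.card = k.val + 1 := α.2.1.2.2
  exact Fin.ext (by omega)

/-- The edge coordinates of the point of the fibre of `N` with coordinates `s` on the lines spanned
by the coordinate vectors `c`. -/
def lineVec (s : Fin 3 → ℂ) (c : (Σ β : Face, β.Edges) → ℂ) : Edge → ℂ :=
  fun α => s α.rank * c ⟨_, α.top⟩

theorem lineVec_hypersimplex (s : Fin 3 → ℂ) (c : (Σ β : Face, β.Edges) → ℂ) (k : Fin 3)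
    (α : (hypersimplex k).Edges) : lineVec s c α.1 = s k * c ⟨hypersimplex k, α⟩ := by
  rw [lineVec, Edge.top_eq, Edge.rank_eq]

theorem mem_fibreN {z : ProjProd} {w : AffineOE} : w ∈ fibreN z ↔
    ∀ k, (fun α : (hypersimplex k).Edges => w.2 α.1) ∈ (z (hypersimplex k)).submodule := by
  rw [fibreN, Submodule.mem_iInf]
  rfl

theorem mem_fibreN_iff {z : ProjProd} {c : (Σ β : Face, β.Edges) → ℂ}
    (hc : c ∈ HomogCoords.rep z) {w : AffineOE} :
    w ∈ fibreN z ↔ ∃ s, w.2 = lineVec s c := by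
  rw [mem_fibreN]
  have hz : ∀ k, (z (hypersimplex k)).submodule =
      Submodule.span ℂ {fun α => c ⟨hypersimplex k, α⟩} := fun k => (mem_rep_proj.1 (hc _)).2
  simp only [hz, Submodule.mem_span_singleton]
  constructor
  · intro h
    choose s hs using h
    exact ⟨s, funext fun α => (congrFun (hs α.rank) α.top).symm⟩
  · rintro ⟨s, hs⟩ k
    refine ⟨s k, funext fun α => ?_⟩
    rw [hs, lineVec_hypersimplex]
    rfl

theorem IsPolyFun.eq_zero_of_forall {σ : Type} {F : (σ → ℂ) → ℂ} (hF : IsPolyFun F)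
    {D : MvPolynomial σ ℂ} (hD : D ≠ 0) (h : ∀ s, MvPolynomial.eval s D ≠ 0 → F s = 0) (s : σ → ℂ) :
    F s = 0 := by
  obtain ⟨P, hP⟩ := hF
  have h0 : D * P = 0 := MvPolynomial.funext fun s => by
    rw [map_mul, map_zero, mul_eq_zero, or_iff_not_imp_left, hP]
    exact h s
  rw [← hP, (mul_eq_zero.1 h0).resolve_left hD, map_zero]

/-- The group `B` sweeps out the fibre over a nondegenerate point. The point of each `ℙ_β` does not
move, because all the edges of `β` have the same rank and are rescaled by the same character. -/
theorem mem_chartImage_of_mem_coreNondeg {z : ProjProd} (hz : z ∈ coreNondeg)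
    {c : (Σ β : Face, β.Edges) → ℂ} (hc : c ∈ HomogCoords.rep z) (a : OpIdx → ℂ) {s : Fin 3 → ℂ}
    (hs : ∀ k, s k ≠ 0) : ((a, lineVec s c), z) ∈ chartImage := by
  obtain ⟨n, ⟨p, hp, -, h2⟩, rfl⟩ := hz
  have hu : ∀ k, ∃ u : ℂ, u ≠ 0 ∧ ∀ α : (hypersimplex k).Edges,
      c ⟨hypersimplex k, α⟩ = u * edgeCoord p α.1 := by
    intro k
    obtain ⟨h0, hck⟩ := hc (hypersimplex k)
    rw [h2, Submodule.mem_span_singleton] at hck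
    obtain ⟨u, hu⟩ := hck
    refine ⟨u, fun h => h0 ?_, fun α => (congrFun hu α).symm⟩
    rw [← hu, h, zero_smul]
  choose u hu0 hu using hu
  -- The factor `u k` compares the chosen coordinate vector with the edge coordinates of `p`, and `s
  -- k` is the prescribed multiple of that vector.
  obtain ⟨b, hb, ha, hx⟩ := exists_translate (isGenericConfig_of_mem_chartNondeg hp) a
    (fun k => s k * u k) fun k => mul_ne_zero (hs k) (hu0 k)
  refine ⟨_, translate_mem_chartNondeg hb hp, Prod.ext ha.symm (funext fun α => ?_), fun β => ?_⟩
  · change s α.rank * c ⟨_, α.top⟩ = edgeCoord (fun I => translate b (p I)) α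
    rw [hx α.rank α α.card_eq, hu]
    exact (mul_assoc _ _ _).symm
  · have hk : ∃ k : Fin 3, β.rank = k.val + 1 := by
      have α := Classical.arbitrary β.Edges
      exact ⟨α.1.rank, by rw [← α.1.card_eq, α.2.1.2.2]⟩
    obtain ⟨k, hk⟩ := hk
    have hsm : (fun α : β.Edges => edgeCoord (fun I => translate b (p I)) α.1) =
        (s k * u k) • fun α : β.Edges => edgeCoord p α.1 := funext fun α =>
      hx k α.1 (α.2.1.2.2.trans hk)
    rw [hsm, Submodule.span_singleton_smul_eq (IsUnit.mk0 _ (mul_ne_zero (hs k) (hu0 k)))]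
    exact h2 β

/-- The coordinate vector with given components. -/
def targetVec (w : AffineOE) (c : (Σ β : Face, β.Edges) → ℂ) : TargetIdx → ℂ :=
  Sum.elim (Sum.elim (fun i => w.1 i.1) fun i => w.2 i.1) c

theorem targetVec_mem_rep {w : AffineOE} {z : ProjProd} {c : (Σ β : Face, β.Edges) → ℂ}
    (hc : c ∈ HomogCoords.rep z) : targetVec w c ∈ HomogCoords.rep (w, z) :=
  mem_rep_target.2 ⟨rfl, hc⟩

/-- Two density arguments in turn: over a fixed nondegenerate point the vectors with all `s k ≠ 0`
are dense in the fibre; then, with `s` fixed, the point of the core varies and reaches the closure.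
-/
theorem mem_chartClosure_of_mem {z : ProjProd}
    (hz : z ∈ @closure ProjProd (zariski ProjProd) coreNondeg) {w : AffineOE} (hw : w ∈ fibreN z) :
    (w, z) ∈ chartClosure := by
  obtain ⟨c, hc⟩ := HomogTorsor.nonempty z
  obtain ⟨s, hs⟩ := (mem_fibreN_iff hc).1 hw
  refine mem_closure_of_eval_eq_zero (targetVec_mem_rep hc) fun f hf => ?_
  have h1 : ∀ z' ∈ coreNondeg, ∀ d ∈ HomogCoords.rep z', ∀ s : Fin 3 → ℂ,
      MvPolynomial.eval (targetVec (w.1, lineVec s d) d) f = 0 := by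
    intro z' hz' d hd
    have hD : (∏ k : Fin 3, MvPolynomial.X k : MvPolynomial (Fin 3) ℂ) ≠ 0 :=
      Finset.prod_ne_zero_iff.2 fun k _ => MvPolynomial.X_ne_zero k
    have hF : IsPolyFun fun s : Fin 3 → ℂ => MvPolynomial.eval (targetVec (w.1, lineVec s d) d) f := by
      refine IsPolyFun.comp ⟨f, fun _ => rfl⟩ fun j => ?_
      rcases j with (j | j) | j
      · exact IsPolyFun.const _
      · exact (IsPolyFun.coord _).mul (IsPolyFun.const _)
      · exact IsPolyFun.const _
    refine hF.eq_zero_of_forall hD fun s hs0 => ?_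
    rw [map_prod, Finset.prod_ne_zero_iff] at hs0
    simp only [MvPolynomial.eval_X, Finset.mem_univ, forall_const] at hs0
    exact hf _ (mem_chartImage_of_mem_coreNondeg hz' hd w.1 hs0) _ (targetVec_mem_rep hd)
  have hG : IsPolyFun fun d : (Σ β : Face, β.Edges) → ℂ =>
      MvPolynomial.eval (targetVec (w.1, lineVec s d) d) f := by
    refine IsPolyFun.comp ⟨f, fun _ => rfl⟩ fun j => ?_
    rcases j with (j | j) | j
    · exact IsPolyFun.const _
    · exact (IsPolyFun.const _).mul (IsPolyFun.coord _)
    · exact IsPolyFun.coord _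
  have := (hG.isRat 1).eq_zero_of_mem_closure hz (fun z' hz' d hd _ => h1 z' hz' d hd s) hc (by simp)
  rwa [← hs] at this

/-- Lying on the tautological line is expressed by the equations `x_α y_α' = x_α' y_α`, which hold
on the image and hence on its closure. -/
theorem mem_of_mem_chartClosure {n : AffineOE × ProjProd} (hn : n ∈ chartClosure) :
    n.2 ∈ @closure ProjProd (zariski ProjProd) coreNondeg ∧ n.1 ∈ fibreN n.2 := by
  obtain ⟨c, hc⟩ := HomogTorsor.nonempty n
  constructor
  · refine mem_closure_of_lift (Y := ProjProd) (T := coreNondeg) hn (D := 1)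
      (g := fun d j => d (Sum.inr j))
      (fun j => (IsPolyFun.coord _).isRat _) (fun m hm d hd _ => ⟨m.2, ⟨m, hm, rfl⟩, hd.2⟩) hc
      (by simp) hc.2
  · rw [mem_fibreN]
    intro k
    have hprop : ∀ α α' : (hypersimplex k).Edges,
        n.1.2 α.1 * c (Sum.inr ⟨hypersimplex k, α'⟩) =
          n.1.2 α'.1 * c (Sum.inr ⟨hypersimplex k, α⟩) := by
      intro α α'
      have hr : IsPolyFun fun d : TargetIdx → ℂ =>
          (affOf d).2 α.1 * d (Sum.inr ⟨hypersimplex k, α'⟩) -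
            (affOf d).2 α'.1 * d (Sum.inr ⟨hypersimplex k, α⟩) :=
        ((IsPolyFun.coord _).mul (IsPolyFun.coord _)).sub
          ((IsPolyFun.coord _).mul (IsPolyFun.coord _))
      have := (hr.isRat 1).eq_zero_of_mem_closure hn (fun m hm d hd _ => ?_) hc (by simp)
      · rw [(mem_rep_target.1 hc).1] at this
        exact sub_eq_zero.1 this
      · obtain ⟨p, hp, h1, h2⟩ := hm
        rw [(mem_rep_target.1 hd).1, h1]
        have h3 := (mem_rep_target.1 hd).2 (hypersimplex k)
        have h4 := h3.2
        rw [h2, Submodule.mem_span_singleton] at h4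
        obtain ⟨u, hu⟩ := h4
        have hu' : ∀ α, d (Sum.inr ⟨hypersimplex k, α⟩) = u * edgeCoord p α.1 :=
          fun α => (congrFun hu α).symm
        rw [hu', hu']
        ring
    obtain ⟨h0, hk⟩ := mem_rep_proj.1 ((mem_rep_target.1 hc).2 (hypersimplex k))
    rw [hk, Submodule.mem_span_singleton]
    obtain ⟨α', hα'⟩ := Function.ne_iff.1 h0
    rw [Pi.zero_apply] at hα'
    refine ⟨n.1.2 α'.1 / c (Sum.inr ⟨hypersimplex k, α'⟩), funext fun α => ?_⟩
    rw [Pi.smul_apply, smul_eq_mul, div_mul_eq_mul_div, div_eq_iff hα']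
    exact (hprop α α').symm

theorem core_eq_closure : core = @closure ProjProd (zariski ProjProd) coreNondeg := by
  ext z
  constructor
  · rintro ⟨e, he, hz⟩
    obtain ⟨n, hn, h, rfl⟩ := mem_chartUtilde_iff.1 he
    rw [hz.unique (isProjImage_psi n h)]
    exact (mem_of_mem_chartClosure hn).1
  · intro hz
    -- The zero vector of the fibre over `z` lies in the closure of the image, so `z` is the image
    -- of an actual point of the chart.
    have hn := mem_chartClosure_of_mem hz (Submodule.zero_mem (fibreN z))
    have h := isCoherent_of_mem_chartClosure hn
    exact ⟨_, psi_mem_chartUtilde hn h, isProjImage_psi _ h⟩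

theorem mem_chartClosure_iff {n : AffineOE × ProjProd} :
    n ∈ chartClosure ↔ n.2 ∈ core ∧ n.1 ∈ fibreN n.2 := by
  rw [core_eq_closure]
  exact ⟨mem_of_mem_chartClosure, fun h => mem_chartClosure_of_mem h.1 h.2⟩

theorem isZariskiClosed_core : IsZariskiClosed core := by
  rw [← isClosed_zariski, core_eq_closure]
  exact @isClosed_closure _ (zariski _) _

/-! ### The chart as an isomorphism -/

theorem isCoherent_bundleN (n : BundleN) : IsCoherent n.1.1 :=
  isCoherent_of_mem_chartClosure (mem_chartClosure_iff.2 n.2)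

/-- The inverse of the chart. -/
noncomputable def psiMap (n : BundleN) : chartUtilde :=
  ⟨psi n.1 (isCoherent_bundleN n), psi_mem_chartUtilde (mem_chartClosure_iff.2 n.2) _⟩

theorem psiMap_bijective : Function.Bijective psiMap := by
  constructor
  · intro n n' h
    have h1 := isChartImage_psi n.1 (isCoherent_bundleN n)
    have h2 := isChartImage_psi n'.1 (isCoherent_bundleN n')
    have h3 : psi n.1 (isCoherent_bundleN n) = psi n'.1 (isCoherent_bundleN n') :=
      congrArg Subtype.val h
    rw [h3] at h1
    exact Subtype.ext (h1.unique h2)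
  · rintro ⟨e, he⟩
    obtain ⟨n, hn, h, rfl⟩ := mem_chartUtilde_iff.1 he
    exact ⟨⟨n, mem_chartClosure_iff.1 hn⟩, rfl⟩

/-- The chart. -/
noncomputable def chart : chartUtilde ≃ BundleN := (Equiv.ofBijective _ psiMap_bijective).symm

theorem chart_psiMap (n : BundleN) : chart (psiMap n) = n :=
  (Equiv.ofBijective _ psiMap_bijective).symm_apply_apply n

theorem exists_psiMap_eq (e : chartUtilde) : ∃ n, e = psiMap n :=
  ⟨chart e, ((Equiv.ofBijective _ psiMap_bijective).apply_symm_apply e).symm⟩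

theorem isChartImage_chart (e : chartUtilde) : IsChartImage e.1 (chart e).1 := by
  obtain ⟨n, rfl⟩ := exists_psiMap_eq e
  rw [chart_psiMap]
  exact isChartImage_psi _ (isCoherent_bundleN n)

theorem isVarietyIso_chart : IsVarietyIso chart := by
  constructor
  · refine IsMorphism.of_lift fun e => ⟨initialMinor, phiLift, fun c hc => ?_, isRat_phiLift,
      fun e' c hc _ => ?_⟩
    · obtain ⟨htet, hgen⟩ := mem_chartU_iff.1 e.2.1.2
      exact (initialMinor_ne_zero hc htet.1).2 hgen
    · have h := isChartImage_chart e'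
      have := phiLift_mem_rep hc h.2
      rw [← h.1] at this
      exact this
  · refine IsMorphism.of_lift fun n => ⟨1, psiLift, fun c _ => by simp,
      fun j => (isPolyFun_psiLift j).isRat _, fun n' c hc _ => psiLift_mem_rep (isCoherent_bundleN n') hc⟩

end Tetra

namespace Tetra

/-! ### Equivariance of the chart -/

/-- Both subspaces have dimension `k + 1`, and the first is spanned by vectors of the flag, which
belong to the second. Only the initial sets matter, as `flagCoord` looks at no others. -/
theorem opFlag_Iic {w : AffineOE} (hw : IsCoherent w) (k : Fin 4) :
    opFlag w.1 (Finset.Iic k) = sysConfig w (Finset.Iic k) := by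
  have hli : LinearIndependent ℂ (opVec w.1) := by
    have h1 : opVec w.1 = fun r => sysVec w (Finset.Iic r) := funext fun r => (IsSystem.init hw r).symm
    rw [h1]
    refine linearIndependent_of_plucker_ne_zero (A := initialSet 4) ?_
    rw [IsSystem.plucker_initialSet hw le_rfl (fun r => Finset.Iic r) fun r => by simp]
    exact one_ne_zero
  refine Submodule.eq_of_le_of_finrank_eq (Submodule.span_le.2 ?_) ?_
  · rintro _ ⟨i, hi, rfl⟩
    rw [← IsSystem.init hw i]
    exact mem_sysSpace (Finset.ne_empty_of_mem (Finset.mem_Iic.2 le_rfl))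
      (Finset.Iic_subset_Iic.2 (Finset.mem_Iic.1 hi))
  · have h2 := hli.comp (Subtype.val : (Finset.Iic k) → Fin 4) Subtype.val_injective
    have h3 : opVec w.1 '' (Finset.Iic k : Set (Fin 4)) =
        Set.range (opVec w.1 ∘ (Subtype.val : (Finset.Iic k) → Fin 4)) := by
      rw [Set.range_comp, Subtype.range_coe_subtype]
      rfl
    rw [hw.isGenericConfig.finrank, opFlag, h3, finrank_span_eq_card h2, Fintype.card_coe]

/-- The diagonal entries of `b`. -/
noncomputable def diagEntry (b : G) (n : ℕ) : ℂ := if h : n < 4 then b ⟨n, h⟩ ⟨n, h⟩ else 1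

theorem IsLowerTriangular.diagEntry_ne_zero {b : G} (hb : IsLowerTriangular b) (n : ℕ) :
    diagEntry b n ≠ 0 := by
  rw [diagEntry]
  split
  · exact hb.diag_ne_zero _
  · exact one_ne_zero

theorem IsLowerTriangular.mulVec_sysVec {b : G} (hb : IsLowerTriangular b) {w w' : AffineOE}
    (hw : IsCoherent w) (hw' : IsCoherent w') (h : sysConfig w' = fun I => translate b (sysConfig w I))
    {K : Finset (Fin 4)} (hK : K ≠ ∅) : (b : Matrix (Fin 4) (Fin 4) ℂ).mulVec (sysVec w K) =
      diagEntry b (K.card - 1) • sysVec w' K := by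
  have hpos := Finset.card_pos.2 (Finset.nonempty_iff_ne_empty.2 hK)
  have h4 := card_le_four K
  have hlt : K.card - 1 < 4 := by omega
  rw [← hw.configVec_sysConfig hK, ← hw'.configVec_sysConfig hK, h,
    hb.configVec_translate hw.isGenericConfig (l := ⟨K.card - 1, hlt⟩) (by simp; omega), diagEntry,
    dif_pos hlt, smul_smul, mul_inv_cancel₀ (hb.diag_ne_zero _), one_smul]

theorem plucker_smul {k : ℕ} (a : Fin k → ℂ) (v : Fin k → Fin 4 → ℂ) (A : Finset (Fin 4)) :
    plucker (fun i => a i • v i) A = (∏ i, a i) * plucker v A := by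
  by_cases h : A.card = k
  · rw [plucker_of_card h, plucker_of_card h, ← Matrix.det_mul_column]
    rfl
  · rw [plucker_of_card_ne h, plucker_of_card_ne h, mul_zero]

/-- The factor by which `b` acts on the Plücker coordinates attached to a pair of sets of sizes `s`
and `k`. -/
noncomputable def edgeFactor (b : G) (s k : ℕ) : ℂ :=
  (∏ r ∈ Finset.range s, diagEntry b r) * diagEntry b (k - 1)

theorem IsLowerTriangular.edgeFactor_ne_zero {b : G} (hb : IsLowerTriangular b) (s k : ℕ) :
    edgeFactor b s k ≠ 0 :=
  mul_ne_zero (Finset.prod_ne_zero_iff.2 fun _ _ => hb.diagEntry_ne_zero _) (hb.diagEntry_ne_zero _)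

/-- By Cauchy–Binet the left side is a minor of the translated vectors. Each of these is a diagonal
entry of `b` times the corresponding vector of the new system, and the diagonal entry depends only
on the size of the label. -/
theorem IsLowerTriangular.sum_compound_edgePlucker {b : G} (hb : IsLowerTriangular b)
    {w w' : AffineOE} (hw : IsCoherent w) (hw' : IsCoherent w')
    (h : sysConfig w' = fun I => translate b (sysConfig w I)) (S : Finset (Fin 4))
    {K : Finset (Fin 4)} (hK : K ≠ ∅) (A : Finset (Fin 4)) :
    ∑ A', compound b A A' * edgePlucker w S K A' =
      edgeFactor b S.card K.card * edgePlucker w' S K A := by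
  rw [edgePlucker, ← plucker_mulVec]
  have h1 : (fun i => (b : Matrix (Fin 4) (Fin 4) ℂ).mulVec
      (Fin.snoc (α := fun _ => Fin 4 → ℂ) (fun r => sysVec w (chain S r)) (sysVec w K) i)) =
      fun i => (Fin.snoc (α := fun _ => ℂ) (fun r : Fin S.card => diagEntry b r)
        (diagEntry b (K.card - 1)) i : ℂ) •
        (Fin.snoc (α := fun _ => Fin 4 → ℂ) (fun r => sysVec w' (chain S r)) (sysVec w' K) i :
          Fin 4 → ℂ) := by
    funext i
    refine Fin.lastCases ?_ (fun r => ?_) i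
    · simp only [Fin.snoc_last]
      exact hb.mulVec_sysVec hw hw' h hK
    · simp only [Fin.snoc_castSucc]
      have hc := card_chain S r
      rw [hb.mulVec_sysVec hw hw' h (fun h0 => by simp [h0] at hc), hc]
      rfl
  rw [h1, plucker_smul, Fin.prod_univ_castSucc]
  simp only [Fin.snoc_castSucc, Fin.snoc_last]
  rw [Fin.prod_univ_eq_prod_range (fun r => diagEntry b r), edgeFactor, edgePlucker]

theorem sum_prod_erase {ι κ : Type} [Fintype ι] [DecidableEq ι] [Fintype κ]
    (C : ι → κ → ℂ) (i₀ : ι) (x : κ → ℂ) (f : ι → κ → ℂ) :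
    ∑ M : ι → κ, (∏ i, C i (M i)) * (x (M i₀) * ∏ i ∈ Finset.univ.erase i₀, f i (M i)) =
      (∑ a, C i₀ a * x a) * ∏ i ∈ Finset.univ.erase i₀, ∑ a, C i a * f i a := by
  classical
  let g : ι → κ → ℂ := Function.update f i₀ x
  have hg : ∀ i ∈ Finset.univ.erase i₀, g i = f i := fun i hi =>
    Function.update_of_ne (Finset.ne_of_mem_erase hi) _ _
  have hg0 : g i₀ = x := Function.update_self _ _ _
  calc _ = ∑ M : ι → κ, ∏ i, C i (M i) * g i (M i) := by
        refine Finset.sum_congr rfl fun M _ => ?_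
        rw [Finset.prod_mul_distrib, ← Finset.mul_prod_erase _ (fun i => g i (M i)) (Finset.mem_univ i₀),
          hg0]
        congr 2
        exact Finset.prod_congr rfl fun i hi => by rw [hg i hi]
    _ = ∏ i, ∑ a, C i a * g i a := by
        rw [Finset.prod_univ_sum, Fintype.piFinset_univ]
    _ = _ := by
        rw [← Finset.mul_prod_erase _ _ (Finset.mem_univ i₀), hg0]
        congr 1
        exact Finset.prod_congr rfl fun i hi => by rw [hg i hi]

theorem sum_prod_mul {P Q : Type} [Fintype P] [Fintype Q] (F : P → ℂ) (G : Q → ℂ) :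
    ∑ x : P × Q, F x.1 * G x.2 = (∑ p, F p) * ∑ q, G q := by
  rw [Fintype.sum_prod_type, Finset.sum_mul_sum]

/-- The matrix of `genAction` is a tensor product over the factors, so its effect on a product of
coordinates is computed factor by factor; the minor is split into its two terms for this purpose. -/
theorem sum_minor_prod_erase {ι κ : Type} [Fintype ι] [DecidableEq ι] [Fintype κ]
    [inst : Fintype ((ι → κ) × (ι → κ))] (C D : ι → κ → ℂ) (i₀ : ι) (x u : κ → ℂ) (f g : ι → κ → ℂ) :
    ∑ MN : (ι → κ) × (ι → κ), (∏ i, C i (MN.1 i) * D i (MN.2 i)) *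
      ((x (MN.1 i₀) * u (MN.2 i₀) - x (MN.2 i₀) * u (MN.1 i₀)) *
        ∏ i ∈ Finset.univ.erase i₀, f i (MN.1 i) * g i (MN.2 i)) =
    ((∑ a, C i₀ a * x a) * (∑ a, D i₀ a * u a) - (∑ a, D i₀ a * x a) * (∑ a, C i₀ a * u a)) *
      ∏ i ∈ Finset.univ.erase i₀, (∑ a, C i a * f i a) * ∑ a, D i a * g i a := by
  obtain rfl : inst = instFintypeProd _ _ := Subsingleton.elim _ _
  have e1 : ∀ MN : (ι → κ) × (ι → κ), (∏ i, C i (MN.1 i) * D i (MN.2 i)) *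
      ((x (MN.1 i₀) * u (MN.2 i₀) - x (MN.2 i₀) * u (MN.1 i₀)) *
        ∏ i ∈ Finset.univ.erase i₀, f i (MN.1 i) * g i (MN.2 i)) =
      ((∏ i, C i (MN.1 i)) * (x (MN.1 i₀) * ∏ i ∈ Finset.univ.erase i₀, f i (MN.1 i))) *
        ((∏ i, D i (MN.2 i)) * (u (MN.2 i₀) * ∏ i ∈ Finset.univ.erase i₀, g i (MN.2 i))) -
      ((∏ i, C i (MN.1 i)) * (u (MN.1 i₀) * ∏ i ∈ Finset.univ.erase i₀, f i (MN.1 i))) *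
        ((∏ i, D i (MN.2 i)) * (x (MN.2 i₀) * ∏ i ∈ Finset.univ.erase i₀, g i (MN.2 i))) := by
    intro MN
    rw [Finset.prod_mul_distrib, Finset.prod_mul_distrib]
    ring
  have hprod := @sum_prod_mul (ι → κ) (ι → κ) _ _
  simp only [e1]
  rw [Finset.sum_sub_distrib,
    hprod (fun M => (∏ i, C i (M i)) * (x (M i₀) * ∏ i ∈ Finset.univ.erase i₀, f i (M i)))
      fun N => (∏ i, D i (N i)) * (u (N i₀) * ∏ i ∈ Finset.univ.erase i₀, g i (N i)),
    hprod (fun M => (∏ i, C i (M i)) * (u (M i₀) * ∏ i ∈ Finset.univ.erase i₀, f i (M i)))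
      fun N => (∏ i, D i (N i)) * (x (N i₀) * ∏ i ∈ Finset.univ.erase i₀, g i (N i)),
    sum_prod_erase, sum_prod_erase, sum_prod_erase, sum_prod_erase, Finset.prod_mul_distrib]
  ring

/-- All the generators are rescaled by the same constant because the edges of `β` have equal rank:
the edge of the generator contributes `l` from `p_I` and `m` from `p_{I ∪ J}`, and every other edge
contributes `l * l`. Projectively, `b` thus acts trivially on the coordinates `y_α`. -/
theorem IsLowerTriangular.genAction_genMap {b : G} (hb : IsLowerTriangular b)
    {w w' : AffineOE} (hw : IsCoherent w) (hw' : IsCoherent w')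
    (h : sysConfig w' = fun I => translate b (sysConfig w I)) (β : Face) :
    ∃ κ : ℂ, κ ≠ 0 ∧ ∀ y, genAction b β (genMap w β y) = κ • genMap w' β y := by
  have hr : ∀ α : β.Edges, α.1.1.1.card = β.rank := fun α => α.2.1.2.2
  have hr2 : ∀ α : β.Edges, α.1.1.2.card = β.rank := fun α => α.2.2.2.2
  have hs : ∀ α : β.Edges, (α.1.1.1 ∩ α.1.1.2).card = β.rank - 1 := fun α => by
    rw [← hr α, ← α.1.card_inter_succ, Nat.add_sub_cancel]
  have hu : ∀ α : β.Edges, (α.1.1.1 ∪ α.1.1.2).card = β.rank + 1 := fun α => by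
    rw [α.1.card_union, hr]
  have hpos : 0 < β.rank := lt_of_le_of_lt (Nat.zero_le _) β.lower_lt
  set l := edgeFactor b (β.rank - 1) β.rank with hl
  set m := edgeFactor b (β.rank - 1) (β.rank + 1) with hm
  have hne : ∀ {K : Finset (Fin 4)}, 0 < K.card → K ≠ ∅ := fun hK h0 => by simp [h0] at hK
  have h1 : ∀ (α : β.Edges) A, ∑ A', compound b A A' *
      edgePlucker w (α.1.1.1 ∩ α.1.1.2) α.1.1.1 A' =
      l * edgePlucker w' (α.1.1.1 ∩ α.1.1.2) α.1.1.1 A := fun α A => by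
    rw [hb.sum_compound_edgePlucker hw hw' h _ (hne (by rw [hr]; exact hpos)), hs, hr]
  have h2 : ∀ (α : β.Edges) A, ∑ A', compound b A A' *
      edgePlucker w (α.1.1.1 ∩ α.1.1.2) α.1.1.2 A' =
      l * edgePlucker w' (α.1.1.1 ∩ α.1.1.2) α.1.1.2 A := fun α A => by
    rw [hb.sum_compound_edgePlucker hw hw' h _ (hne (by rw [hr2]; exact hpos)), hs, hr2]
  have h3 : ∀ (α : β.Edges) A, ∑ A', compound b A A' *
      edgePlucker w (α.1.1.1 ∩ α.1.1.2) (α.1.1.1 ∪ α.1.1.2) A' =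
      m * edgePlucker w' (α.1.1.1 ∩ α.1.1.2) (α.1.1.1 ∪ α.1.1.2) A := fun α A => by
    rw [hb.sum_compound_edgePlucker hw hw' h _ (hne (by rw [hu]; omega)), hs, hu]
  refine ⟨l * m * (l * l) ^ (Fintype.card β.Edges - 1), mul_ne_zero (mul_ne_zero
    (hb.edgeFactor_ne_zero _ _) (hb.edgeFactor_ne_zero _ _)) (pow_ne_zero _ (mul_ne_zero
      (hb.edgeFactor_ne_zero _ _) (hb.edgeFactor_ne_zero _ _))), fun y => funext ?_⟩
  rintro ⟨α₀, M, N⟩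
  have key : ∑ MN : (β.Edges → Finset (Fin 4)) × (β.Edges → Finset (Fin 4)),
      (∏ α, compound b (M α) (MN.1 α) * compound b (N α) (MN.2 α)) * genCoeff w β (α₀, MN) =
      l * m * (l * l) ^ (Fintype.card β.Edges - 1) * genCoeff w' β (α₀, M, N) := by
    refine (sum_minor_prod_erase (fun α => compound b (M α)) (fun α => compound b (N α)) α₀
      (edgePlucker w (α₀.1.1.1 ∩ α₀.1.1.2) α₀.1.1.1)
      (edgePlucker w (α₀.1.1.1 ∩ α₀.1.1.2) (α₀.1.1.1 ∪ α₀.1.1.2))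
      (fun α => edgePlucker w (α.1.1.1 ∩ α.1.1.2) α.1.1.1)
      (fun α => edgePlucker w (α.1.1.1 ∩ α.1.1.2) α.1.1.2)).trans ?_
    simp only [h1, h2, h3]
    have h4 : ∀ x y : ℂ, l * x * (l * y) = l * l * (x * y) := fun x y => by ring
    simp only [h4]
    rw [Finset.prod_mul_distrib, Finset.prod_const, Finset.card_erase_of_mem (Finset.mem_univ _),
      Finset.card_univ, genCoeff]
    ring
  rw [Pi.smul_apply, smul_eq_mul, genMap_apply, ← mul_assoc, ← key, genAction, Matrix.mulVecLin_apply,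
    Matrix.mulVec, dotProduct, Fintype.sum_prod_type, Finset.sum_eq_single α₀]
  · rw [Finset.sum_mul]
    refine Finset.sum_congr rfl fun MN _ => ?_
    rw [Matrix.of_apply, if_pos rfl, genMap_apply, mul_assoc]
  · intro α _ hα
    refine Finset.sum_eq_zero fun MN _ => ?_
    rw [Matrix.of_apply, if_neg (Ne.symm hα), zero_mul]
  · simp

theorem IsLowerTriangular.actB_eq {b : G} (hb : IsLowerTriangular b) {n : AffineOE × ProjProd}
    (h : IsCoherent n.1) : (actB b n).1 = (flagCoord fun I => translate b (sysConfig n.1 I),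
      edgeCoord fun I => translate b (sysConfig n.1 I)) := by
  refine Prod.ext (funext fun ij => ?_) (funext fun α => ?_)
  · change pluckerRatio (translate b (opFlag n.1.1 _)) _ _ = pluckerRatio (translate b (sysConfig n.1 _)) _ _
    rw [opFlag_Iic h]
  · change edgeChar b α * n.1.2 α = edgeCoord (fun I => translate b (sysConfig n.1 I)) α
    rw [hb.edgeCoord_translate h.isGenericConfig]
    have := congrArg Prod.snd h.coord_sysConfig
    rw [← this]

theorem actB_mem (b : G) (n : BundleN) :
    (actB b n.1).2 ∈ core ∧ (actB b n.1).1 ∈ fibreN (actB b n.1).2 := by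
  refine ⟨n.2.1, mem_fibreN.2 fun k => ?_⟩
  have h1 := mem_fibreN.1 n.2.2 k
  have h2 : (fun α : (hypersimplex k).Edges => (actB b n.1).1.2 α.1) =
      (b k.succ k.succ / b k.castSucc k.castSucc) •
        fun α : (hypersimplex k).Edges => n.1.1.2 α.1 := funext fun α => by
    change edgeChar b α.1 * n.1.1.2 α.1 = _
    rw [edgeChar_eq b (k := k) (α.2.1.2.2), Pi.smul_apply, smul_eq_mul]
  rw [h2]
  exact Submodule.smul_mem _ _ h1

theorem exists_isTranslate {b : G} (hb : IsLowerTriangular b) (e : chartUtilde) :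
    ∃ e' : chartUtilde, IsTranslate b e.1 e'.1 ∧ (chart e').1 = actB b (chart e).1 := by
  obtain ⟨n, rfl⟩ := exists_psiMap_eq e
  let n' : BundleN := ⟨actB b n.1, actB_mem b n⟩
  refine ⟨psiMap n', ?_, by rw [chart_psiMap, chart_psiMap]⟩
  have hw := isCoherent_bundleN n
  have hw' := isCoherent_bundleN n'
  have h : sysConfig n'.1.1 = fun I => translate b (sysConfig n.1.1 I) := by
    change sysConfig (actB b n.1).1 = _
    rw [hb.actB_eq hw]
    exact (hb.isGenericConfig_translate hw.isGenericConfig).eq_sysConfig.symm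
  refine ⟨fun I => congrFun h I, fun β => ⟨fun α => ?_, ?_⟩⟩
  · exact Prod.ext (congrFun h _) (congrFun h _)
  · obtain ⟨κ, hκ, hgen⟩ := hb.genAction_genMap hw hw' h β
    change ((psi n'.1 hw').2 β).2.submodule = ((psi n.1 hw).2 β).2.submodule.map _
    rw [psi_submodule, psi_submodule, ← Submodule.map_comp]
    have h2 : genAction b β ∘ₗ genMap n.1.1 β = κ • genMap n'.1.1 β := LinearMap.ext hgen
    rw [h2, Submodule.map_smul _ _ _ hκ]
    rfl

end Tetra

namespace Tetra

/-! ### Local triviality of the bundle -/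

/-- The coordinates of `𝔸_op × ℂ³`. -/
noncomputable def fibreIdx : Fin 9 ≃ OpIdx ⊕ Fin 3 :=
  (Fintype.equivFinOfCardEq (by decide)).symm

/-- The part of the core where the coordinates at the edges `A k` of the hypersimplices do not
vanish. -/
def coreOpen (A : ∀ k : Fin 3, (hypersimplex k).Edges) : Set ProjProd :=
  {z | z ∈ core ∧ ∀ c ∈ HomogCoords.rep z, ∀ k, c ⟨hypersimplex k, A k⟩ ≠ 0}

theorem coord_ne_zero_of_mem_rep {z : ProjProd} {c c' : (Σ β : Face, β.Edges) → ℂ}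
    (hc : c ∈ HomogCoords.rep z) (hc' : c' ∈ HomogCoords.rep z) {i : Σ β : Face, β.Edges}
    (h : c i ≠ 0) : c' i ≠ 0 := by
  have h1 := (hc i.1).2
  rw [(mem_rep_proj.1 (hc' i.1)).2, Submodule.mem_span_singleton] at h1
  obtain ⟨a, ha⟩ := h1
  intro h0
  refine h ((congrFun ha i.2).symm.trans ?_)
  change a * c' i = 0
  rw [h0, mul_zero]

theorem mem_coreOpen {A : ∀ k : Fin 3, (hypersimplex k).Edges} {z : ProjProd} (hz : z ∈ core)
    {c : (Σ β : Face, β.Edges) → ℂ} (hc : c ∈ HomogCoords.rep z) :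
    z ∈ coreOpen A ↔ ∀ k, c ⟨hypersimplex k, A k⟩ ≠ 0 :=
  ⟨fun h => h.2 c hc, fun h => ⟨hz, fun _ hc' k => coord_ne_zero_of_mem_rep hc hc' (h k)⟩⟩

theorem exists_mem_coreOpen {z : ProjProd} (hz : z ∈ core) : ∃ A, z ∈ coreOpen A := by
  obtain ⟨c, hc⟩ := HomogTorsor.nonempty z
  have h : ∀ k : Fin 3, ∃ α, c ⟨hypersimplex k, α⟩ ≠ 0 := fun k => Function.ne_iff.1 (hc _).1
  choose A hA using h
  exact ⟨A, (mem_coreOpen hz hc).2 hA⟩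

theorem isZariskiClosed_compl_coreOpen (A : ∀ k : Fin 3, (hypersimplex k).Edges) :
    IsZariskiClosed {z : core | z.1 ∉ coreOpen A} := by
  refine ⟨{∏ k : Fin 3, MvPolynomial.X ⟨hypersimplex k, A k⟩}, fun z c hc => ?_⟩
  rw [Set.mem_ofPred_eq, mem_coreOpen z.2 hc]
  simp only [Set.mem_singleton_iff, forall_eq, map_prod, MvPolynomial.eval_X, Finset.prod_eq_zero_iff,
    Finset.mem_univ, true_and, not_forall, not_not]

/-- The coordinates on the fibres over `coreOpen A`. -/
noncomputable def fibreCoord (A : ∀ k : Fin 3, (hypersimplex k).Edges) : AffineOE →ₗ[ℂ] (Fin 9 → ℂ) :=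
  LinearMap.pi fun i => Sum.elim (fun ij => LinearMap.proj ij ∘ₗ LinearMap.fst ℂ _ _)
    (fun k => LinearMap.proj (A k).1 ∘ₗ LinearMap.snd ℂ _ _) (fibreIdx i)

theorem fibreCoord_inl (A : ∀ k : Fin 3, (hypersimplex k).Edges) (w : AffineOE) (ij : OpIdx) :
    fibreCoord A w (fibreIdx.symm (Sum.inl ij)) = w.1 ij := by
  simp [fibreCoord]

theorem fibreCoord_inr (A : ∀ k : Fin 3, (hypersimplex k).Edges) (w : AffineOE) (k : Fin 3) :
    fibreCoord A w (fibreIdx.symm (Sum.inr k)) = w.2 (A k).1 := by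
  simp [fibreCoord]

/-- The point of the fibre with given coordinates. -/
noncomputable def fibrePoint (A : ∀ k : Fin 3, (hypersimplex k).Edges)
    (c : (Σ β : Face, β.Edges) → ℂ) (v : Fin 9 → ℂ) : AffineOE :=
  (fun ij => v (fibreIdx.symm (Sum.inl ij)),
    lineVec (fun k => v (fibreIdx.symm (Sum.inr k)) * (c ⟨hypersimplex k, A k⟩)⁻¹) c)

theorem fibrePoint_snd (A : ∀ k : Fin 3, (hypersimplex k).Edges)
    (c : (Σ β : Face, β.Edges) → ℂ) (v : Fin 9 → ℂ) : (fibrePoint A c v).2 =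
      lineVec (fun k => v (fibreIdx.symm (Sum.inr k)) * (c ⟨hypersimplex k, A k⟩)⁻¹) c := rfl

theorem fibreCoord_fibrePoint {A : ∀ k : Fin 3, (hypersimplex k).Edges}
    {c : (Σ β : Face, β.Edges) → ℂ} (hc : ∀ k, c ⟨hypersimplex k, A k⟩ ≠ 0) (v : Fin 9 → ℂ) :
    fibreCoord A (fibrePoint A c v) = v := by
  funext i
  obtain ⟨j, rfl⟩ := fibreIdx.symm.surjective i
  rcases j with ij | k
  · rw [fibreCoord_inl]
    rfl
  · rw [fibreCoord_inr]
    rw [fibrePoint_snd, lineVec_hypersimplex, inv_mul_cancel_right₀ (hc k)]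

/-- A vector on the line spanned by `c` is determined by its coordinate at one edge where `c` is
nonzero. The quotients involved do not change when `c` is rescaled. -/
theorem fibrePoint_fibreCoord {A : ∀ k : Fin 3, (hypersimplex k).Edges} {z : ProjProd}
    {c : (Σ β : Face, β.Edges) → ℂ} (hz : c ∈ HomogCoords.rep z)
    (hc : ∀ k, c ⟨hypersimplex k, A k⟩ ≠ 0) {w : AffineOE} (hw : w ∈ fibreN z) :
    fibrePoint A c (fibreCoord A w) = w := by
  obtain ⟨s, hs⟩ := (mem_fibreN_iff hz).1 hw
  refine Prod.ext (funext fun ij => fibreCoord_inl A w ij) ?_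
  rw [hs, fibrePoint_snd]
  refine congrArg (fun s => lineVec s c) (funext fun k => ?_)
  rw [fibreCoord_inr, hs, lineVec_hypersimplex, mul_inv_cancel_right₀ (hc k)]

theorem fibrePoint_mem {A : ∀ k : Fin 3, (hypersimplex k).Edges} {z : ProjProd}
    {c : (Σ β : Face, β.Edges) → ℂ} (hz : c ∈ HomogCoords.rep z) (v : Fin 9 → ℂ) :
    fibrePoint A c v ∈ fibreN z := (mem_fibreN_iff hz).2
    ⟨fun k => v (fibreIdx.symm (Sum.inr k)) * (c ⟨hypersimplex k, A k⟩)⁻¹, rfl⟩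

/-- The bundle over a subset of the core in coordinates. -/
noncomputable def trivMap (A : ∀ k : Fin 3, (hypersimplex k).Edges) {O : Set ProjProd}
    (n : TotalSpace fibreN O) : O × (Fin 9 → ℂ) :=
  (⟨n.1.2, n.2.1⟩, fibreCoord A n.1.1)

variable {A : ∀ k : Fin 3, (hypersimplex k).Edges} {O : Set ProjProd}

theorem trivMap_bijective (hO : O ⊆ coreOpen A) :
    Function.Bijective (trivMap A : TotalSpace fibreN O → _) := by
  constructor
  · rintro ⟨⟨w, z⟩, hz, hw⟩ ⟨⟨w', z'⟩, hz', hw'⟩ h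
    obtain ⟨h1, h2⟩ := Prod.ext_iff.1 h
    obtain rfl : z = z' := congrArg Subtype.val h1
    obtain ⟨c, hc⟩ := HomogTorsor.nonempty z
    have h3 := fibrePoint_fibreCoord hc ((hO hz).2 c hc) hw
    have h4 := fibrePoint_fibreCoord hc ((hO hz).2 c hc) hw'
    have h5 : fibreCoord A w = fibreCoord A w' := h2
    obtain rfl : w = w' := h3.symm.trans ((congrArg (fibrePoint A c) h5).trans h4)
    rfl
  · rintro ⟨⟨z, hz⟩, v⟩
    obtain ⟨c, hc⟩ := HomogTorsor.nonempty z
    exact ⟨⟨(fibrePoint A c v, z), hz, fibrePoint_mem hc v⟩,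
      Prod.ext rfl (fibreCoord_fibrePoint ((hO hz).2 c hc) v)⟩

/-- The local trivialization over subsets of `coreOpen A`. -/
noncomputable def triv (hO : O ⊆ coreOpen A) : TotalSpace fibreN O ≃ O × (Fin 9 → ℂ) :=
  Equiv.ofBijective _ (trivMap_bijective hO)

theorem isVarietyIso_triv (hO : O ⊆ coreOpen A) : IsVarietyIso (triv hO) := by
  constructor
  · refine IsMorphism.of_lift fun n => ⟨1, fun (c : TargetIdx → ℂ)
      (j : (Σ β : Face, β.Edges) ⊕ (Σ _ : Fin 9, Unit)) =>
        Sum.elim (fun i => c (Sum.inr i)) (fun i => fibreCoord A (affOf c) i.1) j,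
      fun c _ => by simp, fun j => ?_, fun n' c hc _ => ?_⟩
    · refine IsPolyFun.isRat ?_ _
      rcases j with j | ⟨i, _⟩
      · exact IsPolyFun.coord _
      · obtain ⟨j, rfl⟩ := fibreIdx.symm.surjective i
        rcases j with ij | k
        · simp only [Sum.elim_inr, fibreCoord_inl]
          exact IsPolyFun.coord _
        · simp only [Sum.elim_inr, fibreCoord_inr]
          exact IsPolyFun.coord _
    · obtain ⟨h1, h2⟩ := mem_rep_target.1 hc
      refine ⟨h2, fun i => ?_⟩
      change (fun _ : Unit => fibreCoord A (affOf c) i) = fun _ => fibreCoord A n'.1.1 i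
      rw [h1]
  · let D : MvPolynomial ((Σ β : Face, β.Edges) ⊕ (Σ _ : Fin 9, Unit)) ℂ :=
      ∏ k : Fin 3, MvPolynomial.X (Sum.inl ⟨hypersimplex k, A k⟩)
    refine IsMorphism.of_lift fun y => ⟨D, fun c => targetVec (fibrePoint A (fun i => c (Sum.inl i))
      (fun i => c (Sum.inr ⟨i, ()⟩))) (fun i => c (Sum.inl i)), fun c hc => ?_, fun j => ?_,
      fun y' c hc _ => ?_⟩
    · rw [map_prod, Finset.prod_ne_zero_iff]
      intro k _
      rw [MvPolynomial.eval_X]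
      exact (hO y.1.2).2 _ hc.1 k
    · have hinv : ∀ k : Fin 3, IsRat D fun c => (c (Sum.inl ⟨hypersimplex k, A k⟩))⁻¹ := fun k => by
        have : (MvPolynomial.X (Sum.inl ⟨hypersimplex k, A k⟩) :
            MvPolynomial ((Σ β : Face, β.Edges) ⊕ (Σ _ : Fin 9, Unit)) ℂ) ∣ D :=
          Finset.dvd_prod_of_mem _ (Finset.mem_univ k)
        simpa using IsRat.inv_of_dvd this
      have hX : ∀ j : (Σ β : Face, β.Edges) ⊕ (Σ _ : Fin 9, Unit), IsRat D fun c => c j :=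
        fun j => (IsPolyFun.coord j).isRat D
      rcases j with (⟨ij, _⟩ | ⟨α, _⟩) | j
      · exact hX _
      · exact ((hX _).mul (hinv _)).mul (hX _)
      · exact hX _
    · obtain ⟨n, rfl⟩ := (triv hO).surjective y'
      rw [Equiv.symm_apply_apply]
      have hz : (fun i => c (Sum.inl i)) ∈ HomogCoords.rep n.1.2 := hc.1
      have hv : (fun i => c (Sum.inr ⟨i, ()⟩)) = fibreCoord A n.1.1 :=
        funext fun i => congrFun (hc.2 i) ()
      have h1 := fibrePoint_fibreCoord hz ((hO n.2.1).2 _ hz) n.2.2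
      beta_reduce
      rw [hv]
      exact (congrArg (· ∈ HomogCoords.rep n)
        (congrArg (fun w => targetVec w fun i => c (Sum.inl i)) h1)).mpr (targetVec_mem_rep hz)

theorem isVectorBundle_fibreN : IsVectorBundle core fibreN 9 := by
  intro z₀ hz₀
  obtain ⟨A, hA⟩ := exists_mem_coreOpen hz₀
  refine ⟨coreOpen A, fun z hz => hz.1, hA, isZariskiClosed_compl_coreOpen A,
    triv subset_rfl, isVarietyIso_triv subset_rfl, fun n => rfl, fun z => ?_⟩
  obtain ⟨c, hc⟩ := HomogTorsor.nonempty z.1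
  refine ⟨LinearEquiv.ofBijective ((fibreCoord A).domRestrict (fibreN z.1)) ⟨fun w w' h => ?_,
    fun v => ⟨⟨fibrePoint A c v, fibrePoint_mem hc v⟩, fibreCoord_fibrePoint (z.2.2 c hc) v⟩⟩,
    fun w => rfl⟩
  have h5 : fibreCoord A w.1 = fibreCoord A w'.1 := h
  apply Subtype.ext
  rw [← fibrePoint_fibreCoord hc (z.2.2 c hc) w.2, h5, fibrePoint_fibreCoord hc (z.2.2 c hc) w'.2]

end Tetra

namespace Tetra

/-! ### Tetrahedra with given vertices -/

/-- The tetrahedron with given vertices. -/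
def vertexConfig (v : Fin 4 → Fin 4 → ℂ) : Config :=
  fun I => Submodule.span ℂ (v '' (I : Set (Fin 4)))

/-- The Plücker coordinates of the faces of the tetrahedron with given vertices. -/
noncomputable def vertexPlucker (v : Fin 4 → Fin 4 → ℂ) (I : Finset (Fin 4)) :
    Finset (Fin 4) → ℂ :=
  plucker fun r => v (I.orderEmbOfFin rfl r)

theorem vertexPlucker_mem_rep {v : Fin 4 → Fin 4 → ℂ} (hv : LinearIndependent ℂ v)
    (I : Finset (Fin 4)) : vertexPlucker v I ∈ HomogCoords.rep (vertexConfig v I) := by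
  refine ⟨_, _, hv.comp _ (I.orderEmbOfFin rfl).injective, ?_, rfl⟩
  rw [vertexConfig, Set.range_comp, Finset.range_orderEmbOfFin]

theorem linearIndependent_of_vertexPlucker {v : Fin 4 → Fin 4 → ℂ}
    (h : vertexPlucker v Finset.univ (initialSet 4) ≠ 0) : LinearIndependent ℂ v := by
  have h1 := linearIndependent_of_plucker_ne_zero h
  let e : Fin (Finset.univ : Finset (Fin 4)).card ≃ Fin 4 := Equiv.ofBijective
    (Finset.univ.orderEmbOfFin rfl) ⟨(Finset.univ.orderEmbOfFin rfl).injective, fun x => by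
      have : x ∈ Set.range (Finset.univ.orderEmbOfFin (rfl : Finset.univ.card = _)) := by
        rw [Finset.range_orderEmbOfFin]
        exact Finset.mem_coe.2 (Finset.mem_univ x)
      exact this⟩
  exact (linearIndependent_equiv e).1 h1

theorem vertexConfig_mem_nondegTetrahedra {v : Fin 4 → Fin 4 → ℂ} (hv : LinearIndependent ℂ v) :
    vertexConfig v ∈ nondegTetrahedra := by
  have hdet : (Matrix.of v).transpose.det ≠ 0 := by
    rw [Matrix.det_transpose]
    have : IsUnit (Matrix.of v) := Matrix.linearIndependent_rows_iff_isUnit.1 hv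
    exact ((Matrix.isUnit_iff_isUnit_det _).1 this).ne_zero
  refine ⟨Matrix.GeneralLinearGroup.mkOfDetNeZero _ hdet, fun I => ?_⟩
  rw [vertexConfig, translate, coordSubspace, Submodule.map_span, ← Set.image_comp]
  congr 1
  refine Set.image_congr fun i _ => ?_
  ext j
  simp [Matrix.GeneralLinearGroup.mkOfDetNeZero]

theorem vertexConfig_mem_chartNondeg {v : Fin 4 → Fin 4 → ℂ}
    (h : ∀ I, vertexPlucker v I (initialSet I.card) ≠ 0) :
    LinearIndependent ℂ v ∧ vertexConfig v ∈ chartNondeg := by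
  have hv := linearIndependent_of_vertexPlucker (h Finset.univ)
  have hn := vertexConfig_mem_nondegTetrahedra hv
  exact ⟨hv, mem_chartNondeg hn fun I => (rep_initialSet_ne_zero_iff
    ((nondegTetrahedra_subset hn).1 I) (vertexPlucker_mem_rep hv I)).1 (h I)⟩

theorem eq_iSup_of_mem_nondegTetrahedra {p : Config} (hp : p ∈ nondegTetrahedra)
    (I : Finset (Fin 4)) : p I = ⨆ i ∈ (I : Set (Fin 4)), p {i} := by
  obtain ⟨b, hb⟩ := hp
  simp only [hb, translate, coordSubspace, Submodule.map_span, ← Set.image_comp]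
  rw [Submodule.span_eq_iSup_of_singleton_spans, iSup_image]
  simp

/-! ### Normal forms -/

/-- The vertices of the tetrahedra in normal form. -/
def normalVertex (t : Fin 3 → ℂ) : Fin 4 → Fin 4 → ℂ :=
  ![![1, 0, 0, 0], ![1, 1, 0, 0], ![1, t 0, t 0, 0], ![1, t 1, t 1 * t 2, t 1 * t 2]]

/-- The edge `{1, j + 2}`. -/
def vertexEdge (j : Fin 3) : Edge := ⟨({0}, {j.succ}), by decide +revert⟩

/-- The edge `{12, 1(j + 3)}`. -/
def lineEdge (j : Fin 2) : Edge := ⟨({0, 1}, {0, j.succ.succ}), by decide +revert⟩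

/-- The edge `{123, 124}`. -/
def planeEdge : Edge := ⟨({0, 1, 2}, {0, 1, 3}), by decide⟩

/-- The edge relations are solved downwards from the standard flag. In the labels `1, …, 4` they
give `v_124 = e₃ + e₄`, `v_13 = e₂ + e₃` and `v_14 = e₂ + t 2 (e₃ + e₄)`, and then the vertices
`e₁`, `e₁ + e₂`, `e₁ + t 0 v_13` and `e₁ + t 1 v_14`. -/
theorem configVec_eq_normalVertex {p : Config} (h : IsGenericConfig p) (ha : flagCoord p = 0)
    (h0 : edgeCoord p (vertexEdge 0) = 1) (h1 : edgeCoord p (lineEdge 0) = 1)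
    (h2 : edgeCoord p planeEdge = 1) (i : Fin 4) : configVec p {i} = normalVertex
      ![edgeCoord p (vertexEdge 1), edgeCoord p (vertexEdge 2), edgeCoord p (lineEdge 1)] i := by
  have hs := h.isSystem
  rw [ha] at hs
  have hop : ∀ k : Fin 4, opVec 0 k = Pi.single k 1 := fun k => by
    ext j
    simp only [opVec, Pi.zero_apply, Pi.single_apply, eq_comm]
    split <;> simp_all
  have i0 : configVec p {0} = Pi.single 0 1 := (hs.init 0).trans (hop 0)
  have i1 : configVec p {0, 1} = Pi.single 1 1 := (hs.init 1).trans (hop 1)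
  have i2 : configVec p {0, 1, 2} = Pi.single 2 1 := (hs.init 2).trans (hop 2)
  have i3 : configVec p {0, 1, 2, 3} = Pi.single 3 1 := (hs.init 3).trans (hop 3)
  have key : ∀ (α : Edge) (I J K : Finset (Fin 4)), α.1.1 = I → α.1.2 = J → I ∪ J = K →
      configVec p J = configVec p I + edgeCoord p α • configVec p K := by
    rintro α _ _ _ rfl rfl rfl
    exact hs.edge α
  have j1 : configVec p {0, 1, 3} = Pi.single 2 1 + Pi.single 3 1 := by
    rw [key planeEdge {0, 1, 2} {0, 1, 3} {0, 1, 2, 3} rfl rfl (by decide), h2, one_smul, i2, i3]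
  have j2 : configVec p {0, 2} = Pi.single 1 1 + Pi.single 2 1 := by
    rw [key (lineEdge 0) {0, 1} {0, 2} {0, 1, 2} rfl rfl (by decide), h1, one_smul, i1, i2]
  have j3 : configVec p {0, 3} = Pi.single 1 1 +
      edgeCoord p (lineEdge 1) • (Pi.single 2 1 + Pi.single 3 1) := by
    rw [key (lineEdge 1) {0, 1} {0, 3} {0, 1, 3} rfl rfl (by decide), i1, j1]
  fin_cases i
  · refine i0.trans ?_
    ext j
    fin_cases j <;> simp [normalVertex]
  · change configVec p {1} = _
    rw [key (vertexEdge 0) {0} {1} {0, 1} rfl rfl (by decide), h0, one_smul, i0, i1]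
    ext j
    fin_cases j <;> simp [normalVertex]
  · change configVec p {2} = _
    rw [key (vertexEdge 1) {0} {2} {0, 2} rfl rfl (by decide), i0, j2]
    ext j
    fin_cases j <;> simp [normalVertex]
  · change configVec p {3} = _
    rw [key (vertexEdge 2) {0} {3} {0, 3} rfl rfl (by decide), i0, j3]
    ext j
    fin_cases j <;> simp [normalVertex]

/-- The freedom in `B` is used up: the unipotent part moves the flag to the standard one, and the
three characters turn one edge coordinate of each rank into `1`. -/
theorem exists_normalVertex {p : Config} (hp : p ∈ chartNondeg) : ∃ (b : G) (t : Fin 3 → ℂ),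
    IsLowerTriangular b ∧ (fun I => translate b (p I)) = vertexConfig (normalVertex t) ∧
    ∀ I, vertexPlucker (normalVertex t) I (initialSet I.card) ≠ 0 := by
  obtain ⟨b, hb, ha, hx⟩ := exists_translate (isGenericConfig_of_mem_chartNondeg hp) 0
    ![(edgeCoord p (vertexEdge 0))⁻¹, (edgeCoord p (lineEdge 0))⁻¹, (edgeCoord p planeEdge)⁻¹]
    (fun k => by fin_cases k <;> simp [edgeCoord_ne_zero hp])
  have hp' := translate_mem_chartNondeg hb hp
  set p' : Config := fun I => translate b (p I) with hpdef
  have hg := isGenericConfig_of_mem_chartNondeg hp'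
  have h := configVec_eq_normalVertex hg ha
    ((hx 0 (vertexEdge 0) rfl).trans (inv_mul_cancel₀ (edgeCoord_ne_zero hp _)))
    ((hx 1 (lineEdge 0) rfl).trans (inv_mul_cancel₀ (edgeCoord_ne_zero hp _)))
    ((hx 2 planeEdge rfl).trans (inv_mul_cancel₀ (edgeCoord_ne_zero hp _)))
  set t : Fin 3 → ℂ := ![edgeCoord p' (vertexEdge 1), edgeCoord p' (vertexEdge 2),
    edgeCoord p' (lineEdge 1)]
  have hsingle : ∀ i, p' {i} = Submodule.span ℂ {normalVertex t i} := by
    intro i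
    have hne : normalVertex t i ≠ 0 := by
      rw [← h]
      intro h0
      have := hg.isSystem.one {i} 0 (by simp)
      rw [h0] at this
      simp at this
    symm
    refine Submodule.eq_of_le_of_finrank_eq ?_ ?_
    · rw [Submodule.span_singleton_le_iff_mem, ← h]
      exact hg.configVec_mem (Finset.singleton_ne_empty i)
    · rw [finrank_span_singleton hne, hg.finrank, Finset.card_singleton]
  have hpt : p' = vertexConfig (normalVertex t) := by
    funext I
    rw [eq_iSup_of_mem_nondegTetrahedra hp'.1, vertexConfig,
      Submodule.span_eq_iSup_of_singleton_spans, iSup_image]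
    simp only [hsingle]
  refine ⟨b, t, hb, hpt, fun I => ?_⟩
  have hli : LinearIndependent ℂ (normalVertex t) := by
    rw [linearIndependent_iff_card_eq_finrank_span, Set.finrank, ← Set.image_univ]
    have := hg.finrank Finset.univ
    rw [hpt, vertexConfig, Finset.coe_univ] at this
    simpa using this.symm
  exact (rep_initialSet_ne_zero_iff (by rw [← hpt]; exact hg.finrank I)
    (vertexPlucker_mem_rep hli I)).2 (by rw [← hpt]; exact hg.generic I)

theorem IsGenericConfig.configVec_eq {p : Config} (h : IsGenericConfig p) {I : Finset (Fin 4)}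
    {m : ℕ} (hI : I.card = m + 1) {u : Fin 4 → ℂ} (hu : u ∈ p I) (h0 : ∀ i : Fin 4, i.val < m → u i = 0)
    (h1 : ∀ i : Fin 4, i.val = m → u i = 1) : configVec p I = u := by
  rw [configVec, hI, Nat.add_sub_cancel]
  exact (eq_stdVec (by rw [h.finrank, hI]) (hI ▸ h.generic I) hu h0 h1).symm

/-- The parameters are recovered as edge coordinates, so the three parameters are independent; this
gives the lower bound for the dimension of the core. -/
theorem edgeCoord_normalVertex {t : Fin 3 → ℂ}
    (h : ∀ I, vertexPlucker (normalVertex t) I (initialSet I.card) ≠ 0) :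
    edgeCoord (vertexConfig (normalVertex t)) (vertexEdge 0) = 1 ∧
    edgeCoord (vertexConfig (normalVertex t)) (vertexEdge 1) = t 0 ∧
    edgeCoord (vertexConfig (normalVertex t)) (vertexEdge 2) = t 1 ∧
    edgeCoord (vertexConfig (normalVertex t)) (lineEdge 0) = 1 ∧
    edgeCoord (vertexConfig (normalVertex t)) (lineEdge 1) = t 2 := by
  obtain ⟨hli, hp⟩ := vertexConfig_mem_chartNondeg h
  have hg := isGenericConfig_of_mem_chartNondeg hp
  have hmem : ∀ {i : Fin 4} {I : Finset (Fin 4)}, i ∈ I →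
      normalVertex t i ∈ vertexConfig (normalVertex t) I := fun hi =>
    Submodule.subset_span ⟨_, Finset.mem_coe.2 hi, rfl⟩
  have c1 : ∀ i : Fin 4, configVec (vertexConfig (normalVertex t)) {i} = normalVertex t i := by
    intro i
    refine hg.configVec_eq (m := 0) (by simp) (hmem (Finset.mem_singleton_self i)) (by simp) ?_
    intro j hj
    obtain rfl : j = 0 := Fin.ext hj
    fin_cases i <;> simp [normalVertex]
  have d01 : configVec (vertexConfig (normalVertex t)) {0, 1} = Pi.single 1 1 := by
    have hd : (Pi.single 1 1 : Fin 4 → ℂ) = normalVertex t 1 - normalVertex t 0 := by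
      ext j; fin_cases j <;> simp [normalVertex]
    refine hg.configVec_eq (m := 1) (by decide) ?_ (fun i hi => ?_) fun i hi => ?_
    · rw [hd]
      exact Submodule.sub_mem _ (hmem (by decide)) (hmem (by decide))
    · obtain rfl : i = 0 := Fin.ext (by simp; omega)
      simp
    · obtain rfl : i = 1 := Fin.ext hi
      simp
  -- The line through two vertices contains their difference, which has first coordinate zero; it is
  -- normalized by dividing by `t 0`, nonzero because the vertices are distinct.
  have d02 : configVec (vertexConfig (normalVertex t)) {0, 2} = ![0, 1, 1, 0] := by
    have hne : t 0 ≠ 0 := by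
      intro h0
      refine hli.injective.ne (show (2 : Fin 4) ≠ 0 by decide) ?_
      ext j; fin_cases j <;> simp [normalVertex, h0]
    have hd : (![0, 1, 1, 0] : Fin 4 → ℂ) = (t 0)⁻¹ • (normalVertex t 2 - normalVertex t 0) := by
      ext j; fin_cases j <;> simp [normalVertex, hne]
    refine hg.configVec_eq (m := 1) (by decide) ?_ (fun i hi => ?_) fun i hi => ?_
    · rw [hd]
      exact Submodule.smul_mem _ _ (Submodule.sub_mem _ (hmem (by decide)) (hmem (by decide)))
    · obtain rfl : i = 0 := Fin.ext (by simp; omega)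
      simp
    · obtain rfl : i = 1 := Fin.ext hi
      simp
  have d03 : configVec (vertexConfig (normalVertex t)) {0, 3} = ![0, 1, t 2, t 2] := by
    have hne : t 1 ≠ 0 := by
      intro h0
      refine hli.injective.ne (show (3 : Fin 4) ≠ 0 by decide) ?_
      ext j; fin_cases j <;> simp [normalVertex, h0]
    have hd : (![0, 1, t 2, t 2] : Fin 4 → ℂ) = (t 1)⁻¹ • (normalVertex t 3 - normalVertex t 0) := by
      ext j; fin_cases j <;> simp [normalVertex, hne]
    refine hg.configVec_eq (m := 1) (by decide) ?_ (fun i hi => ?_) fun i hi => ?_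
    · rw [hd]
      exact Submodule.smul_mem _ _ (Submodule.sub_mem _ (hmem (by decide)) (hmem (by decide)))
    · obtain rfl : i = 0 := Fin.ext (by simp; omega)
      simp
    · obtain rfl : i = 1 := Fin.ext hi
      simp
  refine ⟨?_, ?_, ?_, ?_, ?_⟩
  · rw [edgeCoord_eq_configVec _ _ 1 rfl]
    change configVec _ {1} 1 - configVec _ {0} 1 = _
    rw [c1, c1]; simp [normalVertex]
  · rw [edgeCoord_eq_configVec _ _ 1 rfl]
    change configVec _ {2} 1 - configVec _ {0} 1 = _
    rw [c1, c1]; simp [normalVertex]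
  · rw [edgeCoord_eq_configVec _ _ 1 rfl]
    change configVec _ {3} 1 - configVec _ {0} 1 = _
    rw [c1, c1]; simp [normalVertex]
  · rw [edgeCoord_eq_configVec _ _ 2 rfl]
    change configVec _ {0, 2} 2 - configVec _ {0, 1} 2 = _
    rw [d02, d01]; simp
  · rw [edgeCoord_eq_configVec _ _ 2 rfl]
    change configVec _ {0, 3} 2 - configVec _ {0, 1} 2 = _
    rw [d03, d01]; simp

theorem chartNondeg_nonempty : chartNondeg.Nonempty := by
  -- Points on the moment curve: all the minors on initial columns are Vandermonde determinants with
  -- distinct nodes.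
  let v : Fin 4 → Fin 4 → ℂ := fun i j => (i.val : ℂ) ^ j.val
  refine ⟨vertexConfig v, (vertexConfig_mem_chartNondeg fun I => ?_).2⟩
  have h4 := card_le_four I
  rw [vertexPlucker, plucker_of_card (card_initialSet h4)]
  have : (Matrix.of fun r j : Fin I.card => v (I.orderEmbOfFin rfl r)
      ((initialSet I.card).orderEmbOfFin (card_initialSet h4) j)) =
      Matrix.vandermonde fun r => ((I.orderEmbOfFin rfl r).val : ℂ) := by
    ext r j
    rw [Matrix.of_apply, orderEmbOfFin_initialSet h4]
    rfl
  rw [this, Matrix.det_vandermonde_ne_zero_iff]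
  intro r r' hr
  exact (I.orderEmbOfFin rfl).injective (Fin.ext (Nat.cast_injective hr))

/-! ### The parametrization of the core -/

theorem exists_parametrization : ∃ (D : MvPolynomial (Fin 3) ℂ) (X : Edge → (Fin 3 → ℂ) → ℂ),
    (∀ α, IsPolyFun (X α)) ∧ (∃ t, MvPolynomial.eval t D ≠ 0) ∧
    (∀ t, MvPolynomial.eval t D ≠ 0 → (∀ α, X α t ≠ 0) ∧
      X (vertexEdge 1) t = t 0 * X (vertexEdge 0) t ∧ X (vertexEdge 2) t = t 1 * X (vertexEdge 0) t ∧
      X (lineEdge 1) t = t 2 * X (lineEdge 0) t) ∧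
    coreNondeg = {z : ProjProd | ∃ t, MvPolynomial.eval t D ≠ 0 ∧
      (fun i : Σ β : Face, β.Edges => X i.2.1 t) ∈ HomogCoords.rep z} := by
  have hv : ∀ i j, IsPolyFun fun t : Fin 3 → ℂ => normalVertex t i j := by
    have h1 := fun k : Fin 3 => IsPolyFun.coord (σ := Fin 3) k
    have h0 := fun a : ℂ => IsPolyFun.const (σ := Fin 3) a
    intro i j
    fin_cases i <;> fin_cases j
    exacts [h0 1, h0 0, h0 0, h0 0, h0 1, h0 1, h0 0, h0 0, h0 1, h1 0, h1 0, h0 0, h0 1, h1 1,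
      (h1 1).mul (h1 2), (h1 1).mul (h1 2)]
  have hpl : ∀ I A, IsPolyFun fun t => vertexPlucker (normalVertex t) I A := fun I A =>
    plucker_isPolyFun (fun i j => hv _ _) A
  let m : Finset (Fin 4) → (Fin 3 → ℂ) → ℂ := fun I t =>
    vertexPlucker (normalVertex t) I (initialSet I.card)
  obtain ⟨D, hD⟩ := IsPolyFun.prod Finset.univ (F := m) fun I _ => hpl I _
  have hD' : ∀ t, MvPolynomial.eval t D ≠ 0 ↔
      ∀ I, vertexPlucker (normalVertex t) I (initialSet I.card) ≠ 0 := fun t => by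
    rw [hD, Finset.prod_ne_zero_iff]
    simp [m]
  -- The edge coordinate with its denominators cleared: `X α` is `D` times `x_α`, where `D` is the
  -- product of all the initial minors. The common factor has no effect in the `ℙ_β`.
  let X : Edge → (Fin 3 → ℂ) → ℂ := fun α t =>
    vertexPlucker (normalVertex t) α.1.2 (secondSet α.1.1.card) * ∏ I ∈ Finset.univ.erase α.1.2, m I t -
      vertexPlucker (normalVertex t) α.1.1 (secondSet α.1.1.card) * ∏ I ∈ Finset.univ.erase α.1.1, m I t
  have hX : ∀ t, MvPolynomial.eval t D ≠ 0 → ∀ α,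
      X α t = MvPolynomial.eval t D * edgeCoord (vertexConfig (normalVertex t)) α := by
    intro t ht α
    have hm := (hD' t).1 ht
    obtain ⟨hli, -⟩ := vertexConfig_mem_chartNondeg hm
    obtain ⟨k, hk⟩ := α.exists_rank
    have hne1 : initialSet α.1.1.card ≠ ∅ := hk ▸ initialSet_succ_ne_empty _
    have hne2 : secondSet α.1.1.card ≠ ∅ := by
      rw [hk, secondSet_succ]
      exact Finset.insert_ne_empty _ _
    have h1 := hm α.1.1
    have h2 := hm α.1.2
    have e1 : MvPolynomial.eval t D = m α.1.1 t * ∏ I ∈ Finset.univ.erase α.1.1, m I t := by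
      rw [hD, Finset.mul_prod_erase _ (fun I => m I t) (Finset.mem_univ _)]
    have e2 : MvPolynomial.eval t D = m α.1.2 t * ∏ I ∈ Finset.univ.erase α.1.2, m I t := by
      rw [hD, Finset.mul_prod_erase _ (fun I => m I t) (Finset.mem_univ _)]
    rw [edgeCoord, pluckerRatio_eq (vertexPlucker_mem_rep hli _) hne2 hne1,
      pluckerRatio_eq (vertexPlucker_mem_rep hli _) hne2 hne1, mul_sub]
    have f1 : m α.1.1 t = vertexPlucker (normalVertex t) α.1.1 (initialSet α.1.1.card) := rfl
    have f2 : m α.1.2 t = vertexPlucker (normalVertex t) α.1.2 (initialSet α.1.1.card) := by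
      rw [α.2.1]
    rw [α.2.1.symm] at h2
    refine congrArg₂ (· - ·) ?_ ?_
    · rw [e2, f2]
      field_simp
    · rw [e1, f1]
      field_simp
  have hXmem : ∀ t, MvPolynomial.eval t D ≠ 0 → ∀ z : ProjProd,
      (fun i : Σ β : Face, β.Edges => X i.2.1 t) ∈ HomogCoords.rep z ↔
      ∀ β, (z β).submodule =
        Submodule.span ℂ {fun α : β.Edges => edgeCoord (vertexConfig (normalVertex t)) α.1} := by
    intro t ht z
    refine forall_congr' fun β => ?_
    have hne := edgeCoord_face_ne_zero (vertexConfig_mem_chartNondeg ((hD' t).1 ht)).2 β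
    have hsm : (fun α : β.Edges => X α.1 t) = MvPolynomial.eval t D •
        fun α : β.Edges => edgeCoord (vertexConfig (normalVertex t)) α.1 :=
      funext fun α => hX t ht α.1
    refine mem_rep_proj.trans ?_
    change (fun α : β.Edges => X α.1 t) ≠ 0 ∧ _ = Submodule.span ℂ {fun α : β.Edges => X α.1 t} ↔ _
    rw [hsm, Submodule.span_singleton_smul_eq (IsUnit.mk0 _ ht)]
    exact and_iff_right (smul_ne_zero ht hne)
  refine ⟨D, X, fun α => ((hpl _ _).mul (IsPolyFun.prod _ fun I _ => hpl I _)).sub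
    ((hpl _ _).mul (IsPolyFun.prod _ fun I _ => hpl I _)), ?_, fun t ht => ⟨fun α => ?_, ?_⟩, ?_⟩
  · obtain ⟨p, hp⟩ := chartNondeg_nonempty
    obtain ⟨b, t, -, -, ht⟩ := exists_normalVertex hp
    exact ⟨t, (hD' t).2 ht⟩
  · rw [hX t ht]
    exact mul_ne_zero ht (edgeCoord_ne_zero (vertexConfig_mem_chartNondeg ((hD' t).1 ht)).2 α)
  · obtain ⟨h1, h2, h3, h4, h5⟩ := edgeCoord_normalVertex ((hD' t).1 ht)
    simp only [hX t ht, h1, h2, h3, h4, h5]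
    refine ⟨?_, ?_, ?_⟩ <;> ring
  · ext z
    constructor
    · rintro ⟨n, ⟨p, hp, -, h2⟩, rfl⟩
      obtain ⟨b, t, hb, hpt, ht⟩ := exists_normalVertex hp
      have ht' := (hD' t).2 ht
      refine ⟨t, ht', (hXmem t ht' _).2 fun β => ?_⟩
      rw [h2, ← hpt]
      have α₀ := Classical.arbitrary β.Edges
      have hsm : (fun α : β.Edges => edgeCoord (fun I => translate b (p I)) α.1) =
          edgeChar b α₀.1 • fun α : β.Edges => edgeCoord p α.1 := funext fun α => by
        rw [hb.edgeCoord_translate (isGenericConfig_of_mem_chartNondeg hp)]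
        rw [edgeChar_eq b α₀.1.card_eq, edgeChar_eq b (k := α₀.1.rank) (by
          rw [← α₀.1.card_eq, α.2.1.2.2, α₀.2.1.2.2])]
        rfl
      have hne : edgeChar b α₀.1 ≠ 0 := by
        rw [edgeChar_eq b α₀.1.card_eq]
        exact div_ne_zero (hb.diag_ne_zero _) (hb.diag_ne_zero _)
      rw [hsm, Submodule.span_singleton_smul_eq (IsUnit.mk0 _ hne)]
    · rintro ⟨t, ht, hz⟩
      exact ⟨((flagCoord (vertexConfig (normalVertex t)), edgeCoord (vertexConfig (normalVertex t))), z),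
        ⟨_, (vertexConfig_mem_chartNondeg ((hD' t).1 ht)).2, rfl, (hXmem t ht z).1 hz⟩, rfl⟩

end Tetra

namespace Tetra

/-! ### Irreducibility and dimension of parametrized varieties -/

theorem exists_eval_ne_zero {σ : Type} {P : MvPolynomial σ ℂ} (hP : P ≠ 0) :
    ∃ u, MvPolynomial.eval u P ≠ 0 := by
  by_contra! h
  exact hP (MvPolynomial.funext fun u => by rw [h, map_zero])

/-- A closed set that misses a point of the image pulls back into the zero set of a nonzero
polynomial. The product of `D` with two such polynomials is nonzero somewhere, so two proper closed
subsets cannot cover the image. -/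
theorem isIrreducible_of_parametrization {Z σ : Type} [HomogCoords Z] {D : MvPolynomial σ ℂ}
    (hD : D ≠ 0) {h : (σ → ℂ) → HomogCoords.idx Z → ℂ} (hh : ∀ j, IsPolyFun fun u => h u j)
    (hrep : ∀ u, MvPolynomial.eval u D ≠ 0 → ∃ z : Z, h u ∈ HomogCoords.rep z) :
    @IsIrreducible Z (zariski Z)
      {z | ∃ u, MvPolynomial.eval u D ≠ 0 ∧ h u ∈ HomogCoords.rep z} := by
  let _ := zariski Z
  refine ⟨?_, isPreirreducible_iff_isClosed_union_isClosed.2 fun Z₁ Z₂ h₁ h₂ hsub => ?_⟩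
  · obtain ⟨u, hu⟩ := exists_eval_ne_zero hD
    obtain ⟨z, hz⟩ := hrep u hu
    exact ⟨z, u, hu, hz⟩
  have key : ∀ Y : Set Z, IsClosed Y →
      ¬ {z | ∃ u, MvPolynomial.eval u D ≠ 0 ∧ h u ∈ HomogCoords.rep z} ⊆ Y →
      ∃ P : MvPolynomial σ ℂ, P ≠ 0 ∧ ∀ z u, h u ∈ HomogCoords.rep z → z ∈ Y →
        MvPolynomial.eval u P = 0 := by
    intro Y hY hne
    obtain ⟨z, ⟨u, hu, hz⟩, hzY⟩ := Set.not_subset.1 hne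
    obtain ⟨T, hT⟩ := isClosed_zariski.1 hY
    rw [hT z _ hz] at hzY
    push Not at hzY
    obtain ⟨f, hf, hf0⟩ := hzY
    obtain ⟨P, hP⟩ : IsPolyFun fun u => MvPolynomial.eval (h u) f :=
      IsPolyFun.comp ⟨f, fun _ => rfl⟩ hh
    refine ⟨P, ?_, fun z' u' hz' hzY' => ?_⟩
    · rintro rfl
      exact hf0 (by simpa using (hP u).symm)
    · rw [hP]
      exact (hT z' _ hz').1 hzY' f hf
  by_contra! hne
  obtain ⟨P₁, hP₁, hP₁'⟩ := key Z₁ h₁ hne.1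
  obtain ⟨P₂, hP₂, hP₂'⟩ := key Z₂ h₂ hne.2
  obtain ⟨u, hu⟩ := exists_eval_ne_zero (mul_ne_zero (mul_ne_zero hD hP₁) hP₂)
  rw [map_mul, map_mul] at hu
  obtain ⟨z, hz⟩ := hrep u (left_ne_zero_of_mul (left_ne_zero_of_mul hu))
  rcases hsub ⟨u, left_ne_zero_of_mul (left_ne_zero_of_mul hu), hz⟩ with hz' | hz'
  · exact right_ne_zero_of_mul (left_ne_zero_of_mul hu) (hP₁' z u hz hz')
  · exact right_ne_zero_of_mul hu (hP₂' z u hz hz')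

/-! ### Krull dimension of finitely generated algebras -/

theorem trdeg_localizationAway {n : ℕ} {Q : MvPolynomial (Fin n) ℂ} (hQ : Q ≠ 0) :
    Algebra.trdeg ℂ (Localization.Away Q) = n := by
  have hle : Submonoid.powers Q ≤ nonZeroDivisors (MvPolynomial (Fin n) ℂ) :=
    powers_le_nonZeroDivisors_of_noZeroDivisors hQ
  have : IsDomain (Localization.Away Q) := IsLocalization.isDomain_localization hle
  have hinj : Function.Injective (algebraMap (MvPolynomial (Fin n) ℂ) (Localization.Away Q)) :=
    IsLocalization.injective _ hle
  have : FaithfulSMul (MvPolynomial (Fin n) ℂ) (Localization.Away Q) :=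
    (faithfulSMul_iff_algebraMap_injective _ _).2 hinj
  have : Algebra.IsAlgebraic (MvPolynomial (Fin n) ℂ) (Localization.Away Q) :=
    IsLocalization.isAlgebraic _ (Submonoid.powers Q)
  rw [← _root_.trdeg_add_eq ℂ (MvPolynomial (Fin n) ℂ) (A := Localization.Away Q),
    _root_.trdeg_eq_zero (R := MvPolynomial (Fin n) ℂ), add_zero, MvPolynomial.trdeg_of_isDomain]
  simp

/-- Noether normalization makes `R` integral over a polynomial ring in `s` variables. Its embedding
into `L` bounds `s` by the transcendence degree, and incomparability of primes in integral
extensions bounds the dimension by `s`. -/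
theorem ringKrullDim_le_of_injective {R L : Type} [CommRing R] [Nontrivial R] [Algebra ℂ R]
    [Algebra.FiniteType ℂ R] [CommRing L] [Algebra ℂ L] {n : ℕ} (hL : Algebra.trdeg ℂ L = n)
    (f : R →ₐ[ℂ] L) (hf : Function.Injective f) : ringKrullDim R ≤ n := by
  obtain ⟨s, g, hg, hint⟩ := exists_integral_inj_algHom_of_fg ℂ R
  have hs : s ≤ n := by
    have := _root_.trdeg_le_of_injective (f.comp g) (hf.comp hg)
    rw [hL, MvPolynomial.trdeg_of_isDomain] at this
    simpa using this
  let _ : Algebra (MvPolynomial (Fin s) ℂ) R := g.toRingHom.toAlgebra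
  have : Algebra.IsIntegral (MvPolynomial (Fin s) ℂ) R := ⟨hint⟩
  have h1 : ringKrullDim R ≤ ringKrullDim (MvPolynomial (Fin s) ℂ) :=
    Order.krullDim_le_of_strictMono (PrimeSpectrum.comap (algebraMap (MvPolynomial (Fin s) ℂ) R))
      fun p q hpq => Ideal.IsIntegral.comap_lt_comap (I := p.asIdeal) (J := q.asIdeal) hpq
  refine h1.trans ?_
  rw [MvPolynomial.ringKrullDim_of_isNoetherianRing, ringKrullDim_eq_zero_of_field, zero_add,
    Nat.card_fin]
  exact_mod_cast hs

end Tetra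

namespace Tetra

/-! ### The dimension of parametrized subvarieties of products of projective spaces -/

section Parametrized

variable {ι : Type} {E : ι → Type}

/-- Normalization of the coordinate vectors by the coordinates `γ i`. -/
noncomputable def normCoord (γ : ∀ i, E i) (c : (Σ i, E i) → ℂ) : (Σ i, E i) → ℂ :=
  fun j => c j * (c ⟨j.1, γ j.1⟩)⁻¹

theorem normCoord_mem_rep {γ : ∀ i, E i} {z : ∀ i, ℙ ℂ (E i → ℂ)} {c : (Σ i, E i) → ℂ}
    (hc : c ∈ HomogCoords.rep z) (h : ∀ i, c ⟨i, γ i⟩ ≠ 0) : normCoord γ c ∈ HomogCoords.rep z := by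
  intro i
  refine ⟨fun h0 => ?_, ?_⟩
  · have := congrFun h0 (γ i)
    exact mul_ne_zero (h i) (inv_ne_zero (h i)) this
  · have h1 : (fun j => normCoord γ c ⟨i, j⟩) = (c ⟨i, γ i⟩)⁻¹ • fun j => c ⟨i, j⟩ :=
      funext fun j => mul_comm _ _
    exact h1 ▸ Submodule.smul_mem _ _ (hc i).2

theorem exists_smul_of_mem_rep {z : ∀ i, ℙ ℂ (E i → ℂ)} {c c' : (Σ i, E i) → ℂ}
    (hc : c ∈ HomogCoords.rep z) (hc' : c' ∈ HomogCoords.rep z) :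
    ∃ a : ι → ℂ, (∀ i, a i ≠ 0) ∧ ∀ j, c' j = a j.1 * c j := by
  have h : ∀ i, ∃ a : ℂ, ∀ j, c' ⟨i, j⟩ = a * c ⟨i, j⟩ := fun i => by
    have h1 := (hc' i).2
    rw [(mem_rep_proj.1 (hc i)).2, Submodule.mem_span_singleton] at h1
    obtain ⟨a, ha⟩ := h1
    exact ⟨a, fun j => (congrFun ha j).symm⟩
  choose a ha using h
  refine ⟨a, fun i h0 => (hc' i).1 (funext fun j => ?_), fun j => ha j.1 j.2⟩
  beta_reduce
  rw [ha, h0, zero_mul]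
  rfl

theorem normCoord_eq_of_mem_rep (γ : ∀ i, E i) {z : ∀ i, ℙ ℂ (E i → ℂ)} {c c' : (Σ i, E i) → ℂ}
    (hc : c ∈ HomogCoords.rep z) (hc' : c' ∈ HomogCoords.rep z) :
    normCoord γ c' = normCoord γ c := by
  obtain ⟨a, ha, h⟩ := exists_smul_of_mem_rep hc hc'
  funext j
  rw [normCoord, normCoord, h, h, mul_inv, mul_mul_mul_comm, mul_inv_cancel₀ (ha j.1), one_mul]

theorem apply_ne_zero_of_mem_rep {z : ∀ i, ℙ ℂ (E i → ℂ)} {c c' : (Σ i, E i) → ℂ}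
    (hc : c ∈ HomogCoords.rep z) (hc' : c' ∈ HomogCoords.rep z) {j : Σ i, E i} (h : c j ≠ 0) :
    c' j ≠ 0 := by
  obtain ⟨a, ha, h'⟩ := exists_smul_of_mem_rep hc hc'
  rw [h']
  exact mul_ne_zero (ha _) h

/-- Polynomials whose value at the normalized coordinates vanishes on `W`. -/
def normIdeal (γ : ∀ i, E i) (W : Set (∀ i, ℙ ℂ (E i → ℂ))) : Ideal (MvPolynomial (Σ i, E i) ℂ) where
  carrier := {f | ∀ z ∈ W, ∀ c ∈ HomogCoords.rep z, (∀ i, c ⟨i, γ i⟩ ≠ 0) →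
    MvPolynomial.eval (normCoord γ c) f = 0}
  zero_mem' := fun z _ c _ _ => map_zero _
  add_mem' := fun hf hg z hz c hc h => by rw [map_add, hf z hz c hc h, hg z hz c hc h, add_zero]
  smul_mem' := fun a f hf z hz c hc h => by rw [smul_eq_mul, map_mul, hf z hz c hc h, mul_zero]

theorem mem_normIdeal {γ : ∀ i, E i} {W : Set (∀ i, ℙ ℂ (E i → ℂ))}
    {f : MvPolynomial (Σ i, E i) ℂ} : f ∈ normIdeal γ W ↔ ∀ z ∈ W, ∀ c ∈ HomogCoords.rep z,
      (∀ i, c ⟨i, γ i⟩ ≠ 0) → MvPolynomial.eval (normCoord γ c) f = 0 := Iff.rfl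

variable [Fintype ι]

/-- The product of the coordinates `γ i`. -/
noncomputable def normDenom (γ : ∀ i, E i) : MvPolynomial (Σ i, E i) ℂ :=
  ∏ i, MvPolynomial.X ⟨i, γ i⟩

theorem eval_normDenom_ne_zero {γ : ∀ i, E i} {c : (Σ i, E i) → ℂ} :
    MvPolynomial.eval c (normDenom γ) ≠ 0 ↔ ∀ i, c ⟨i, γ i⟩ ≠ 0 := by
  simp [normDenom, map_prod, Finset.prod_ne_zero_iff]

theorem isRat_normCoord (γ : ∀ i, E i) (j : Σ i, E i) :
    IsRat (normDenom γ) fun c => normCoord γ c j := by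
  have h : (MvPolynomial.X ⟨j.1, γ j.1⟩ : MvPolynomial (Σ i, E i) ℂ) ∣ normDenom γ :=
    Finset.dvd_prod_of_mem _ (Finset.mem_univ j.1)
  exact ((IsPolyFun.coord j).isRat _).mul (by simpa using IsRat.inv_of_dvd h)

theorem isZariskiClosed_normCoord (γ : ∀ i, E i) (V : Set (∀ i, ℙ ℂ (E i → ℂ)))
    (f : MvPolynomial (Σ i, E i) ℂ) :
    IsZariskiClosed {z : V | f ∈ normIdeal γ {z.1}} := by
  obtain ⟨F, n, hF⟩ := IsRat.comp (isRat_normCoord γ) f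
  beta_reduce at hF
  have h := isZariskiClosed_eval_eq_zero (X := V) {normDenom γ * F}
  convert h using 1
  ext z
  simp only [Set.mem_ofPred_eq, mem_normIdeal, Set.mem_singleton_iff, forall_eq]
  refine forall_congr' fun c => forall_congr' fun hc => ?_
  rw [map_mul, mul_eq_zero, or_iff_not_imp_left]
  change _ ↔ (MvPolynomial.eval c (normDenom γ) ≠ 0 → _)
  refine ⟨fun hz h0 => ?_, fun hz h0 => ?_⟩
  · have := hz (eval_normDenom_ne_zero.1 h0)
    rw [hF c h0, div_eq_zero_iff] at this
    exact this.resolve_right (pow_ne_zero _ h0)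
  · have h1 := eval_normDenom_ne_zero.2 h0
    rw [hF c h1, hz h1, zero_div]

/-- This is the ideal of the part of `W` in an affine chart. It is prime because `W` is irreducible
and meets the chart at `z₀`. -/
theorem normIdeal_isPrime {γ : ∀ i, E i} {V : Set (∀ i, ℙ ℂ (E i → ℂ))} {W : Set V}
    (hW : @IsIrreducible V (zariski V) W) {z₀ : V} (hz₀ : z₀ ∈ W)
    {c₀ : (Σ i, E i) → ℂ} (hc₀ : c₀ ∈ HomogCoords.rep z₀.1) (h₀ : ∀ i, c₀ ⟨i, γ i⟩ ≠ 0) :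
    (normIdeal γ (Subtype.val '' W)).IsPrime := by
  let _ := zariski V
  refine ⟨fun h => ?_, fun {f g} hfg => ?_⟩
  · have := mem_normIdeal.1 ((Ideal.eq_top_iff_one _).1 h) z₀.1 ⟨z₀, hz₀, rfl⟩ c₀ hc₀ h₀
    rw [map_one] at this
    exact one_ne_zero this
  · have h1 := isPreirreducible_iff_isClosed_union_isClosed.1 hW.2 _ _
      (isClosed_zariski.2 (isZariskiClosed_normCoord γ V f))
      (isClosed_zariski.2 (isZariskiClosed_normCoord γ V g)) fun z hz => by
        by_contra hne
        simp only [Set.mem_union, Set.mem_ofPred_eq, mem_normIdeal, Set.mem_singleton_iff, forall_eq,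
          not_or] at hne
        push Not at hne
        obtain ⟨⟨c, hc, hc0, hcf⟩, ⟨d, hd, hd0, hdg⟩⟩ := hne
        have := mem_normIdeal.1 hfg z.1 ⟨z, hz, rfl⟩ c hc hc0
        rw [normCoord_eq_of_mem_rep γ hc hd] at hdg
        rw [map_mul] at this
        exact mul_ne_zero hcf hdg this
    refine h1.imp ?_ ?_ <;>
    · rintro h _ ⟨z, hz, rfl⟩ c hc hc0
      exact h hz z.1 rfl c hc hc0

/-- If the ideals agreed, the part of `W'` in the chart would lie in `W`. Then `W'` would be covered
by `W` and the complement of the chart, and irreducibility excludes both. -/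
theorem normIdeal_lt {γ : ∀ i, E i} {V : Set (∀ i, ℙ ℂ (E i → ℂ))} {W W' : Set V}
    (hWW : W ⊆ W') (hne : ¬ W' ⊆ W) (hcl : IsZariskiClosed W)
    (hW' : @IsIrreducible V (zariski V) W') {z₀ : V} (hz₀ : z₀ ∈ W)
    {c₀ : (Σ i, E i) → ℂ} (hc₀ : c₀ ∈ HomogCoords.rep z₀.1) (h₀ : ∀ i, c₀ ⟨i, γ i⟩ ≠ 0) :
    normIdeal γ (Subtype.val '' W') < normIdeal γ (Subtype.val '' W) := by
  let _ := zariski V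
  refine lt_of_le_not_ge (fun f hf z hz => hf z (Set.image_mono hWW hz)) fun hle => ?_
  have h1 := isPreirreducible_iff_isClosed_union_isClosed.1 hW'.2 _ _ (isClosed_zariski.2 hcl)
    -- The constant `1` belongs to the ideal of a point exactly when the point lies outside the
    -- chart, so this set is the complement of the chart.
    (isClosed_zariski.2 (isZariskiClosed_normCoord γ V 1)) fun z hz => by
      rw [Set.mem_union, or_iff_not_imp_right]
      intro hz1
      simp only [Set.mem_ofPred_eq, mem_normIdeal, Set.mem_singleton_iff, forall_eq] at hz1
      push Not at hz1
      obtain ⟨c, hc, hc0, -⟩ := hz1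
      obtain ⟨T, hT⟩ := hcl
      refine (hT z _ (normCoord_mem_rep hc hc0)).2 fun f hf => ?_
      refine hle (?_ : f ∈ normIdeal γ (Subtype.val '' W)) z.1 ⟨z, hz, rfl⟩ c hc hc0
      rintro _ ⟨w, hw, rfl⟩ d hd hd0
      exact (hT w _ (normCoord_mem_rep hd hd0)).1 hw f hf
  rcases h1 with h1 | h1
  · exact hne h1
  · have := h1 (hWW hz₀) z₀.1 rfl c₀ hc₀ h₀
    rw [map_one] at this
    exact one_ne_zero this

/-- Pullback of the normalized coordinates along the parametrization. A polynomial in the kernel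
vanishes on the image, hence on its closure wherever the normalization is defined. -/
theorem exists_algHom_of_parametrization {n : ℕ} {P : (Σ i, E i) → MvPolynomial (Fin n) ℂ}
    {γ : ∀ i, E i} {V : Set (∀ i, ℙ ℂ (E i → ℂ))}
    {D : MvPolynomial (Fin n) ℂ}
    (hD : ∀ t j, MvPolynomial.eval t D ≠ 0 → MvPolynomial.eval t (P j) ≠ 0)
    (hV : ∀ z ∈ V, z ∈ @closure _ (zariski _) {z : ∀ i, ℙ ℂ (E i → ℂ) |
      ∃ t, MvPolynomial.eval t D ≠ 0 ∧ (fun j => MvPolynomial.eval t (P j)) ∈ HomogCoords.rep z}) :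
    ∃ φ : MvPolynomial (Σ i, E i) ℂ →ₐ[ℂ] Localization.Away (∏ i, P ⟨i, γ i⟩),
      ∀ W ⊆ V, RingHom.ker φ ≤ normIdeal γ W := by
  set Q := ∏ i, P ⟨i, γ i⟩ with hQdef
  have hu : ∀ i, ∃ u : Localization.Away Q, algebraMap _ _ (P ⟨i, γ i⟩) * u = 1 := fun i => by
    have h1 : IsUnit (algebraMap _ (Localization.Away Q) Q) :=
      IsLocalization.Away.algebraMap_isUnit Q
    have h2 : P ⟨i, γ i⟩ ∣ Q := Finset.dvd_prod_of_mem _ (Finset.mem_univ i)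
    exact (isUnit_of_dvd_unit (map_dvd _ h2) h1).exists_right_inv
  choose u hu using hu
  refine ⟨MvPolynomial.aeval fun j => algebraMap _ _ (P j) * u j.1, fun W hW f hf z hz c hc hc0 => ?_⟩
  refine IsRat.eq_zero_of_mem_closure (hV z (hW hz)) (IsRat.comp (isRat_normCoord γ) f) ?_ hc
    (eval_normDenom_ne_zero.2 hc0)
  rintro y ⟨t, ht, hy⟩ d hd -
  rw [normCoord_eq_of_mem_rep γ hy hd]
  have hQt : IsUnit (MvPolynomial.eval t Q) := by
    rw [isUnit_iff_ne_zero, hQdef, map_prod, Finset.prod_ne_zero_iff]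
    exact fun i _ => hD t _ ht
  let e : Localization.Away Q →+* ℂ := IsLocalization.Away.lift Q hQt
  have he : ∀ p, e (algebraMap _ _ p) = MvPolynomial.eval t p :=
    fun p => IsLocalization.Away.lift_eq Q hQt p
  have heu : ∀ i, e (u i) = (MvPolynomial.eval t (P ⟨i, γ i⟩))⁻¹ := fun i => by
    have := congrArg e (hu i)
    rw [map_mul, he, map_one] at this
    exact eq_inv_of_mul_eq_one_right this
  have h1 := congrArg e hf
  rw [map_zero] at h1
  rw [← h1]
  have h2 : ∀ p : MvPolynomial (Σ i, E i) ℂ,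
      MvPolynomial.eval (normCoord γ fun j => MvPolynomial.eval t (P j)) p =
        e (MvPolynomial.aeval (fun j => algebraMap _ _ (P j) * u j.1) p) := fun p => by
    induction p using MvPolynomial.induction_on with
    | C a =>
      rw [MvPolynomial.eval_C, MvPolynomial.aeval_C,
        IsScalarTower.algebraMap_apply ℂ (MvPolynomial (Fin n) ℂ), he]
      simp
    | add p q hp hq => simp only [map_add, hp, hq]
    | mul_X p j hp =>
      rw [map_mul, map_mul, map_mul, hp, MvPolynomial.eval_X, MvPolynomial.aeval_X, map_mul, he, heu]
      rfl
  exact h2 f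

/-- All members of a chain contain a point of the smallest one, so an affine chart around that point
meets them all. The chain then becomes a chain of primes in an algebra that embeds into a
localization of a polynomial ring in `n` variables. -/
theorem topologicalKrullDim_le_of_parametrization [∀ i, Finite (E i)] {n : ℕ}
    {V : Set (∀ i, ℙ ℂ (E i → ℂ))} {X : (Σ i, E i) → (Fin n → ℂ) → ℂ}
    (hX : ∀ j, IsPolyFun (X j)) {D : MvPolynomial (Fin n) ℂ} (hD0 : ∃ t, MvPolynomial.eval t D ≠ 0)
    (hD : ∀ t j, MvPolynomial.eval t D ≠ 0 → X j t ≠ 0)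
    (hV : ∀ z ∈ V, z ∈ @closure _ (zariski _) {z : ∀ i, ℙ ℂ (E i → ℂ) |
      ∃ t, MvPolynomial.eval t D ≠ 0 ∧ (fun j => X j t) ∈ HomogCoords.rep z}) :
    @topologicalKrullDim V (zariski V) ≤ n := by
  let _ := zariski V
  choose P hP using hX
  obtain rfl : X = fun j t => MvPolynomial.eval t (P j) := funext₂ fun j t => (hP j t).symm
  refine iSup_le fun p => ?_
  obtain ⟨z₀, hz₀⟩ := p.head.isIrreducible'.1
  obtain ⟨c₀, hc₀⟩ := HomogTorsor.nonempty z₀.1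
  have hγ : ∀ i, ∃ j, c₀ ⟨i, j⟩ ≠ 0 := fun i => Function.ne_iff.1 (hc₀ i).1
  choose γ hγ using hγ
  have hQ : ∏ i, P ⟨i, γ i⟩ ≠ 0 := by
    rw [Finset.prod_ne_zero_iff]
    rintro i - h0
    obtain ⟨t, ht⟩ := hD0
    exact hD t ⟨i, γ i⟩ ht (by beta_reduce; rw [h0, map_zero])
  obtain ⟨φ, hφ⟩ := exists_algHom_of_parametrization (γ := γ) hD hV
  have hmem : ∀ k, z₀ ∈ (p k).carrier := fun k => p.monotone (Fin.zero_le k) hz₀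
  have hprime : ∀ k, (normIdeal γ (Subtype.val '' (p k).carrier)).IsPrime := fun k =>
    normIdeal_isPrime (p k).isIrreducible' (hmem k) hc₀ hγ
  -- Larger subvarieties have smaller ideals, so the chain is read backwards.
  let q : LTSeries (PrimeSpectrum.zeroLocus (RingHom.ker φ : Set (MvPolynomial (Σ i, E i) ℂ))) :=
    LTSeries.mk p.length
      (fun k => ⟨⟨normIdeal γ (Subtype.val '' (p k.rev).carrier), hprime _⟩,
        hφ _ (by rintro _ ⟨z, _, rfl⟩; exact z.2)⟩)
      fun k l hkl => by
        have h1 : p l.rev < p k.rev := p.strictMono (Fin.rev_lt_rev.2 hkl)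
        exact normIdeal_lt h1.le (fun h => h1.not_ge h) (isClosed_zariski.1 (p l.rev).isClosed')
          (p k.rev).isIrreducible' (hmem _) hc₀ hγ
  have h1 : (p.length : WithBot ℕ∞) ≤ _ := Order.LTSeries.length_le_krullDim q
  refine h1.trans ?_
  rw [← ringKrullDim_quotient]
  have : Nontrivial (MvPolynomial (Σ i, E i) ℂ ⧸ RingHom.ker φ) := by
    have h2 : RingHom.ker φ ≠ ⊤ := fun h => (hprime 0).ne_top
      (top_le_iff.1 (h ▸ hφ _ (by rintro _ ⟨z, _, rfl⟩; exact z.2)))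
    exact Ideal.Quotient.nontrivial_iff.2 h2
  exact ringKrullDim_le_of_injective (trdeg_localizationAway hQ) (Ideal.kerLiftAlg φ)
    (Ideal.kerLiftAlg_injective φ)

end Parametrized

end Tetra

/-! ### A lower bound for the dimension, and the geometry of the core. -/

namespace Tetra

/-- Let the parameters loose one at a time, keeping the others at the values of `t₀`. The ratio of
the coordinates `b k` and `a k` is the parameter `t k`, and it stays constant on the closure of a
stage where that parameter is frozen; so the closures grow strictly. -/
theorem le_topologicalKrullDim_of_parametrization {Z : Type} [HomogCoords Z] [HomogTorsor Z] {n : ℕ}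
    {D : MvPolynomial (Fin n) ℂ} (hD : ∃ t, MvPolynomial.eval t D ≠ 0)
    {h : (Fin n → ℂ) → HomogCoords.idx Z → ℂ} (hh : ∀ j, IsPolyFun fun t => h t j)
    (hrep : ∀ t, MvPolynomial.eval t D ≠ 0 → ∃ z : Z, h t ∈ HomogCoords.rep z)
    (a b : Fin n → HomogCoords.idx Z)
    (hsc : ∀ (z : Z), ∀ c ∈ HomogCoords.rep z, ∀ d ∈ HomogCoords.rep z, ∀ (k : Fin n) (s : ℂ),
      c (b k) = s * c (a k) → d (b k) = s * d (a k))
    (hab : ∀ t, MvPolynomial.eval t D ≠ 0 → ∀ k, h t (b k) = t k * h t (a k) ∧ h t (a k) ≠ 0) :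
    n ≤ @topologicalKrullDim Z (zariski Z) := by
  let _ := zariski Z
  obtain ⟨t₀, ht₀⟩ := hD
  let A : Fin (n + 1) → (Fin n → ℂ) → Fin n → ℂ := fun k u i => if i.castSucc < k then u i else t₀ i
  have hA : ∀ k i, IsPolyFun fun u => A k u i := fun k i => by
    by_cases hi : i.castSucc < k
    · simpa only [A, if_pos hi] using IsPolyFun.coord i
    · simpa only [A, if_neg hi] using IsPolyFun.const (t₀ i)
  have hD' : ∀ k, IsPolyFun fun u => MvPolynomial.eval (A k u) D :=
    fun k => IsPolyFun.comp ⟨D, fun _ => rfl⟩ (hA k)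
  choose D' hD' using hD'
  beta_reduce at hD'
  have hD0 : ∀ k, D' k ≠ 0 := fun k h0 => by
    have h1 := hD' k t₀
    have h2 : A k t₀ = t₀ := funext fun i => ite_self _
    rw [h0, map_zero, h2] at h1
    exact ht₀ h1.symm
  let S : Fin (n + 1) → Set Z := fun k =>
    {z | ∃ u, MvPolynomial.eval u (D' k) ≠ 0 ∧ h (A k u) ∈ HomogCoords.rep z}
  have hirr : ∀ k, IsIrreducible (S k) := fun k =>
    isIrreducible_of_parametrization (hD0 k) (fun j => (hh j).comp (hA k)) fun u hu =>
      hrep _ (by rwa [← hD'])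
  have hmono : ∀ k : Fin n, S k.castSucc ⊆ S k.succ := by
    rintro k z ⟨u, hu, hz⟩
    have h1 : A k.succ (A k.castSucc u) = A k.castSucc u := funext fun i => by
      simp only [A]
      by_cases h3 : i.castSucc < k.succ
      · rw [if_pos h3]
      · rw [if_neg h3, if_neg fun h4 => h3 (h4.trans k.castSucc_lt_succ)]
    refine ⟨A k.castSucc u, ?_, by rwa [h1]⟩
    rwa [hD', h1, ← hD']
  have hnot : ∀ k : Fin n, ¬ S k.succ ⊆ closure (S k.castSucc) := by
    intro k hsub
    have hk : (MvPolynomial.X k - MvPolynomial.C (t₀ k) : MvPolynomial (Fin n) ℂ) ≠ 0 := fun h0 => by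
      have := congrArg (MvPolynomial.eval (t₀ + 1)) h0
      simp at this
    -- An admissible parameter whose `k`-th entry differs from the frozen value; its image violates
    -- the equation that holds on the previous stage.
    obtain ⟨u, hu⟩ := exists_eval_ne_zero (mul_ne_zero (hD0 k.succ) hk)
    rw [map_mul] at hu
    have hu1 := left_ne_zero_of_mul hu
    have hu2 : u k - t₀ k ≠ 0 := by simpa using right_ne_zero_of_mul hu
    have hu3 : MvPolynomial.eval (A k.succ u) D ≠ 0 := by rwa [← hD']
    obtain ⟨z, hz⟩ := hrep _ hu3
    have h2 := eval_eq_zero_of_mem_closure (hsub ⟨u, hu1, hz⟩)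
      (f := MvPolynomial.X (b k) - MvPolynomial.C (t₀ k) * MvPolynomial.X (a k)) (by
        rintro y ⟨v, hv, hy⟩ d hd
        have h3 := (hab (A k.castSucc v) (by rwa [← hD']) k).1
        have h4 : A k.castSucc v k = t₀ k := if_neg (lt_irrefl _)
        rw [h4] at h3
        simp [hsc y _ hy d hd k _ h3]) _ hz
    simp only [map_sub, map_mul, MvPolynomial.eval_X, MvPolynomial.eval_C] at h2
    rw [(hab _ hu3 k).1, ← sub_mul] at h2
    have h3 : A k.succ u k = u k := if_pos k.castSucc_lt_succ
    rw [h3] at h2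
    exact mul_ne_zero hu2 (hab _ hu3 k).2 h2
  let p : LTSeries (TopologicalSpace.IrreducibleCloseds Z) := LTSeries.mk n
    (fun k => ⟨closure (S k), (hirr k).closure, isClosed_closure⟩)
    (Fin.strictMono_iff_lt_succ.2 fun k => lt_of_le_not_ge (closure_mono (hmono k))
      fun hle => hnot k (subset_closure.trans hle))
  exact Order.LTSeries.length_le_krullDim p

/-! ### The core -/

instance : Finite Face :=
  Finite.of_injective (β := Finset (Fin 4) × Finset (Fin 4) × Fin 5)
    (fun β => (β.lower, β.upper, ⟨β.rank, β.lt_upper.trans_le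
      ((Finset.card_le_univ β.upper).trans (by simp))⟩)) fun β β' h => by
    obtain ⟨A, B, k, _, _, _, _⟩ := β
    obtain ⟨A', B', k', _, _, _, _⟩ := β'
    simp only [Prod.mk.injEq, Fin.mk.injEq] at h
    obtain ⟨rfl, rfl, rfl⟩ := h
    rfl

noncomputable instance : Fintype Face := Fintype.ofFinite Face

/-- The edges that give the three coordinates of the parametrization of the core, paired with the
edges that they are compared to. -/
def coreEdges (k : Fin 3) : (Σ β : Face, β.Edges) × (Σ β : Face, β.Edges) :=
  ![(⟨hypersimplex 0, vertexEdge 0, by decide⟩, ⟨hypersimplex 0, vertexEdge 1, by decide⟩),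
    (⟨hypersimplex 0, vertexEdge 0, by decide⟩, ⟨hypersimplex 0, vertexEdge 2, by decide⟩),
    (⟨hypersimplex 1, lineEdge 0, by decide⟩, ⟨hypersimplex 1, lineEdge 1, by decide⟩)] k

theorem coreEdges_fst (k : Fin 3) : (coreEdges k).1.1 = (coreEdges k).2.1 := by
  fin_cases k <;> rfl

theorem exists_mem_rep_of_ne_zero {c : (Σ β : Face, β.Edges) → ℂ} (hc : ∀ i, c i ≠ 0) :
    ∃ z : ProjProd, c ∈ HomogCoords.rep z := by
  have h : ∀ β : Face, (fun α : β.Edges => c ⟨β, α⟩) ≠ 0 := fun β h0 =>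
    (Face.nonempty_edges β).elim fun α => hc ⟨β, α⟩ (congrFun h0 α)
  exact ⟨fun β => Projectivization.mk ℂ _ (h β), fun β => ⟨h β, by
    rw [Projectivization.submodule_mk]
    exact Submodule.mem_span_singleton_self _⟩⟩

theorem coreNondeg_subset_core : coreNondeg ⊆ core := by
  rw [core_eq_closure]
  exact @subset_closure ProjProd (zariski ProjProd) _

theorem exists_mem_core_of_parametrization {n : ℕ} {D : MvPolynomial (Fin n) ℂ}
    {X : Edge → (Fin n → ℂ) → ℂ}
    (hcore : coreNondeg = {z : ProjProd | ∃ t, MvPolynomial.eval t D ≠ 0 ∧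
      (fun i : Σ β : Face, β.Edges => X i.2.1 t) ∈ HomogCoords.rep z})
    {t : Fin n → ℂ} (h0 : ∀ α, X α t ≠ 0) (ht : MvPolynomial.eval t D ≠ 0) :
    ∃ z : core, (fun i : Σ β : Face, β.Edges => X i.2.1 t) ∈ HomogCoords.rep z := by
  obtain ⟨z, hz⟩ := exists_mem_rep_of_ne_zero
    (c := fun i : Σ β : Face, β.Edges => X i.2.1 t) fun i => h0 i.2.1
  exact ⟨⟨z, coreNondeg_subset_core (hcore ▸ ⟨t, ht, hz⟩)⟩, hz⟩

theorem topologicalKrullDim_core : @topologicalKrullDim core (zariski core) = 3 := by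
  obtain ⟨D, X, hX, hD, hDX, hcore⟩ := exists_parametrization
  have hrep := fun t ht => exists_mem_core_of_parametrization hcore (hDX t ht).1 ht
  apply le_antisymm
  · refine topologicalKrullDim_le_of_parametrization (n := 3)
      (X := fun i : Σ β : Face, β.Edges => X i.2.1) (fun i => hX i.2.1) hD
      (fun t i ht => (hDX t ht).1 i.2.1) fun z hz => ?_
    rwa [core_eq_closure, hcore] at hz
  · refine le_topologicalKrullDim_of_parametrization (Z := core) (n := 3) hD
      (h := fun t i => X i.2.1 t) (fun i => hX i.2.1) hrep
      (fun k => (coreEdges k).1) (fun k => (coreEdges k).2) ?_ fun t ht k => ⟨?_, (hDX t ht).1 _⟩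
    · intro z c hc d hd k s h
      obtain ⟨a, -, ha⟩ := exists_smul_of_mem_rep (z := z.1) hc hd
      rw [ha, ha, h, coreEdges_fst, mul_left_comm]
    · obtain ⟨-, h1, h2, h3⟩ := hDX t ht
      fin_cases k
      exacts [h1, h2, h3]

theorem irreducibleSpace_core : @IrreducibleSpace core (zariski core) := by
  obtain ⟨D, X, hX, hD, hDX, hcore⟩ := exists_parametrization
  have hD0 : D ≠ 0 := by
    rintro rfl
    obtain ⟨t, ht⟩ := hD
    exact ht (map_zero _)
  have hrep := fun t ht => exists_mem_core_of_parametrization hcore (hDX t ht).1 ht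
  let _ := zariski core
  rw [irreducibleSpace_def, ← (?_ : closure {z : core | ∃ t, MvPolynomial.eval t D ≠ 0 ∧
    (fun i : Σ β : Face, β.Edges => X i.2.1 t) ∈ HomogCoords.rep z.1} = (⊤ : Set core))]
  · exact (isIrreducible_of_parametrization (Z := core) (h := fun t (i : Σ β : Face, β.Edges) => X i.2.1 t)
      hD0 (fun i => hX i.2.1) hrep).closure
  · refine Set.eq_univ_of_forall fun z => ?_
    obtain ⟨c, hc⟩ := HomogTorsor.nonempty z
    refine mem_closure_of_eval_eq_zero hc fun f hf => ?_
    have hz := core_eq_closure.subset z.2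
    refine eval_eq_zero_of_mem_closure hz (fun y hy d hd => ?_) c hc
    rw [hcore] at hy
    obtain ⟨t, ht, hy⟩ := hy
    exact hf ⟨y, coreNondeg_subset_core (hcore ▸ ⟨t, ht, hy⟩)⟩ ⟨t, ht, hy⟩ d hd

end Tetra

namespace Tetra

/-! ### Regular local rings and hypersurface sections -/

section RegularLocalRing

variable {S R : Type} [CommRing S] [CommRing R] [IsLocalRing S] {ψ : S →+* R} {t : S}

open IsLocalRing

theorem map_maximalIdeal_of_surjective [IsLocalRing R] (hψ : Function.Surjective ψ) :
    (maximalIdeal S).map ψ = maximalIdeal R := by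
  have := IsLocalHom.of_surjective ψ hψ
  refine le_antisymm (((local_hom_TFAE ψ).out 0 2).1 this) fun r hr => ?_
  obtain ⟨s, rfl⟩ := hψ r
  refine Ideal.mem_map_of_mem ψ ?_
  rw [mem_maximalIdeal, mem_nonunits_iff] at hr ⊢
  exact fun hs => hr (hs.map ψ)

theorem ringKrullDim_add_one_of_ker_eq_span [IsNoetherianRing S] (hψ : Function.Surjective ψ)
    (hker : RingHom.ker ψ = Ideal.span {t}) (ht : t ∈ nonZeroDivisors S)
    (htm : t ∈ maximalIdeal S) : ringKrullDim R + 1 = ringKrullDim S := by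
  rw [← ringKrullDim_quotient_span_singleton_succ_eq_ringKrullDim_of_mem_nonZeroDivisors ht htm,
    ← hker, ringKrullDim_eq_of_ringEquiv (RingHom.quotientKerEquivOfSurjective hψ)]

variable [IsLocalRing R]

/-- Lifts of generators of the maximal ideal of `R`, together with `t`, generate that of `S`. -/
theorem spanFinrank_maximalIdeal_le [IsNoetherianRing R] (hψ : Function.Surjective ψ)
    (hker : RingHom.ker ψ = Ideal.span {t}) (htm : t ∈ maximalIdeal S) :
    (maximalIdeal S).spanFinrank ≤ (maximalIdeal R).spanFinrank + 1 := by
  have hfg := (maximalIdeal R).fg_of_isNoetherianRing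
  set G := (maximalIdeal R).generators with hG
  have hGf : G.Finite := Submodule.FG.finite_generators hfg
  choose f hf using hψ
  have h1 : maximalIdeal S = Ideal.span (insert t (f '' G)) := by
    apply le_antisymm
    · intro s hs
      have h2 : ψ s ∈ Ideal.map ψ (Ideal.span (f '' G)) := by
        rw [Ideal.map_span, Set.image_image]
        simp only [hf, Set.image_id']
        have h3 : Ideal.span G = maximalIdeal R := (maximalIdeal R).span_generators
        rw [h3, ← map_maximalIdeal_of_surjective fun r => ⟨f r, hf r⟩]
        exact Ideal.mem_map_of_mem ψ hs
      obtain ⟨s', hs', h4⟩ := (Ideal.mem_map_iff_of_surjective ψ fun r => ⟨f r, hf r⟩).1 h2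
      have h5 : s - s' ∈ RingHom.ker ψ := by rw [RingHom.mem_ker, map_sub, h4, sub_self]
      rw [hker] at h5
      rw [Ideal.span_insert, ← sub_add_cancel s s']
      exact Submodule.add_mem_sup h5 hs'
    · rw [Ideal.span_le]
      rintro s (rfl | ⟨r, hr, rfl⟩)
      · exact htm
      · have hr' : r ∈ maximalIdeal R := by
          rw [← (maximalIdeal R).span_generators]
          exact Submodule.subset_span hr
        change f r ∈ maximalIdeal S
        rw [mem_maximalIdeal, mem_nonunits_iff] at hr' ⊢
        exact fun h => hr' (hf r ▸ h.map ψ)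
  rw [h1, ← Submodule.FG.generators_ncard hfg]
  exact (Submodule.spanFinrank_span_le_ncard_of_finite ((hGf.image f).insert t)).trans
    ((Set.ncard_insert_le _ _).trans (Nat.add_le_add_right (Set.ncard_image_le hGf) 1))

/-- As `t` is not in the square of the maximal ideal, some coefficient in its expression by minimal
generators is a unit. Modulo `t` the corresponding generator is redundant. -/
theorem spanFinrank_maximalIdeal_add_one_le [IsNoetherianRing S] (hψ : Function.Surjective ψ)
    (hker : RingHom.ker ψ = Ideal.span {t}) (htm : t ∈ maximalIdeal S)
    (ht2 : t ∉ maximalIdeal S * maximalIdeal S) :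
    (maximalIdeal R).spanFinrank + 1 ≤ (maximalIdeal S).spanFinrank := by
  classical
  have hfg := (maximalIdeal S).fg_of_isNoetherianRing
  have hGf : (maximalIdeal S).generators.Finite := Submodule.FG.finite_generators hfg
  have hspan : Ideal.span (maximalIdeal S).generators = maximalIdeal S :=
    (maximalIdeal S).span_generators
  obtain ⟨G, hG⟩ := hGf.exists_finset_coe
  rw [← hG] at hspan
  have hGm : ∀ g ∈ G, g ∈ maximalIdeal S := fun g hg => hspan ▸ Ideal.subset_span hg
  rw [← hspan] at htm
  obtain ⟨a, -, ha⟩ := Submodule.mem_span_finset.1 htm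
  obtain ⟨g, hg, hag⟩ : ∃ g ∈ G, IsUnit (a g) := by
    by_contra! h
    refine ht2 (ha ▸ Ideal.sum_mem _ fun g hg => Ideal.mul_mem_mul ?_ (hGm g hg))
    exact (mem_maximalIdeal _).2 (h g hg)
  have h1 : maximalIdeal R = Ideal.span (ψ '' (G.erase g : Finset S)) := by
    rw [← map_maximalIdeal_of_surjective hψ, ← hspan, Ideal.map_span]
    apply le_antisymm
    · rw [Ideal.span_le]
      rintro _ ⟨g', hg', rfl⟩
      by_cases h : g' = g
      · subst h
        have h2 : ψ t = 0 := by
          rw [← RingHom.mem_ker, hker]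
          exact Ideal.mem_span_singleton_self t
        rw [← ha, ← Finset.add_sum_erase _ _ hg, map_add, smul_eq_mul, map_mul, map_sum] at h2
        have h3 : ψ (a g') * ψ g' ∈ Ideal.span (ψ '' (G.erase g' : Finset S)) := by
          rw [eq_neg_of_add_eq_zero_left h2]
          refine Submodule.neg_mem _ (Ideal.sum_mem _ fun g hg => ?_)
          rw [smul_eq_mul, map_mul]
          exact Ideal.mul_mem_left _ _ (Ideal.subset_span ⟨g, hg, rfl⟩)
        exact (Ideal.unit_mul_mem_iff_mem _ (hag.map ψ)).1 h3
      · exact Ideal.subset_span ⟨g', Finset.mem_erase.2 ⟨h, hg'⟩, rfl⟩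
    · exact Ideal.span_mono (Set.image_mono (Finset.coe_subset.2 (G.erase_subset g)))
  rw [h1, ← Submodule.FG.generators_ncard hfg, ← hG, Set.ncard_coe_finset,
    ← Finset.card_erase_add_one hg]
  refine Nat.add_le_add_right ((Submodule.spanFinrank_span_le_ncard_of_finite
    ((Finset.finite_toSet _).image ψ)).trans ?_) 1
  rw [← Set.ncard_coe_finset]
  exact Set.ncard_image_le (Finset.finite_toSet _)

/-- Passing from `S` to `R = S / (t)` lowers the Krull dimension by one because `t` is a
nonzerodivisor, and the embedding dimension by one because `t` is not in the square of the maximal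
ideal. Equality of the two numbers is therefore preserved in both directions. -/
theorem isRegularLocalRing_iff_of_ker_eq_span [IsNoetherianRing S] [IsNoetherianRing R]
    (hψ : Function.Surjective ψ)
    (hker : RingHom.ker ψ = Ideal.span {t}) (ht : t ∈ nonZeroDivisors S)
    (htm : t ∈ maximalIdeal S) (ht2 : t ∉ maximalIdeal S * maximalIdeal S) :
    IsRegularLocalRing S ↔ IsRegularLocalRing R := by
  have hdim := ringKrullDim_add_one_of_ker_eq_span hψ hker ht htm
  constructor
  · intro h
    apply IsRegularLocalRing.of_spanFinrank_maximalIdeal_le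
    have h1 := h.spanFinrank_maximalIdeal
    have h2 := spanFinrank_maximalIdeal_add_one_le hψ hker htm ht2
    rw [← hdim] at h1
    have h3 : (((maximalIdeal R).spanFinrank + 1 : ℕ) : WithBot ℕ∞) ≤ ringKrullDim R + 1 := by
      rw [← h1]
      exact_mod_cast h2
    push_cast at h3
    exact ENat.WithBot.add_le_add_one_right_iff.1 h3
  · intro h
    apply IsRegularLocalRing.of_spanFinrank_maximalIdeal_le
    have h2 := spanFinrank_maximalIdeal_le hψ hker htm
    rw [← hdim, ← h.spanFinrank_maximalIdeal]
    exact_mod_cast h2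

end RegularLocalRing

end Tetra

namespace Tetra

/-! ### Maps of local rings -/

section LocalRing

variable {X Y : Type} [HomogCoords X] [HomogCoords Y]

/-- The germ of a regular function. -/
def IsRegularAt.germ {f : X → ℂ} {x : X} (h : IsRegularAt f x) : localRing X x := ⟨f, f, h, rfl⟩

theorem exists_germ_eq {x : X} (r : localRing X x) : ∃ (f : X → ℂ) (h : IsRegularAt f x),
    h.germ = r := by
  obtain ⟨_, f, hf, rfl⟩ := r
  exact ⟨f, hf, rfl⟩

theorem IsRegularAt.germ_eq_germ {f g : X → ℂ} {x : X} (hf : IsRegularAt f x)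
    (hg : IsRegularAt g x) : hf.germ = hg.germ ↔ f =ᶠ[@nhds X (zariski X) x] g :=
  Subtype.ext_iff.trans Filter.Germ.coe_eq

theorem IsMorphism.tendsto {φ : X → Y} (hφ : IsMorphism φ) (x : X) :
    Filter.Tendsto φ (@nhds X (zariski X) x) (@nhds Y (zariski Y) (φ x)) := by
  let _ := zariski X
  let _ := zariski Y
  exact hφ.1.continuousAt

/-- The pullback of germs along a morphism. -/
def IsMorphism.localRingHom {φ : X → Y} (hφ : IsMorphism φ) (x : X) :
    localRing Y (φ x) →+* localRing X x where
  toFun r := ⟨r.1.compTendsto φ (hφ.tendsto x), by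
    obtain ⟨_, f, hf, rfl⟩ := r
    exact ⟨f ∘ φ, hφ.2 f x hf, rfl⟩⟩
  map_zero' := rfl
  map_one' := rfl
  map_add' r s := by
    obtain ⟨_, f, hf, rfl⟩ := r
    obtain ⟨_, g, hg, rfl⟩ := s
    rfl
  map_mul' r s := by
    obtain ⟨_, f, hf, rfl⟩ := r
    obtain ⟨_, g, hg, rfl⟩ := s
    rfl

theorem IsMorphism.localRingHom_germ {φ : X → Y} (hφ : IsMorphism φ) {x : X} {f : Y → ℂ}
    (hf : IsRegularAt f (φ x)) : hφ.localRingHom x hf.germ = (hφ.2 f x hf).germ := rfl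

theorem isRegularLocalRing_iff_of_bijective {R S : Type} [CommRing R] [CommRing S] (f : R →+* S)
    (hf : Function.Bijective f) : IsRegularLocalRing R ↔ IsRegularLocalRing S :=
  ⟨fun _ => IsRegularLocalRing.of_ringEquiv (RingEquiv.ofBijective f hf),
    fun _ => IsRegularLocalRing.of_ringEquiv (RingEquiv.ofBijective f hf).symm⟩

theorem IsMorphism.isRegularLocalRing_iff {φ : X → Y} (hφ : IsMorphism φ) {x : X}
    (h1 : ∀ f g : Y → ℂ, f ∘ φ =ᶠ[@nhds X (zariski X) x] g ∘ φ →
      f =ᶠ[@nhds Y (zariski Y) (φ x)] g)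
    (h2 : ∀ f : X → ℂ, IsRegularAt f x → ∃ g : Y → ℂ, IsRegularAt g (φ x) ∧ g ∘ φ = f) :
    IsRegularLocalRing (localRing Y (φ x)) ↔ IsRegularLocalRing (localRing X x) := by
  refine isRegularLocalRing_iff_of_bijective (hφ.localRingHom x) ⟨fun r s hrs => ?_, fun r => ?_⟩
  · obtain ⟨f, hf, rfl⟩ := exists_germ_eq r
    obtain ⟨g, hg, rfl⟩ := exists_germ_eq s
    rw [hφ.localRingHom_germ, hφ.localRingHom_germ, IsRegularAt.germ_eq_germ] at hrs
    exact (hf.germ_eq_germ hg).2 (h1 f g hrs)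
  · obtain ⟨f, hf, rfl⟩ := exists_germ_eq r
    obtain ⟨g, hg, rfl⟩ := h2 f hf
    exact ⟨hg.germ, rfl⟩

theorem IsVarietyIso.isRegularLocalRing_iff {φ : X ≃ Y} (hφ : IsVarietyIso φ) (x : X) :
    IsRegularLocalRing (localRing Y (φ x)) ↔ IsRegularLocalRing (localRing X x) := by
  refine hφ.1.isRegularLocalRing_iff (fun f g h => ?_) fun f hf =>
    ⟨f ∘ φ.symm, hφ.2.2 f (φ x) (by rwa [φ.symm_apply_apply]), ?_⟩
  · have h1 := hφ.2.tendsto (φ x)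
    rw [φ.symm_apply_apply] at h1
    have h2 := h1.eventually h
    exact h2.mono fun y hy => by simpa using hy
  · funext y
    simp

theorem IsVarietyIso.isSmoothVariety_iff {φ : X ≃ Y} (hφ : IsVarietyIso φ) :
    IsSmoothVariety X ↔ IsSmoothVariety Y :=
  ⟨fun h y => by
    obtain ⟨x, rfl⟩ := φ.surjective y
    exact (hφ.isRegularLocalRing_iff x).2 (h x),
    fun h x => (hφ.isRegularLocalRing_iff x).1 (h (φ x))⟩

theorem isMorphism_inclusion [HomogTorsor X] {p q : X → Prop} (hpq : ∀ x, q x → p x) :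
    IsMorphism fun x : {x : X // q x} => (⟨x.1, hpq x.1 x.2⟩ : {x : X // p x}) :=
  IsMorphism.of_lift fun _ => ⟨1, fun c => c, fun _ _ => by simp,
    fun j => (IsPolyFun.coord j).isRat _, fun _ _ hc _ => hc⟩

/-- Germs at a point do not change under restriction to an open neighbourhood, here one cut out by
`H ≠ 0`. -/
theorem isRegularLocalRing_iff_of_open [HomogTorsor X] {p q : X → Prop} (hpq : ∀ x, q x → p x)
    {H : MvPolynomial (HomogCoords.idx X) ℂ}
    (hH : ∀ y, p y → ∀ c ∈ HomogCoords.rep y, MvPolynomial.eval c H ≠ 0 → q y) {x : X} (hx : q x)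
    (hxH : ∀ c ∈ HomogCoords.rep x, MvPolynomial.eval c H ≠ 0) :
    IsRegularLocalRing (localRing {x : X // p x} ⟨x, hpq x hx⟩) ↔
      IsRegularLocalRing (localRing {x : X // q x} ⟨x, hx⟩) := by
  classical
  refine (isMorphism_inclusion hpq).isRegularLocalRing_iff (x := ⟨x, hx⟩) (fun f g h => ?_)
    fun f hf => ?_
  · let T := zariski X
    have hopen : @IsOpen X (zariski X) {y | ∃ c ∈ HomogCoords.rep y, MvPolynomial.eval c H ≠ 0} := by
      have h1 := isClosed_zariski.2 (isZariskiClosed_eval_eq_zero (X := X) {H})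
      rw [← @isOpen_compl_iff X _ (zariski X)] at h1
      convert h1 using 1
      ext y
      simp
    rw [zariski_subtype] at h ⊢
    rw [Filter.EventuallyEq, nhds_induced, Filter.eventually_comap] at h ⊢
    obtain ⟨c, hc⟩ := HomogTorsor.nonempty x
    have h2 := hopen.mem_nhds (x := x) ⟨c, hc, hxH c hc⟩
    filter_upwards [h, h2] with y hy1 hy2
    rintro ⟨y, hy⟩ rfl
    obtain ⟨d, hd, hdH⟩ := hy2
    exact hy1 ⟨y, hH y hy d hd hdH⟩ rfl
  · obtain ⟨P, Q, hQ, hPQ⟩ := hf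
    -- The function is extended by zero; multiplying numerator and denominator by `H` excludes the
    -- points where the extension is arbitrary.
    refine ⟨fun y => if h : q y.1 then f ⟨y.1, h⟩ else 0, ⟨P * H, Q * H, fun c hc => ?_,
      fun y c hc hne => ?_⟩, funext fun y => dif_pos y.2⟩
    · rw [map_mul]
      exact mul_ne_zero (hQ c hc) (hxH c hc)
    · rw [map_mul] at hne
      have h1 := right_ne_zero_of_mul hne
      have hy := hH y.1 y.2 c hc h1
      beta_reduce
      rw [dif_pos hy, hPQ ⟨y.1, hy⟩ c hc (left_ne_zero_of_mul hne), map_mul, map_mul,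
        mul_div_mul_right _ _ h1]

/-- The value of germs at the point. -/
def germValue (x : X) : localRing X x →+* ℂ :=
  (@Filter.Germ.valueRingHom X ℂ _ (zariski X) x).comp (localRing X x).subtype

theorem germValue_germ {x : X} {f : X → ℂ} (hf : IsRegularAt f x) : germValue x hf.germ = f x := rfl

end LocalRing

/-! ### Affine varieties -/

/-- Varieties whose points have a single coordinate vector. -/
class AffineCoords (X : Type) [HomogCoords X] where
  coord : X → HomogCoords.idx X → ℂ
  rep_eq : ∀ x, HomogCoords.rep x = {coord x}

instance : AffineCoords ℂ where
  coord x := fun _ => x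
  rep_eq _ := rfl

instance {ι : Type} (X : ι → Type) [∀ i, HomogCoords (X i)] [∀ i, AffineCoords (X i)] :
    AffineCoords (∀ i, X i) where
  coord x := fun j => AffineCoords.coord (x j.1) j.2
  rep_eq x := by
    ext c
    change (∀ i, _ ∈ _) ↔ _
    simp only [AffineCoords.rep_eq, Set.mem_singleton_iff]
    exact ⟨fun h => funext fun j => congrFun (h j.1) j.2, fun h i => h ▸ rfl⟩

instance (X Y : Type) [HomogCoords X] [HomogCoords Y] [AffineCoords X] [AffineCoords Y] :
    AffineCoords (X × Y) where
  coord x := Sum.elim (AffineCoords.coord x.1) (AffineCoords.coord x.2)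
  rep_eq x := by
    ext c
    change (_ ∈ _ ∧ _ ∈ _) ↔ _
    simp only [AffineCoords.rep_eq, Set.mem_singleton_iff]
    refine ⟨fun h => funext fun j => ?_, fun h => h ▸ ⟨rfl, rfl⟩⟩
    rcases j with j | j
    exacts [congrFun h.1 j, congrFun h.2 j]

instance {X : Type} [HomogCoords X] [AffineCoords X] (p : X → Prop) :
    AffineCoords {x : X // p x} where
  coord x := AffineCoords.coord (X := X) x.1
  rep_eq x := AffineCoords.rep_eq (X := X) x.1

section Affine

open AffineCoords

variable {X : Type} [HomogCoords X] [AffineCoords X]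

theorem mem_rep_affine {x : X} {c : HomogCoords.idx X → ℂ} :
    c ∈ HomogCoords.rep x ↔ c = coord x := by rw [rep_eq, Set.mem_singleton_iff]

theorem AffineCoords.homogTorsor : HomogTorsor X where
  nonempty x := ⟨_, mem_rep_affine.2 rfl⟩
  exists_scaling := ⟨{fun _ => 1}, fun x c hc c' => by
    rw [mem_rep_affine] at hc ⊢
    simp [hc]⟩

theorem isRegularAt_iff_affine {f : X → ℂ} {x : X} : IsRegularAt f x ↔
    ∃ P Q : MvPolynomial (HomogCoords.idx X) ℂ, MvPolynomial.eval (coord x) Q ≠ 0 ∧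
      ∀ y, MvPolynomial.eval (coord y) Q ≠ 0 →
        f y = MvPolynomial.eval (coord y) P / MvPolynomial.eval (coord y) Q := by
  simp only [IsRegularAt, mem_rep_affine, forall_eq]

/-- The sets `Q ≠ 0` form a basis of the topology of an affine variety. -/
theorem eventually_nhds_affine {x : X} {p : X → Prop} : (∀ᶠ y in @nhds X (zariski X) x, p y) ↔
    ∃ Q : MvPolynomial (HomogCoords.idx X) ℂ, MvPolynomial.eval (coord x) Q ≠ 0 ∧
      ∀ y, MvPolynomial.eval (coord y) Q ≠ 0 → p y := by
  let _ := zariski X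
  rw [eventually_nhds_iff]
  constructor
  · rintro ⟨U, hU, hopen, hx⟩
    rw [← isClosed_compl_iff, isClosed_zariski] at hopen
    obtain ⟨T, hT⟩ := hopen
    have h1 : x ∉ Uᶜ := fun h => h hx
    rw [hT x _ (mem_rep_affine.2 rfl)] at h1
    push Not at h1
    obtain ⟨Q, hQ, hQx⟩ := h1
    refine ⟨Q, hQx, fun y hy => hU y ?_⟩
    by_contra h2
    exact hy ((hT y _ (mem_rep_affine.2 rfl)).1 h2 Q hQ)
  · rintro ⟨Q, hQ, hp⟩
    refine ⟨{y | MvPolynomial.eval (coord y) Q ≠ 0}, fun y hy => hp y hy, ?_, hQ⟩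
    rw [← isClosed_compl_iff, isClosed_zariski]
    refine ⟨{Q}, fun y c hc => ?_⟩
    rw [mem_rep_affine.1 hc]
    simp

theorem isRegularAt_eval (P : MvPolynomial (HomogCoords.idx X) ℂ) (x : X) :
    IsRegularAt (fun y => MvPolynomial.eval (coord y) P) x :=
  isRegularAt_iff_affine.2 ⟨P, 1, by simp, by simp⟩

/-- The germs of the polynomial functions. -/
noncomputable def polyGerm (x : X) : MvPolynomial (HomogCoords.idx X) ℂ →+* localRing X x where
  toFun P := (isRegularAt_eval P x).germ
  map_zero' := Subtype.ext (congrArg (Filter.Germ.coeRingHom _) (funext fun y => map_zero (MvPolynomial.eval (coord y))))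
  map_one' := Subtype.ext (congrArg (Filter.Germ.coeRingHom _) (funext fun y => map_one (MvPolynomial.eval (coord y))))
  map_add' P Q := Subtype.ext
    (congrArg (Filter.Germ.coeRingHom _) (funext fun y => map_add (MvPolynomial.eval (coord y)) P Q))
  map_mul' P Q := Subtype.ext
    (congrArg (Filter.Germ.coeRingHom _) (funext fun y => map_mul (MvPolynomial.eval (coord y)) P Q))

theorem germ_eq_zero {x : X} {f : X → ℂ} (hf : IsRegularAt f x) :
    hf.germ = 0 ↔ ∃ Q : MvPolynomial (HomogCoords.idx X) ℂ, MvPolynomial.eval (coord x) Q ≠ 0 ∧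
      ∀ y, MvPolynomial.eval (coord y) Q ≠ 0 → f y = 0 := by
  rw [← eventually_nhds_affine]
  exact Subtype.ext_iff.trans Filter.Germ.coe_eq

theorem isUnit_polyGerm {x : X} {Q : MvPolynomial (HomogCoords.idx X) ℂ}
    (hQ : MvPolynomial.eval (coord x) Q ≠ 0) : IsUnit (polyGerm x Q) := by
  have h1 : IsRegularAt (fun y => (MvPolynomial.eval (coord y) Q)⁻¹) x :=
    isRegularAt_iff_affine.2 ⟨1, Q, hQ, fun y _ => by simp⟩
  refine IsUnit.of_mul_eq_one h1.germ (Subtype.ext (Filter.Germ.coe_eq.2 ?_))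
  exact eventually_nhds_affine.2 ⟨Q, hQ, fun y hy => mul_inv_cancel₀ hy⟩

instance (x : X) : (RingHom.ker (MvPolynomial.eval (coord x))).IsPrime := RingHom.ker_isPrime _

/-- Germs at `x` as fractions of polynomials. -/
noncomputable def fractionGerm (x : X) :
    Localization.AtPrime (RingHom.ker (MvPolynomial.eval (coord x))) →+* localRing X x :=
  IsLocalization.lift (M := (RingHom.ker (MvPolynomial.eval (coord x))).primeCompl)
    (g := polyGerm x) fun Q => isUnit_polyGerm Q.2

/-- The local ring is a quotient of a localized polynomial ring, hence local and, with finitely many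
coordinates, Noetherian. -/
theorem fractionGerm_surjective (x : X) : Function.Surjective (fractionGerm x) := by
  intro r
  obtain ⟨f, hf, rfl⟩ := exists_germ_eq r
  obtain ⟨P, Q, hQ, hPQ⟩ := isRegularAt_iff_affine.1 hf
  have hQ' : Q ∈ (RingHom.ker (MvPolynomial.eval (coord x))).primeCompl := hQ
  refine ⟨IsLocalization.mk' _ P ⟨Q, hQ'⟩, ?_⟩
  rw [fractionGerm, IsLocalization.lift_mk'_spec]
  refine Subtype.ext (Filter.Germ.coe_eq.2 (eventually_nhds_affine.2 ⟨Q, hQ, fun y hy => ?_⟩))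
  beta_reduce
  rw [hPQ y hy]
  field_simp

instance (x : X) : Nontrivial (localRing X x) := (germValue x).domain_nontrivial

instance (x : X) : IsLocalRing (localRing X x) :=
  IsLocalRing.of_surjective' (fractionGerm x) (fractionGerm_surjective x)

instance [Finite (HomogCoords.idx X)] (x : X) : IsNoetherianRing (localRing X x) := by
  have := IsLocalization.isNoetherianRing (RingHom.ker (MvPolynomial.eval (coord x))).primeCompl
    (Localization.AtPrime (RingHom.ker (MvPolynomial.eval (coord x)))) inferInstance
  exact isNoetherianRing_of_surjective _ _ (fractionGerm x) (fractionGerm_surjective x)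

theorem mem_maximalIdeal_localRing {x : X} {r : localRing X x} :
    r ∈ IsLocalRing.maximalIdeal (localRing X x) ↔ germValue x r = 0 := by
  have h : Function.Surjective (germValue x) := fun a =>
    ⟨(isRegularAt_eval (MvPolynomial.C a) x).germ, by rw [germValue_germ, MvPolynomial.eval_C]⟩
  have := RingHom.ker_isMaximal_of_surjective (germValue x) h
  rw [← IsLocalRing.eq_maximalIdeal this, RingHom.mem_ker]

end Affine

end Tetra

namespace Tetra

/-! ### Products with the affine line -/

section Line

open AffineCoords

variable {X : Type} [HomogCoords X] [AffineCoords X]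

theorem isMorphism_slice (t₀ : ℂ) : IsMorphism fun x : X => (x, t₀) :=
  have : HomogTorsor X := AffineCoords.homogTorsor
  IsMorphism.of_lift fun _ => ⟨1, fun c => Sum.elim c fun _ => t₀, fun _ _ => by simp,
    fun j => by
      rcases j with j | j
      exacts [(IsPolyFun.coord j).isRat _, IsRat.const t₀], fun _ _ hc _ => ⟨hc, rfl⟩⟩

theorem isMorphism_fst : IsMorphism (Prod.fst : X × ℂ → X) :=
  have : HomogTorsor X := AffineCoords.homogTorsor
  IsMorphism.of_lift fun _ => ⟨1, fun c j => c (Sum.inl j), fun _ _ => by simp,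
    fun _ => (IsPolyFun.coord _).isRat _, fun _ _ hc _ => hc.1⟩

/-- The polynomial in the coordinates of `X` that is given by a polynomial on `X × ℂ` and a value of
the last coordinate. -/
theorem exists_eval_slice (P : MvPolynomial (HomogCoords.idx (X × ℂ)) ℂ) (t₀ : ℂ) :
    ∃ P₀ : MvPolynomial (HomogCoords.idx X) ℂ,
      ∀ x, MvPolynomial.eval (coord x) P₀ = MvPolynomial.eval (coord (x, t₀)) P := by
  obtain ⟨P₀, h⟩ : IsPolyFun fun c : HomogCoords.idx X → ℂ =>
      MvPolynomial.eval (Sum.elim c fun _ => t₀ : HomogCoords.idx (X × ℂ) → ℂ) P :=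
    IsPolyFun.comp ⟨P, fun _ => rfl⟩ fun j => by
      rcases j with j | j
      exacts [IsPolyFun.coord j, IsPolyFun.const t₀]
  exact ⟨P₀, fun x => h _⟩

/-- The difference of the values at `t` and `t₀` is divisible by `t - t₀`, with a quotient that is
polynomial in all the coordinates. -/
theorem exists_eval_sub_eq (P : MvPolynomial (HomogCoords.idx (X × ℂ)) ℂ) (t₀ : ℂ) :
    ∃ P₁ : MvPolynomial (HomogCoords.idx (X × ℂ)) ℂ, ∀ (x : X) (t : ℂ),
      MvPolynomial.eval (coord (x, t)) P - MvPolynomial.eval (coord (x, t₀)) P =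
        (t - t₀) * MvPolynomial.eval (coord (x, t)) P₁ := by
  induction P using MvPolynomial.induction_on with
  | C a => exact ⟨0, fun x t => by simp⟩
  | add p q hp hq =>
    obtain ⟨p₁, hp⟩ := hp
    obtain ⟨q₁, hq⟩ := hq
    refine ⟨p₁ + q₁, fun x t => ?_⟩
    rw [map_add, map_add, map_add, add_sub_add_comm, hp, hq, mul_add]
  | mul_X p j hp =>
    obtain ⟨p₁, hp⟩ := hp
    rcases j with j | j
    · refine ⟨p₁ * MvPolynomial.X (Sum.inl j), fun x t => ?_⟩
      have h2 : coord (x, t) (Sum.inl j) = coord (x, t₀) (Sum.inl j) := rfl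
      simp only [map_mul, MvPolynomial.eval_X, h2]
      rw [← sub_mul, hp]
      exact mul_assoc _ _ _
    -- The last coordinate is `t` itself, and `p t - p₀ t₀ = (p - p₀) t + p₀ (t - t₀)` with `p₀` the
    -- restriction of `p` to the slice.
    · obtain ⟨P₀, hP₀⟩ := exists_eval_slice p t₀
      refine ⟨p₁ * MvPolynomial.X (Sum.inr j) + MvPolynomial.rename Sum.inl P₀, fun x t => ?_⟩
      have h1 : MvPolynomial.eval (coord (x, t)) (MvPolynomial.rename Sum.inl P₀) =
          MvPolynomial.eval (coord (x, t₀)) p := by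
        rw [← hP₀, MvPolynomial.eval_rename]
        rfl
      rw [map_add, h1, mul_add, map_mul (MvPolynomial.eval _) p₁, ← mul_assoc, ← hp]
      simp only [map_mul, MvPolynomial.eval_X]
      have h2 : coord (x, t) (Sum.inr j) = t := rfl
      have h3 : coord (x, t₀) (Sum.inr j) = t₀ := rfl
      rw [h2, h3]
      ring

theorem isRegularAt_sub (x : X) (t₀ : ℂ) : IsRegularAt (fun y : X × ℂ => y.2 - t₀) (x, t₀) :=
  isRegularAt_iff_affine.2 ⟨MvPolynomial.X (Sum.inr ()) - MvPolynomial.C t₀, 1, by simp, fun y _ => by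
    simp only [map_sub, MvPolynomial.eval_X, MvPolynomial.eval_C, map_one, div_one]
    rfl⟩

/-- The germ of the equation of a slice. -/
def sliceGerm (x : X) (t₀ : ℂ) : localRing (X × ℂ) (x, t₀) := (isRegularAt_sub x t₀).germ

theorem localRingHom_slice_surjective (x : X) (t₀ : ℂ) :
    Function.Surjective ((isMorphism_slice t₀).localRingHom x) := by
  intro r
  obtain ⟨f, hf, rfl⟩ := exists_germ_eq r
  exact ⟨(isMorphism_fst.2 f (x, t₀) hf).germ, rfl⟩

/-- For a fraction that vanishes on the slice near `x`, the numerator vanishes there too, so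
division of the numerator by `t - t₀` leaves no remainder. -/
theorem ker_localRingHom_slice (x : X) (t₀ : ℂ) :
    RingHom.ker ((isMorphism_slice t₀).localRingHom x) = Ideal.span {sliceGerm x t₀} := by
  apply le_antisymm
  · intro r hr
    obtain ⟨f, hf, rfl⟩ := exists_germ_eq r
    rw [RingHom.mem_ker, IsMorphism.localRingHom_germ, germ_eq_zero] at hr
    obtain ⟨Q₀, hQ₀, hfQ₀⟩ := hr
    obtain ⟨P, Q, hQ, hPQ⟩ := isRegularAt_iff_affine.1 hf
    obtain ⟨P₁, hP₁⟩ := exists_eval_sub_eq P t₀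
    obtain ⟨Q₂, hQ₂⟩ := exists_eval_slice Q t₀
    have hg : IsRegularAt (fun y : X × ℂ => MvPolynomial.eval (coord y) P₁ /
      MvPolynomial.eval (coord y) Q) (x, t₀) := isRegularAt_iff_affine.2 ⟨P₁, Q, hQ, fun _ _ => rfl⟩
    -- The neighbourhood has to control `(y, t)` and its projection `(y, t₀)` together: `Q₀` ensures
    -- that the function vanishes at the projection, and `Q₂` that the denominator does not.
    refine Ideal.mem_span_singleton.2 ⟨hg.germ, Subtype.ext (Filter.Germ.coe_eq.2
      (eventually_nhds_affine.2 ⟨Q * MvPolynomial.rename Sum.inl (Q₀ * Q₂), ?_, ?_⟩))⟩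
    · rw [map_mul, MvPolynomial.eval_rename, map_mul]
      refine mul_ne_zero hQ (mul_ne_zero hQ₀ ?_)
      exact (hQ₂ x).trans_ne hQ
    · rintro ⟨y, t⟩ hy
      rw [map_mul, MvPolynomial.eval_rename, map_mul] at hy
      have h1 := left_ne_zero_of_mul hy
      have h2 := left_ne_zero_of_mul (right_ne_zero_of_mul hy)
      have h3 : MvPolynomial.eval (coord (y, t₀)) Q ≠ 0 :=
        (hQ₂ y).symm.trans_ne (right_ne_zero_of_mul (right_ne_zero_of_mul hy))
      have h4 : f (y, t₀) = 0 := hfQ₀ y h2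
      rw [hPQ _ h3, div_eq_zero_iff, or_iff_left h3] at h4
      have h5 := hP₁ y t
      rw [h4, sub_zero] at h5
      beta_reduce
      rw [hPQ _ h1, h5, mul_div_assoc]
  · rw [Ideal.span_singleton_le_iff_mem, RingHom.mem_ker, sliceGerm, IsMorphism.localRingHom_germ,
      germ_eq_zero]
    exact ⟨1, by simp, fun y _ => sub_self t₀⟩

theorem differentiable_eval_slice (P : MvPolynomial (HomogCoords.idx (X × ℂ)) ℂ) (x : X) :
    Differentiable ℂ fun t : ℂ => MvPolynomial.eval (coord (x, t)) P := by
  induction P using MvPolynomial.induction_on with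
  | C a => simp only [MvPolynomial.eval_C, differentiable_const]
  | add p q hp hq =>
    simp only [map_add]
    exact hp.fun_add hq
  | mul_X p j hp =>
    simp only [map_mul, MvPolynomial.eval_X]
    refine hp.fun_mul ?_
    rcases j with j | j
    exacts [differentiable_const (coord x j), differentiable_id]

theorem eval_slice_eq_zero {P : MvPolynomial (HomogCoords.idx (X × ℂ)) ℂ} {x : X} {t₀ : ℂ}
    (h : ∀ t, t ≠ t₀ → MvPolynomial.eval (coord (x, t)) P = 0) :
    MvPolynomial.eval (coord (x, t₀)) P = 0 := by
  have hc := (differentiable_eval_slice P x).continuous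
  exact congrFun (Continuous.ext_on (dense_compl_singleton t₀) hc continuous_const
    fun t ht => h t ht) t₀

/-- If `(t - t₀) f` vanishes near the point, then `f`, cleared of denominators and cut off by `H`,
is a polynomial along each line that vanishes for `t ≠ t₀`. By continuity it vanishes at `t₀` as
well. -/
theorem sliceGerm_mem_nonZeroDivisors (x : X) (t₀ : ℂ) :
    sliceGerm x t₀ ∈ nonZeroDivisors (localRing (X × ℂ) (x, t₀)) := by
  rw [mem_nonZeroDivisors_iff_right]
  intro r hr
  obtain ⟨f, hf, rfl⟩ := exists_germ_eq r
  have h1 := eventually_nhds_affine.1 (Filter.Germ.coe_eq.1 (congrArg Subtype.val hr))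
  obtain ⟨H, hH, hfH⟩ := h1
  obtain ⟨P, Q, hQ, hPQ⟩ := isRegularAt_iff_affine.1 hf
  rw [germ_eq_zero]
  refine ⟨H * Q, by rw [map_mul]; exact mul_ne_zero hH hQ, fun y hy => ?_⟩
  have key : ∀ t, MvPolynomial.eval (coord (y.1, t)) (P * (H * Q)) = 0 := by
    have h2 : ∀ t, t ≠ t₀ → MvPolynomial.eval (coord (y.1, t)) (P * (H * Q)) = 0 := by
      intro t ht
      rw [map_mul]
      by_cases h0 : MvPolynomial.eval (coord (y.1, t)) (H * Q) = 0
      · rw [h0, mul_zero]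
      · rw [map_mul] at h0
        have h3 : f (y.1, t) * (t - t₀) = 0 := hfH _ (left_ne_zero_of_mul h0)
        have h4 := (mul_eq_zero.1 h3).resolve_right (sub_ne_zero.2 ht)
        rw [hPQ _ (right_ne_zero_of_mul h0), div_eq_zero_iff] at h4
        rw [h4.resolve_right (right_ne_zero_of_mul h0), zero_mul]
    intro t
    by_cases ht : t = t₀
    · rw [ht]
      exact eval_slice_eq_zero h2
    · exact h2 t ht
  have h3 := key y.2
  rw [map_mul, mul_eq_zero] at h3
  have h4 : MvPolynomial.eval (coord y) P = 0 := h3.resolve_right hy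
  rw [map_mul] at hy
  rw [hPQ y (right_ne_zero_of_mul hy), h4, zero_div]

theorem IsRegularAt.differentiableAt {f : X × ℂ → ℂ} {x : X} {t₀ : ℂ}
    (hf : IsRegularAt f (x, t₀)) : DifferentiableAt ℂ (fun t => f (x, t)) t₀ := by
  obtain ⟨P, Q, hQ, hPQ⟩ := isRegularAt_iff_affine.1 hf
  refine ((differentiable_eval_slice P x t₀).div (differentiable_eval_slice Q x t₀) hQ).congr_of_eventuallyEq ?_
  filter_upwards [(differentiable_eval_slice Q x).continuous.continuousAt.eventually_ne hQ] with t ht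
  exact hPQ _ ht

/-- The derivative along the line kills the square of the maximal ideal, by the product rule. The
germ of `t - t₀` has derivative `1`, so it is not in the square. -/
theorem exists_hasDerivAt_zero {x : X} {t₀ : ℂ} {r : localRing (X × ℂ) (x, t₀)}
    (hr : r ∈ IsLocalRing.maximalIdeal (localRing (X × ℂ) (x, t₀)) *
      IsLocalRing.maximalIdeal (localRing (X × ℂ) (x, t₀))) :
    ∃ (f : X × ℂ → ℂ) (hf : IsRegularAt f (x, t₀)), hf.germ = r ∧
      HasDerivAt (fun t => f (x, t)) 0 t₀ := by
  refine Submodule.mul_induction_on hr (fun r hr s hs => ?_) fun r s hr hs => ?_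
  · obtain ⟨f, hf, rfl⟩ := exists_germ_eq r
    obtain ⟨g, hg, rfl⟩ := exists_germ_eq s
    rw [mem_maximalIdeal_localRing, germValue_germ] at hr hs
    have h1 := hf.differentiableAt.hasDerivAt.mul hg.differentiableAt.hasDerivAt
    rw [hr, hs, mul_zero, zero_mul, add_zero] at h1
    have h2 : IsRegularAt (f * g) (x, t₀) := by
      obtain ⟨P, Q, hQ, hPQ⟩ := isRegularAt_iff_affine.1 hf
      obtain ⟨P', Q', hQ', hPQ'⟩ := isRegularAt_iff_affine.1 hg
      refine isRegularAt_iff_affine.2 ⟨P * P', Q * Q', ?_, fun y hy => ?_⟩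
      · rw [map_mul]
        exact mul_ne_zero hQ hQ'
      · rw [map_mul] at hy
        rw [Pi.mul_apply, hPQ y (left_ne_zero_of_mul hy), hPQ' y (right_ne_zero_of_mul hy), map_mul,
          map_mul, div_mul_div_comm]
    exact ⟨f * g, h2, rfl, h1⟩
  · obtain ⟨f, hf, rfl, hf'⟩ := hr
    obtain ⟨g, hg, rfl, hg'⟩ := hs
    have h2 : IsRegularAt (f + g) (x, t₀) := by
      obtain ⟨P, Q, hQ, hPQ⟩ := isRegularAt_iff_affine.1 hf
      obtain ⟨P', Q', hQ', hPQ'⟩ := isRegularAt_iff_affine.1 hg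
      refine isRegularAt_iff_affine.2 ⟨P * Q' + Q * P', Q * Q', ?_, fun y hy => ?_⟩
      · rw [map_mul]
        exact mul_ne_zero hQ hQ'
      · rw [map_mul] at hy
        rw [Pi.add_apply, hPQ y (left_ne_zero_of_mul hy), hPQ' y (right_ne_zero_of_mul hy),
          div_add_div _ _ (left_ne_zero_of_mul hy) (right_ne_zero_of_mul hy)]
        simp only [map_add, map_mul]
    have h1 := hf'.add hg'
    rw [add_zero] at h1
    exact ⟨f + g, h2, rfl, h1⟩

theorem sliceGerm_mem_maximalIdeal (x : X) (t₀ : ℂ) :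
    sliceGerm x t₀ ∈ IsLocalRing.maximalIdeal (localRing (X × ℂ) (x, t₀)) := by
  rw [mem_maximalIdeal_localRing, sliceGerm, germValue_germ, sub_self]

theorem sliceGerm_notMem_maximalIdeal_mul (x : X) (t₀ : ℂ) :
    sliceGerm x t₀ ∉ IsLocalRing.maximalIdeal (localRing (X × ℂ) (x, t₀)) *
      IsLocalRing.maximalIdeal (localRing (X × ℂ) (x, t₀)) := by
  intro h
  obtain ⟨f, hf, hfr, hd⟩ := exists_hasDerivAt_zero h
  rw [sliceGerm, IsRegularAt.germ_eq_germ] at hfr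
  obtain ⟨Q, hQ, hfQ⟩ := eventually_nhds_affine.1 hfr
  have h1 : HasDerivAt (fun t : ℂ => t - t₀) 1 t₀ := (hasDerivAt_id t₀).sub_const t₀
  have hc := (differentiable_eval_slice Q x).continuous
  have h2 : (fun t => f (x, t)) =ᶠ[nhds t₀] fun t => t - t₀ := by
    filter_upwards [hc.continuousAt.eventually_ne hQ] with t ht
    exact hfQ _ ht
  exact zero_ne_one ((hd.congr_of_eventuallyEq h2.symm).unique h1)

theorem isRegularLocalRing_prod_line_iff [Finite (HomogCoords.idx X)] (x : X) (t₀ : ℂ) :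
    IsRegularLocalRing (localRing (X × ℂ) (x, t₀)) ↔ IsRegularLocalRing (localRing X x) := by
  have : Finite (HomogCoords.idx (X × ℂ)) := inferInstanceAs (Finite (HomogCoords.idx X ⊕ Unit))
  exact isRegularLocalRing_iff_of_ker_eq_span (localRingHom_slice_surjective x t₀)
    (ker_localRingHom_slice x t₀) (sliceGerm_mem_nonZeroDivisors x t₀)
    (sliceGerm_mem_maximalIdeal x t₀) (sliceGerm_notMem_maximalIdeal_mul x t₀)

end Line

end Tetra

namespace Tetra

/-! ### Products and affine models -/

theorem IsRat.rename {σ τ : Type} {D : MvPolynomial σ ℂ} {h : (σ → ℂ) → ℂ} (hh : IsRat D h)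
    (f : σ → τ) : IsRat (MvPolynomial.rename f D) fun c => h (c ∘ f) := by
  obtain ⟨P, n, hP⟩ := hh
  refine ⟨MvPolynomial.rename f P, n, fun c hc => ?_⟩
  rw [MvPolynomial.eval_rename] at hc
  rw [MvPolynomial.eval_rename, MvPolynomial.eval_rename]
  exact hP _ hc

/-- Maps that are given locally by rational functions of the coordinates. -/
def HasLift {X Y : Type} [HomogCoords X] [HomogCoords Y] (φ : X → Y) : Prop :=
  ∀ x, ∃ (D : MvPolynomial (HomogCoords.idx X) ℂ)
    (h : (HomogCoords.idx X → ℂ) → HomogCoords.idx Y → ℂ),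
    (∀ c ∈ HomogCoords.rep x, MvPolynomial.eval c D ≠ 0) ∧
    (∀ j, IsRat D fun c => h c j) ∧
    ∀ y, ∀ c ∈ HomogCoords.rep y, MvPolynomial.eval c D ≠ 0 → h c ∈ HomogCoords.rep (φ y)

theorem HasLift.isMorphism {X Y : Type} [HomogCoords X] [HomogCoords Y] [HomogTorsor X] {φ : X → Y}
    (h : HasLift φ) : IsMorphism φ := IsMorphism.of_lift h

/-- The Zariski topology of a product is not the product topology, so products of maps are handled
through their lifts to coordinate vectors. -/
theorem HasLift.prodMap_id {X Y : Type} [HomogCoords X] [HomogCoords Y] {φ : X → Y}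
    (hφ : HasLift φ) (W : Type) [HomogCoords W] : HasLift (Prod.map φ (id : W → W)) := by
  intro x
  obtain ⟨D, h, hD, hh, hφ⟩ := hφ x.1
  refine ⟨MvPolynomial.rename Sum.inl D, fun c => Sum.elim (h (c ∘ Sum.inl)) (c ∘ Sum.inr),
    fun c hc => ?_, fun j => ?_, fun y c hc hne => ?_⟩
  · rw [MvPolynomial.eval_rename]
    exact hD _ hc.1
  · rcases j with j | j
    exacts [(hh j).rename Sum.inl, (IsPolyFun.coord _).isRat _]
  · rw [MvPolynomial.eval_rename] at hne
    exact ⟨hφ _ _ hc.1 hne, hc.2⟩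

section AffineModel

variable {ι : Type} {E : ι → Type}

theorem eq_of_mem_rep {z z' : ∀ i, ℙ ℂ (E i → ℂ)} {c : (Σ i, E i) → ℂ} (hc : c ∈ HomogCoords.rep z)
    (hc' : c ∈ HomogCoords.rep z') : z = z' :=
  funext fun i => Projectivization.submodule_injective
    ((mem_rep_proj.1 (hc i)).2.trans (mem_rep_proj.1 (hc' i)).2.symm)

/-- The points of `V` at which the coordinates `γ i` do not vanish. -/
def normOpen (γ : ∀ i, E i) (V : Set (∀ i, ℙ ℂ (E i → ℂ))) : Set (∀ i, ℙ ℂ (E i → ℂ)) :=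
  {z | z ∈ V ∧ ∀ c ∈ HomogCoords.rep z, ∀ i, c ⟨i, γ i⟩ ≠ 0}

/-- The normalized coordinate vectors of the points of `normOpen γ V`. -/
abbrev AffineModel (γ : ∀ i, E i) (V : Set (∀ i, ℙ ℂ (E i → ℂ))) : Type :=
  {v : (Σ i, E i) → ℂ // ∃ z ∈ normOpen γ V, v ∈ HomogCoords.rep z ∧ ∀ i, v ⟨i, γ i⟩ = 1}

/-- The normalized coordinates of a point. -/
noncomputable def affineModelMap (γ : ∀ i, E i) (V : Set (∀ i, ℙ ℂ (E i → ℂ)))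
    (z : normOpen γ V) : AffineModel γ V :=
  have hc := (HomogTorsor.nonempty z.1).choose_spec
  ⟨normCoord γ (HomogTorsor.nonempty z.1).choose, z.1, z.2, normCoord_mem_rep hc (z.2.2 _ hc),
    fun i => mul_inv_cancel₀ (z.2.2 _ hc i)⟩

theorem affineModelMap_mem_rep {γ : ∀ i, E i} {V : Set (∀ i, ℙ ℂ (E i → ℂ))} (z : normOpen γ V) :
    (affineModelMap γ V z).1 ∈ HomogCoords.rep z.1 :=
  have hc := (HomogTorsor.nonempty z.1).choose_spec
  normCoord_mem_rep hc (z.2.2 _ hc)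

theorem normCoord_eq_self {γ : ∀ i, E i} {v : (Σ i, E i) → ℂ} (hv : ∀ i, v ⟨i, γ i⟩ = 1) :
    normCoord γ v = v := funext fun j => by rw [normCoord, hv, inv_one, mul_one]

theorem affineModelMap_bijective (γ : ∀ i, E i) (V : Set (∀ i, ℙ ℂ (E i → ℂ))) :
    Function.Bijective (affineModelMap γ V) := by
  refine ⟨fun z z' h => Subtype.ext ?_, fun v => ?_⟩
  · have h1 := affineModelMap_mem_rep z
    rw [h] at h1
    exact eq_of_mem_rep h1 (affineModelMap_mem_rep z')
  · obtain ⟨v, z, hz, hv, hv1⟩ := v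
    refine ⟨⟨z, hz⟩, Subtype.ext ?_⟩
    exact (normCoord_eq_of_mem_rep γ hv (HomogTorsor.nonempty z).choose_spec).trans
      (normCoord_eq_self hv1)

/-- The affine model. -/
noncomputable def affineModel (γ : ∀ i, E i) (V : Set (∀ i, ℙ ℂ (E i → ℂ))) :
    normOpen γ V ≃ AffineModel γ V := Equiv.ofBijective _ (affineModelMap_bijective γ V)

theorem affineModel_symm_mem_rep {γ : ∀ i, E i} {V : Set (∀ i, ℙ ℂ (E i → ℂ))}
    (v : AffineModel γ V) : v.1 ∈ HomogCoords.rep ((affineModel γ V).symm v).1 := by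
  obtain ⟨z, rfl⟩ := (affineModel γ V).surjective v
  rw [Equiv.symm_apply_apply]
  exact affineModelMap_mem_rep z

theorem hasLift_affineModel_symm (γ : ∀ i, E i) (V : Set (∀ i, ℙ ℂ (E i → ℂ))) :
    HasLift (affineModel γ V).symm := fun _ =>
  ⟨1, fun c j => c ⟨j, ()⟩, fun _ _ => by simp, fun _ => (IsPolyFun.coord _).isRat _,
    fun v c hc _ => by
      have h1 : (fun j => c ⟨j, ()⟩) = v.1 := funext fun j => congrFun (hc j) ()
      beta_reduce
      exact h1 ▸ affineModel_symm_mem_rep v⟩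

theorem hasLift_affineModel [Fintype ι] (γ : ∀ i, E i) (V : Set (∀ i, ℙ ℂ (E i → ℂ))) :
    HasLift (affineModel γ V) := fun z =>
  ⟨normDenom γ, fun c j => normCoord γ c j.1, fun c hc => eval_normDenom_ne_zero.2 (z.2.2 c hc),
    fun j => isRat_normCoord γ j.1, fun z c hc _ j => by
      have h1 := normCoord_eq_of_mem_rep γ (HomogTorsor.nonempty z.1).choose_spec hc
      exact funext fun _ => congrFun h1 j⟩

theorem isVarietyIso_affineModel [Fintype ι] (γ : ∀ i, E i) (V : Set (∀ i, ℙ ℂ (E i → ℂ))) :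
    IsVarietyIso (affineModel γ V) :=
  have : HomogTorsor (AffineModel γ V) := AffineCoords.homogTorsor
  ⟨(hasLift_affineModel γ V).isMorphism, (hasLift_affineModel_symm γ V).isMorphism⟩

theorem isVarietyIso_affineModel_prod [Fintype ι] (γ : ∀ i, E i) (V : Set (∀ i, ℙ ℂ (E i → ℂ)))
    (W : Type) [HomogCoords W] [AffineCoords W] :
    IsVarietyIso ((affineModel γ V).prodCongr (Equiv.refl W)) :=
  have : HomogTorsor (AffineModel γ V × W) := AffineCoords.homogTorsor
  have : HomogTorsor W := AffineCoords.homogTorsor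
  ⟨((hasLift_affineModel γ V).prodMap_id W).isMorphism,
    ((hasLift_affineModel_symm γ V).prodMap_id W).isMorphism⟩

end AffineModel

section AffineSpace

variable {X : Type} [HomogCoords X] [AffineCoords X]

theorem isVarietyIso_prodUnique : IsVarietyIso (Equiv.prodUnique X (Fin 0 → ℂ)) :=
  have : HomogTorsor X := AffineCoords.homogTorsor
  ⟨IsMorphism.of_lift fun _ => ⟨1, fun c j => c (Sum.inl j), fun _ _ => by simp,
    fun _ => (IsPolyFun.coord _).isRat _, fun _ _ hc _ => hc.1⟩,
  IsMorphism.of_lift fun _ => ⟨1, fun c => Sum.elim c fun j => j.1.elim0, fun _ _ => by simp,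
    fun j => by
      rcases j with j | j
      exacts [(IsPolyFun.coord j).isRat _, j.1.elim0], fun _ _ hc _ => ⟨hc, fun i => i.elim0⟩⟩⟩

/-- `X × ℂ ^ (n + 1)` as the product of `X × ℂ ^ n` and `ℂ`. -/
def prodPiSucc (X : Type) (n : ℕ) : X × (Fin (n + 1) → ℂ) ≃ (X × (Fin n → ℂ)) × ℂ where
  toFun y := ((y.1, fun i => y.2 i.succ), y.2 0)
  invFun y := (y.1.1, Fin.cons y.2 y.1.2)
  left_inv y := Prod.ext rfl (Fin.cons_self_tail y.2)
  right_inv _ := rfl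

theorem isVarietyIso_prodPiSucc (n : ℕ) : IsVarietyIso (prodPiSucc X n) :=
  have : HomogTorsor X := AffineCoords.homogTorsor
  ⟨IsMorphism.of_lift fun _ => ⟨1, fun c => Sum.elim
      (Sum.elim (fun j => c (Sum.inl j)) fun j => c (Sum.inr ⟨j.1.succ, ()⟩))
      fun _ => c (Sum.inr ⟨0, ()⟩), fun _ _ => by simp,
    fun j => by
      rcases j with (j | j) | j <;> exact (IsPolyFun.coord _).isRat _,
    fun _ _ hc _ => ⟨⟨hc.1, fun i => hc.2 i.succ⟩, hc.2 0⟩⟩,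
  IsMorphism.of_lift fun _ => ⟨1, fun c => Sum.elim (fun j => c (Sum.inl (Sum.inl j)))
      fun j => Fin.cons (α := fun _ => ℂ) (c (Sum.inr ())) (fun i => c (Sum.inl (Sum.inr ⟨i, ()⟩))) j.1,
    fun _ _ => by simp,
    fun j => by
      rcases j with j | ⟨j, _⟩
      · exact (IsPolyFun.coord _).isRat _
      · refine Fin.cases ?_ (fun i => ?_) j <;> exact (IsPolyFun.coord _).isRat _,
    fun _ _ hc _ => ⟨hc.1.1, fun i => by
      refine Fin.cases ?_ (fun i => ?_) i
      · exact hc.2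
      · exact hc.1.2 i⟩⟩⟩

/-- The coordinates of the affine space are split off one line at a time. -/
theorem isRegularLocalRing_prod_pi_iff [Finite (HomogCoords.idx X)] (x : X) (n : ℕ)
    (v : Fin n → ℂ) :
    IsRegularLocalRing (localRing (X × (Fin n → ℂ)) (x, v)) ↔
      IsRegularLocalRing (localRing X x) := by
  induction n with
  | zero => exact (isVarietyIso_prodUnique.isRegularLocalRing_iff (x, v)).symm
  | succ n ih =>
    have : Finite (HomogCoords.idx (X × (Fin n → ℂ))) :=
      inferInstanceAs (Finite (HomogCoords.idx X ⊕ (Σ _ : Fin n, Unit)))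
    exact ((isVarietyIso_prodPiSucc n).isRegularLocalRing_iff (x, v)).symm.trans
      ((isRegularLocalRing_prod_line_iff (x, fun i : Fin n => v i.succ) (v 0)).trans (ih _))

end AffineSpace

/-! ### Smoothness -/

theorem normOpen_subset_coreOpen (γ : ∀ β : Face, β.Edges) :
    normOpen γ core ⊆ coreOpen fun k => γ (hypersimplex k) :=
  fun _ hz => ⟨hz.1, fun c hc k => hz.2 c hc (hypersimplex k)⟩

theorem isRegularLocalRing_core_iff (γ : ∀ β : Face, β.Edges) (z : normOpen γ core) :
    IsRegularLocalRing (localRing core ⟨z.1, z.2.1⟩) ↔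
      IsRegularLocalRing (localRing (normOpen γ core) z) :=
  isRegularLocalRing_iff_of_open (X := ProjProd) (p := fun z => z ∈ core)
    (q := fun z => z ∈ normOpen γ core) (fun _ h => h.1) (H := normDenom γ)
    (fun _ hy _ hc hne => ⟨hy, fun _ hd i =>
      apply_ne_zero_of_mem_rep hc hd (eval_normDenom_ne_zero.1 hne i)⟩) z.2
    fun c hc => eval_normDenom_ne_zero.2 (z.2.2 c hc)

theorem isRegularLocalRing_bundleN_iff (γ : ∀ β : Face, β.Edges)
    (n : TotalSpace fibreN (normOpen γ core)) :
    IsRegularLocalRing (localRing BundleN ⟨n.1, n.2.1.1, n.2.2⟩) ↔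
      IsRegularLocalRing (localRing (TotalSpace fibreN (normOpen γ core)) n) :=
  isRegularLocalRing_iff_of_open (X := AffineOE × ProjProd)
    (p := fun n => n.2 ∈ core ∧ n.1 ∈ fibreN n.2)
    (q := fun n => n.2 ∈ normOpen γ core ∧ n.1 ∈ fibreN n.2) (fun _ h => ⟨h.1.1, h.2⟩)
    (H := MvPolynomial.rename Sum.inr (normDenom γ))
    (fun _ hy _ hc hne => ⟨⟨hy.1, fun _ hd i => by
      rw [MvPolynomial.eval_rename] at hne
      exact apply_ne_zero_of_mem_rep hc.2 hd (eval_normDenom_ne_zero.1 hne i)⟩, hy.2⟩) n.2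
    fun c hc => by
      rw [MvPolynomial.eval_rename]
      exact eval_normDenom_ne_zero.2 (n.2.1.2 _ hc.2)

/-- Near the point, one nonzero coordinate is chosen in every `ℙ_β`. On that open set the bundle is
trivial and the core has an affine model, so the statement reduces to the product of an affine
variety with `𝔸⁹`. -/
theorem isRegularLocalRing_bundleN_iff_core (n : BundleN) :
    IsRegularLocalRing (localRing BundleN n) ↔
      IsRegularLocalRing (localRing core ⟨n.1.2, n.2.1⟩) := by
  obtain ⟨c, hc⟩ := HomogTorsor.nonempty n.1.2
  have hγ : ∀ β : Face, ∃ α, c ⟨β, α⟩ ≠ 0 := fun β => Function.ne_iff.1 (hc β).1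
  choose γ hγ using hγ
  have hz : n.1.2 ∈ normOpen γ core :=
    ⟨n.2.1, fun d hd β => apply_ne_zero_of_mem_rep hc hd (hγ β)⟩
  have h1 := isRegularLocalRing_bundleN_iff γ ⟨n.1, hz, n.2.2⟩
  have h2 := (isVarietyIso_triv (normOpen_subset_coreOpen γ)).isRegularLocalRing_iff
    ⟨n.1, hz, n.2.2⟩
  have h3 := (isVarietyIso_affineModel_prod γ core (Fin 9 → ℂ)).isRegularLocalRing_iff
    (triv (normOpen_subset_coreOpen γ) ⟨n.1, hz, n.2.2⟩)
  have : Finite (HomogCoords.idx (AffineModel γ core)) :=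
    inferInstanceAs (Finite (Σ _ : (Σ β : Face, β.Edges), Unit))
  have h4 := isRegularLocalRing_prod_pi_iff (affineModel γ core ⟨n.1.2, hz⟩) 9
    (triv (normOpen_subset_coreOpen γ) ⟨n.1, hz, n.2.2⟩).2
  have h5 := (isVarietyIso_affineModel γ core).isRegularLocalRing_iff ⟨n.1.2, hz⟩
  have h6 := isRegularLocalRing_core_iff γ ⟨n.1.2, hz⟩
  exact h1.trans (h2.symm.trans (h3.symm.trans (h4.trans (h5.trans h6.symm))))

theorem isSmoothVariety_bundleN_iff : IsSmoothVariety BundleN ↔ IsSmoothVariety core :=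
  ⟨fun h z => (isRegularLocalRing_bundleN_iff_core ⟨(0, z.1), z.2, Submodule.zero_mem _⟩).1 (h _),
    fun h n => (isRegularLocalRing_bundleN_iff_core n).2 (h _)⟩

end Tetra

theorem mainTheorem2 :
    Tetra.chartUtilde = {e | e ∈ Tetra.completeTetrahedra ∧ e.1 ∈ Tetra.chartU} ∧
    Tetra.IsZariskiClosed Tetra.core ∧
    @IrreducibleSpace Tetra.core (Tetra.zariski Tetra.core) ∧
    @topologicalKrullDim Tetra.core (Tetra.zariski Tetra.core) = 3 ∧
    Tetra.IsVectorBundle Tetra.core Tetra.fibreN 9 ∧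
    (∃ Φ : Tetra.chartUtilde ≃ Tetra.BundleN,
      Tetra.IsVarietyIso Φ ∧
      (∀ e : Tetra.chartUtilde, Tetra.IsChartImage e.1 (Φ e).1) ∧
      ∀ b : Tetra.G, Tetra.IsLowerTriangular b → ∀ e : Tetra.chartUtilde,
        ∃ e' : Tetra.chartUtilde, Tetra.IsTranslate b e.1 e'.1 ∧
          (Φ e').1 = Tetra.actB b (Φ e).1) ∧
    (Tetra.IsSmoothVariety Tetra.chartUtilde ↔ Tetra.IsSmoothVariety Tetra.core) :=
  ⟨Tetra.chartUtilde_eq, Tetra.isZariskiClosed_core, Tetra.irreducibleSpace_core,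
    Tetra.topologicalKrullDim_core, Tetra.isVectorBundle_fibreN,
    ⟨Tetra.chart, Tetra.isVarietyIso_chart, Tetra.isChartImage_chart,
      fun _ hb e => Tetra.exists_isTranslate hb e⟩,
    Tetra.isVarietyIso_chart.isSmoothVariety_iff.trans Tetra.isSmoothVariety_bundleN_iff⟩
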